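/- Let $L>0$, $N\in\mathbb{N}$ with $N\ge 1$, $h=L/N$, and $J_k=[(k-1)h,kh]$ for $k=1,\dots,N$. Let $\bar x_k,x_k\in J_k$ be arbitrary points, $k=1,\dots,N$, and let $\alpha>0$ and $\mu,\nu\in\mathbb{R}$. Write $L^p_{per}$ and $H^1_{per}$ for the Lebesgue and Sobolev spaces of real $L$-periodic functions on $[0,L]$, and $H^{-1}_{per}$ for the dual of $H^1_{per}$; functions in $H^1_{per}$ are identified with their continuous representatives, and $\delta(\cdot-a)\in H^{-1}_{per}$ is given by $\langle\delta(\cdot-a),v\rangle=v(a)$. Consider $$\frac{\partial u}{\partial t}-\nu u_{xx}-\alpha u+u^3=-\mu\sum_{k=1}^{N}h\,u(\bar x_k)\,\delta(x-x_k),\qquad u(x,t)=u(x+L,t),\qquad u(0)=u_0. \tag{1}$$ For $T>0$, a solution of (1) on $[0,T]$ is a function $$u\in C([0,T];L^2_{per})\cap L^2(0,T;H^1_{per})\cap L^4(0,T;L^4_{per})$$ with $u(0)=u_0$ such that for every $v\in H^1_{per}$ $$\frac{d}{dt}(u,v)_{L^2}+\nu(u_x,v_x)_{L^2}-\alpha(u,v)_{L^2}+\int_0^L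 u^3v\,dx=-\mu\sum_{k=1}^{N}h\,u(\bar x_k)\,v(x_k)$$ in the sense of distributions on $(0,T)$. Assume $\mu>4\alpha$ and $\nu\ge 2\mu h^2$. Then for every $u_0\in L^2_{per}$ there is a function $u:[0,\infty)\to L^2_{per}$ such that, for every $T>0$, the restriction of $u$ to $[0,T]$ is the unique solution of (1) on $[0,T]$, and $\frac{\partial u}{\partial t}\in L^2(0,T;H^{-1}_{per})$. Moreover, $$\lim_{t\to\infty}\|u(t)\|_{L^2}=0.$$ -/

import Mathlib

open MeasureTheory Set Filter Topology
open scoped ContDiff RealInnerProductSpace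

noncomputable section

namespace NodalFeedback

/-- `L²_per[0, L]`: real square-integrable functions on the circle `ℝ / L ℤ`, which carries the
Lebesgue measure of total mass `L`. -/
abbrev L2per (L : ℝ) [Fact (0 < L)] : Type := Lp ℝ 2 (volume : Measure (AddCircle L))

instance fact_one_le_four : Fact ((1 : ENNReal) ≤ 4) := ⟨by norm_num⟩

/-- `L⁴_per[0, L]`. -/
abbrev L4per (L : ℝ) [Fact (0 < L)] : Type := Lp ℝ 4 (volume : Measure (AddCircle L))

/-- `g` is the weak derivative of the periodic function `f`, tested against smooth `L`-periodic
functions. -/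
def IsWeakDeriv {L : ℝ} [Fact (0 < L)] (f g : L2per L) : Prop :=
  ∀ φ : ℝ → ℝ, ContDiff ℝ ∞ φ → Function.Periodic φ L →
    ∫ x in (0 : ℝ)..L, f (x : AddCircle L) * deriv φ x
      = -∫ x in (0 : ℝ)..L, g (x : AddCircle L) * φ x

section Helpers

variable {L : ℝ} [Fact (0 < L)]

theorem ae_comp_mk {P : AddCircle L → Prop} (h : ∀ᵐ y : AddCircle L, P y) :
    ∀ᵐ x : ℝ, x ∈ uIoc 0 L → P (x : AddCircle L) := by
  have h1 := (AddCircle.measurePreserving_mk L 0).quasiMeasurePreserving.ae h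
  rw [zero_add, ae_restrict_iff' measurableSet_Ioc] at h1
  rw [uIoc_of_le (Fact.out : 0 < L).le]
  exact h1

theorem intervalIntegrable_coe (f : L2per L) (a b : ℝ) :
    IntervalIntegrable (fun x : ℝ => f (x : AddCircle L)) volume a b := by
  have hf : Integrable (f : AddCircle L → ℝ) := (Lp.memLp f).integrable (by norm_num)
  have h1 : IntervalIntegrable (fun x : ℝ => f (x : AddCircle L)) volume 0 (0 + L) := by
    rw [intervalIntegrable_iff_integrableOn_Ioc_of_le (by
      simpa using (Fact.out : 0 < L).le)]
    exact (AddCircle.measurePreserving_mk L 0).integrable_comp_of_integrable hf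
  refine Function.Periodic.intervalIntegrable (T := L) ?_ (Fact.out : 0 < L).ne' h1 a b
  intro x
  simp

theorem intervalIntegrable_coe_mul (f : L2per L) {φ : ℝ → ℝ} (hφ : Continuous φ) (a b : ℝ) :
    IntervalIntegrable (fun x : ℝ => f (x : AddCircle L) * φ x) volume a b :=
  (intervalIntegrable_coe f a b).mul_continuousOn hφ.continuousOn

theorem integral_add_mul (f g : L2per L) {φ : ℝ → ℝ} (hφ : Continuous φ) :
    ∫ x in (0 : ℝ)..L, (f + g : L2per L) (x : AddCircle L) * φ x
      = (∫ x in (0 : ℝ)..L, f (x : AddCircle L) * φ x)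
        + ∫ x in (0 : ℝ)..L, g (x : AddCircle L) * φ x := by
  rw [← intervalIntegral.integral_add (intervalIntegrable_coe_mul f hφ 0 L)
    (intervalIntegrable_coe_mul g hφ 0 L)]
  apply intervalIntegral.integral_congr_ae
  filter_upwards [ae_comp_mk (Lp.coeFn_add f g)] with x hx hxm
  rw [hx hxm, Pi.add_apply, add_mul]

theorem integral_smul_mul (c : ℝ) (f : L2per L) (φ : ℝ → ℝ) :
    ∫ x in (0 : ℝ)..L, (c • f : L2per L) (x : AddCircle L) * φ x
      = c * ∫ x in (0 : ℝ)..L, f (x : AddCircle L) * φ x := by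
  rw [← intervalIntegral.integral_const_mul]
  apply intervalIntegral.integral_congr_ae
  filter_upwards [ae_comp_mk (Lp.coeFn_smul c f)] with x hx hxm
  rw [hx hxm, Pi.smul_apply, smul_eq_mul, mul_assoc]

end Helpers

/-- `H¹_per[0, L]`: pairs `(u, u_x)` in `L² × L²` with `u_x` the weak derivative of `u`, with the
inner product `(u, v) + (u_x, v_x)`. -/
def H1per (L : ℝ) [Fact (0 < L)] : Submodule ℝ (WithLp 2 (L2per L × L2per L)) where
  carrier := {p | IsWeakDeriv p.fst p.snd}
  zero_mem' := by
    intro φ _ _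
    have h := fun ψ : ℝ → ℝ => integral_smul_mul (L := L) 0 0 ψ
    simp only [zero_smul, zero_mul] at h
    simp only [WithLp.zero_fst, WithLp.zero_snd, h, neg_zero]
  add_mem' := by
    intro p q hp hq φ hφ hper
    simp only [WithLp.add_fst, WithLp.add_snd]
    rw [integral_add_mul _ _ (hφ.continuous_deriv (by simp)), integral_add_mul _ _ hφ.continuous,
      hp φ hφ hper, hq φ hφ hper]
    ring
  smul_mem' := by
    intro c p hp φ hφ hper
    simp only [WithLp.smul_fst, WithLp.smul_snd]
    rw [integral_smul_mul, integral_smul_mul, hp φ hφ hper]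
    ring

/-- The inclusion `H¹_per → L²_per`. -/
def H1per.toL2 (L : ℝ) [Fact (0 < L)] : H1per L →L[ℝ] L2per L :=
  (WithLp.fstL 2 ℝ (L2per L) (L2per L)).comp (H1per L).subtypeL

/-- The derivative `u ↦ u_x`, from `H¹_per` to `L²_per`. -/
def H1per.dx (L : ℝ) [Fact (0 < L)] : H1per L →L[ℝ] L2per L :=
  (WithLp.sndL 2 ℝ (L2per L) (L2per L)).comp (H1per L).subtypeL

section Representative

variable {L : ℝ} [Fact (0 < L)]

theorem fourier_antideriv (n : ℤ) (hn : n ≠ 0) :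
    ∃ E : ℝ → ℂ, ContDiff ℝ ∞ E ∧ Function.Periodic E L ∧
      ∀ x : ℝ, HasDerivAt E (fourier (-n) (x : AddCircle L)) x := by
  have hL : (L : ℂ) ≠ 0 := by exact_mod_cast (Fact.out : 0 < L).ne'
  refine ⟨fun x => L / (-2 * Real.pi * Complex.I * n) * fourier (-n) (x : AddCircle L),
    ?_, fun x => by simp, fun x => has_antideriv_at_fourier_neg inferInstance hn x⟩
  simp only [fourier_coe_apply]
  have h : ContDiff ℝ ∞ fun x : ℝ => (x : ℂ) := Complex.ofRealCLM.contDiff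
  fun_prop

theorem exists_continuous_rep (f g : L2per L) (hfg : IsWeakDeriv f g) :
    ∃ c : C(AddCircle L, ℝ), (c : AddCircle L → ℝ) =ᵐ[volume] f := by
  have hL : 0 < L := Fact.out
  set g' : ℝ → ℝ := fun x => g (x : AddCircle L) with hg'
  have hgi : ∀ a b, IntervalIntegrable g' volume a b := intervalIntegrable_coe g
  have hg0 : ∫ x in (0 : ℝ)..L, g' x = 0 := by
    have := hfg (fun _ => 1) contDiff_const (fun _ => rfl)
    simpa using this
  set G : ℝ → ℝ := fun x => ∫ y in (0 : ℝ)..x, g' y with hG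
  have hGc : Continuous G := intervalIntegral.continuous_primitive hgi 0
  have hGp : Function.Periodic G L := by
    intro x
    have hp : Function.Periodic g' L := fun y => by simp [hg']
    simp only [hG]
    rw [hp.intervalIntegral_add_eq_add 0 x hgi, zero_add, hg0, add_zero]
  have hGL : G L = 0 := hg0
  have hG0 : G 0 = 0 := by simp [hG]
  let c0 : C(AddCircle L, ℝ) := ⟨hGp.lift, continuous_quot_lift _ hGc⟩
  have hc0 : ∀ x : ℝ, c0 (x : AddCircle L) = G x := fun x => rfl
  have key : ∀ φ : ℝ → ℝ, ContDiff ℝ ∞ φ → Function.Periodic φ L →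
      ∫ x in (0 : ℝ)..L, (f (x : AddCircle L) - G x) * deriv φ x = 0 := by
    intro φ hφ hper
    have hφd : Continuous (deriv φ) := hφ.continuous_deriv (by simp)
    have h1 : ∫ x in (0 : ℝ)..L, G x * deriv φ x = -∫ x in (0 : ℝ)..L, g' x * φ x := by
      have hac : AbsolutelyContinuousOnInterval G 0 L :=
        (hgi 0 L).absolutelyContinuousOnInterval_intervalIntegral (by simp)
      have hac2 : AbsolutelyContinuousOnInterval φ 0 L := by
        have : φ = fun x => φ 0 + ∫ y in (0 : ℝ)..x, deriv φ y := by
          funext x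
          rw [intervalIntegral.integral_deriv_eq_sub
            (fun y _ => (hφ.differentiable (by simp)) y) (hφd.intervalIntegrable _ _)]
          ring
        rw [this]
        have hk : AbsolutelyContinuousOnInterval (fun _ : ℝ => φ 0) 0 L :=
          ((LipschitzWith.const (φ 0)).lipschitzOnWith).absolutelyContinuousOnInterval
        exact hk.fun_add ((hφd.intervalIntegrable 0 L).absolutelyContinuousOnInterval_intervalIntegral
          (by simp))
      rw [hac.integral_mul_deriv_eq_deriv_mul hac2, hGL, hG0]
      simp only [zero_mul, sub_zero, zero_sub, neg_inj]
      apply intervalIntegral.integral_congr_ae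
      filter_upwards [(hgi 0 L).ae_hasDerivAt_integral] with x hx hxm
      rw [(hx (uIoc_subset_uIcc hxm) 0 (by simp)).deriv]
    have h2 := hfg φ hφ hper
    have h3 : ∫ x in (0 : ℝ)..L, (f (x : AddCircle L) - G x) * deriv φ x
        = (∫ x in (0 : ℝ)..L, f (x : AddCircle L) * deriv φ x)
          - ∫ x in (0 : ℝ)..L, G x * deriv φ x := by
      rw [← intervalIntegral.integral_sub (intervalIntegrable_coe_mul f hφd 0 L)
        ((hGc.fun_mul hφd).intervalIntegrable _ _)]
      simp only [sub_mul]
    rw [h3, h2, h1]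
    simp [hg']
  set m : ℝ := (1 / L) * ∫ x in (0 : ℝ)..L, (f (x : AddCircle L) - G x) with hm
  let c : C(AddCircle L, ℝ) := c0 + ContinuousMap.const _ m
  have hc : ∀ x : ℝ, c (x : AddCircle L) = G x + m := fun x => rfl
  refine ⟨c, ?_⟩
  have hfm : MemLp (fun y : AddCircle L => ((f y - c y : ℝ) : ℂ)) 2 volume :=
    ((Lp.memLp f).sub (c.continuous.memLp_of_hasCompactSupport
      (HasCompactSupport.of_compactSpace _))).ofReal
  have hF : MemLp (fun y : AddCircle L => ((f y - c y : ℝ) : ℂ)) 2 AddCircle.haarAddCircle :=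
    memLp_haarAddCircle_iff.mpr hfm
  have hfi : IntervalIntegrable (fun x : ℝ => f (x : AddCircle L) - G x) volume 0 L :=
    (intervalIntegrable_coe f 0 L).sub (hGc.intervalIntegrable _ _)
  have hcoef : ∀ n : ℤ, fourierCoeff (fun y : AddCircle L => ((f y - c y : ℝ) : ℂ)) n = 0 := by
    intro n
    rw [fourierCoeff_eq_intervalIntegral _ n 0, zero_add]
    by_cases hn : n = 0
    · subst hn
      have : ∫ x in (0 : ℝ)..L, (f (x : AddCircle L) - c (x : AddCircle L)) = 0 := by
        have h4 : ∀ x : ℝ, f (x : AddCircle L) - c (x : AddCircle L)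
            = (f (x : AddCircle L) - G x) - m := fun x => by rw [hc]; ring
        simp only [h4]
        rw [intervalIntegral.integral_sub hfi (by simp), intervalIntegral.integral_const, hm]
        simp only [smul_eq_mul, sub_zero]
        field_simp
        ring
      simp only [neg_zero, fourier_zero, one_smul]
      rw [intervalIntegral.integral_ofReal, this]
      simp
    · obtain ⟨E, hE, hEp, hEd⟩ := fourier_antideriv (L := L) n hn
      have hre : ∀ x : ℝ, deriv (fun y => (E y).re) x = (fourier (-n) (x : AddCircle L)).re :=
        fun x => (Complex.reCLM.hasFDerivAt.comp_hasDerivAt x (hEd x)).deriv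
      have him : ∀ x : ℝ, deriv (fun y => (E y).im) x = (fourier (-n) (x : AddCircle L)).im :=
        fun x => (Complex.imCLM.hasFDerivAt.comp_hasDerivAt x (hEd x)).deriv
      have hsub : ∀ φ : ℝ → ℝ, ContDiff ℝ ∞ φ → Function.Periodic φ L →
          ∫ x in (0 : ℝ)..L, (f (x : AddCircle L) - c (x : AddCircle L)) * deriv φ x = 0 := by
        intro φ hφ hper
        have hφd : Continuous (deriv φ) := hφ.continuous_deriv (by simp)
        have h4 : ∀ x : ℝ, (f (x : AddCircle L) - c (x : AddCircle L)) * deriv φ x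
            = (f (x : AddCircle L) - G x) * deriv φ x - m * deriv φ x :=
          fun x => by rw [hc]; ring
        simp only [h4]
        rw [intervalIntegral.integral_sub (hfi.mul_continuousOn hφd.continuousOn)
          ((continuous_const.fun_mul hφd).intervalIntegrable _ _), key φ hφ hper,
          intervalIntegral.integral_const_mul, intervalIntegral.integral_deriv_eq_sub
            (fun y _ => (hφ.differentiable (by simp)) y) (hφd.intervalIntegrable _ _)]
        have := hper 0
        rw [zero_add] at this
        rw [this]
        ring
      have h1 := hsub (fun y => (E y).re) (Complex.reCLM.contDiff.comp hE)
        (fun x => congrArg Complex.re (hEp x))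
      have h2 := hsub (fun y => (E y).im) (Complex.imCLM.contDiff.comp hE)
        (fun x => congrArg Complex.im (hEp x))
      simp only [hre, him] at h1 h2
      have hcont : Continuous fun x : ℝ => fourier (-n) (x : AddCircle L) :=
        (fourier (-n)).continuous.comp (AddCircle.continuous_mk' L)
      have hfci : IntervalIntegrable (fun x : ℝ => f (x : AddCircle L) - c (x : AddCircle L))
          volume 0 L := (intervalIntegrable_coe f 0 L).sub
            ((c.continuous.comp (AddCircle.continuous_mk' L)).intervalIntegrable _ _)
      have h3 : ∀ x : ℝ, fourier (-n) (x : AddCircle L) •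
          ((f (x : AddCircle L) - c (x : AddCircle L) : ℝ) : ℂ)
          = (((f (x : AddCircle L) - c (x : AddCircle L)) *
              (fourier (-n) (x : AddCircle L)).re : ℝ) : ℂ)
            + (((f (x : AddCircle L) - c (x : AddCircle L)) *
              (fourier (-n) (x : AddCircle L)).im : ℝ) : ℂ) * Complex.I := by
        intro x
        apply Complex.ext <;> simp [mul_comm]
      simp only [h3]
      rw [intervalIntegral.integral_add, intervalIntegral.integral_mul_const,
        intervalIntegral.integral_ofReal, intervalIntegral.integral_ofReal, h1, h2]
      · simp
      · have h6 := hfci.mul_continuousOn (Complex.continuous_re.comp hcont).continuousOn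
        exact ⟨h6.1.ofReal, h6.2.ofReal⟩
      · have h6 := hfci.mul_continuousOn (Complex.continuous_im.comp hcont).continuousOn
        exact IntervalIntegrable.mul_const ⟨h6.1.ofReal, h6.2.ofReal⟩ _
  have hsum := hasSum_sq_fourierCoeff (hF.toLp _)
  have hz : ∀ i : ℤ, ‖fourierCoeff (hF.toLp _ : AddCircle L → ℂ) i‖ ^ 2 = 0 := by
    intro i
    rw [fourierCoeff_congr_ae hF.coeFn_toLp, hcoef]
    simp
  simp only [hz] at hsum
  have hint := hsum.unique hasSum_zero
  rw [integral_eq_zero_iff_of_nonneg (fun _ => by positivity)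
    (Lp.memLp (hF.toLp _)).integrable_norm_pow'] at hint
  suffices h8 : ∀ᵐ y ∂(AddCircle.haarAddCircle : Measure (AddCircle L)), c y = f y by
    have h9 := Measure.ae_smul_measure h8 (ENNReal.ofReal L)
    rwa [← AddCircle.volume_eq_smul_haarAddCircle] at h9
  filter_upwards [hint, hF.coeFn_toLp] with y hy1 hy2
  rw [hy2] at hy1
  have h7 : ‖((f y - c y : ℝ) : ℂ)‖ ^ 2 = 0 := hy1
  rw [pow_eq_zero_iff two_ne_zero, norm_eq_zero, Complex.ofReal_eq_zero, sub_eq_zero] at h7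
  exact h7.symm

end Representative

/-- The continuous representative of `v ∈ H¹_per`; it gives the point values `v(a)`, hence the
action `⟨δ(· - a), v⟩ = v(a)`. -/
def H1per.rep {L : ℝ} [Fact (0 < L)] (v : H1per L) : C(AddCircle L, ℝ) :=
  (exists_continuous_rep _ _ v.2).choose

theorem H1per.rep_ae_eq {L : ℝ} [Fact (0 < L)] (v : H1per L) :
    (H1per.rep v : AddCircle L → ℝ) =ᵐ[volume] H1per.toL2 L v :=
  (exists_continuous_rep _ _ v.2).choose_spec

/-- `H⁻¹_per`, the topological dual of `H¹_per`. -/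
abbrev Hneg1per (L : ℝ) [Fact (0 < L)] : Type := StrongDual ℝ (H1per L)

/-- The embedding `L²_per → H⁻¹_per`, `f ↦ (v ↦ (f, v)_{L²})`. -/
def toHneg1 {L : ℝ} [Fact (0 < L)] (f : L2per L) : Hneg1per L :=
  (innerSL ℝ f).comp (H1per.toL2 L)

/-- Test functions in time: smooth with compact support in `(0, T)`. -/
def IsTimeTest (T : ℝ) (φ : ℝ → ℝ) : Prop :=
  ContDiff ℝ ∞ φ ∧ HasCompactSupport φ ∧ tsupport φ ⊆ Ioo 0 T

/-- `g` is the derivative of `f : (0, T) → E` in the sense of `E`-valued distributions. -/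
def HasWeakTimeDeriv {E : Type*} [NormedAddCommGroup E] [NormedSpace ℝ E] [CompleteSpace E]
    (T : ℝ) (f g : ℝ → E) : Prop :=
  ∀ φ : ℝ → ℝ, IsTimeTest T φ →
    ∫ t in (0 : ℝ)..T, deriv φ t • f t = -∫ t in (0 : ℝ)..T, φ t • g t

/-- `u_t ∈ L²(0, T; H⁻¹_per)`. -/
def TimeDerivMemL2Hneg1 {L : ℝ} [Fact (0 < L)] (T : ℝ) (u : ℝ → L2per L) : Prop :=
  ∃ g : ℝ → Hneg1per L, MemLp g 2 (volume.restrict (Ioo 0 T)) ∧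
    HasWeakTimeDeriv T (fun t => toHneg1 (u t)) g

/-- The right-hand side of the weak formulation at a fixed time, for the state `w ∈ H¹_per` and
the test function `v ∈ H¹_per`:
`ν (w_x, v_x) - α (w, v) + (w³, v) + μ ∑ₖ h w(x̄ₖ) v(xₖ)` with `h = L / N`. -/
def weakForm {L : ℝ} [Fact (0 < L)] (ν α μ : ℝ) {N : ℕ} (xbar x : Fin N → ℝ)
    (w v : H1per L) : ℝ :=
  ν * inner ℝ (H1per.dx L w) (H1per.dx L v)
    - α * inner ℝ (H1per.toL2 L w) (H1per.toL2 L v)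
    + (∫ y : AddCircle L, H1per.rep w y ^ 3 * H1per.rep v y)
    + μ * ∑ k : Fin N, (L / N) * H1per.rep w (xbar k : AddCircle L) * H1per.rep v (x k : AddCircle L)

/-- `u` is a solution on `[0, T]`, with initial value `u₀`, of
`u_t - ν u_xx - α u + u³ = -μ ∑ₖ h u(x̄ₖ) δ(· - xₖ)` with `L`-periodic boundary conditions,
in the class `C([0,T]; L²) ∩ L²(0,T; H¹) ∩ L⁴(0,T; L⁴)`; the equation is meant in the sense of
distributions on `(0, T)` after testing with each `v ∈ H¹_per`. -/
structure IsSolution {L : ℝ} [Fact (0 < L)] (ν α μ : ℝ) {N : ℕ} (xbar x : Fin N → ℝ)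
    (T : ℝ) (u₀ : L2per L) (u : ℝ → L2per L) : Prop where
  continuousOn : ContinuousOn u (Icc 0 T)
  initial : u 0 = u₀
  memL4 : ∃ w : ℝ → L4per L, MemLp w 4 (volume.restrict (Ioo 0 T)) ∧
    ∀ᵐ t ∂(volume.restrict (Ioo 0 T)), (w t : AddCircle L → ℝ) =ᵐ[volume] u t
  weak : ∃ U : ℝ → H1per L, MemLp U 2 (volume.restrict (Ioo 0 T)) ∧
    (∀ᵐ t ∂(volume.restrict (Ioo 0 T)), H1per.toL2 L (U t) = u t) ∧
    ∀ v : H1per L, ∀ φ : ℝ → ℝ, IsTimeTest T φ →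
      ∫ t in (0 : ℝ)..T, deriv φ t * inner ℝ (u t) (H1per.toL2 L v)
        = ∫ t in (0 : ℝ)..T, φ t * weakForm ν α μ xbar x (U t) v

end NodalFeedback

end

/-! Write `V` for `H¹_per`, `H` for `L²_per` and `j : V → H` for the inclusion. The Riesz map
identifies the dual of `V` with `V`, and then `j†` is the embedding of `H` into the dual. The
equation becomes `j†j u' + 𝒜 u = 0` in `V`, where `𝒜` (`nodalOp`) is a bounded linear operator plus
`j†` of the cube.

Everything rests on the strong monotonicity of `𝒜`. On one cell of length `h`, the oscillation of
`w` squared is at most `h ∫ w_x²`, so the product of two nodal values controls the local mass: `h ∑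
w(x̄ₖ) w(xₖ) ≥ ‖w‖²/4 - h² ‖w_x‖²` (`nodal_inequality`). Hence the linear part is coercive with `c =
min (ν - μh²) (μ/4 - α) > 0` (`exists_coercive`). The cube is increasing and only helps
(`nodalOp_mono`).

The second pillar is the energy identity (`exists_continuous_energy`): a function in `L²(0,T;V)`
whose derivative is in `L²(0,T;V')` is continuous into `H`, and `‖u‖²` obeys the chain rule. It is
proved with the resolvents `(j†j + ε)⁻¹` in place of mollification in time. Applied to a difference
of solutions it gives uniqueness. Applied to one solution it shows that `‖u(t)‖` decreases and that
`2c ∫ ‖u‖_V² ≤ ‖u₀‖²`, so `2cT ‖u(T)‖² ≤ ‖u₀‖²`, which forces decay.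

Existence has three layers. The linear equation `j†j u' + κu = f` is solved by duality in
`L²(0,T;V)` (`exists_linear_evolution`); a contraction argument replaces `κ` by a Lipschitz strongly
monotone operator (`exists_monotone_evolution`); the cube is then the limit of its truncations
(`exists_evolution_of_approx`), where monotonicity makes the approximate solutions Cauchy and
Agmon's inequality bounds the truncation error. The du Bois-Reymond lemma relates the distributional
formulation to the integrated one in which all this takes place. -/

noncomputable section

open scoped InnerProduct

namespace NodalFeedback

/-! ### Chain rule for Bochner primitives. -/

section Primitive

variable {E : Type*} [NormedAddCommGroup E] [InnerProductSpace ℝ E] [CompleteSpace E]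

/-- Transfers absolute continuity from the real primitive of `‖f‖` to the vector-valued primitive of
`f`, and from there to quadratic expressions in it. -/
theorem absolutelyContinuousOnInterval_of_dist_le {X Y : Type*} [PseudoMetricSpace X]
    [PseudoMetricSpace Y] {f : ℝ → X} {g : ℝ → Y} {a b K : ℝ}
    (hg : AbsolutelyContinuousOnInterval g a b)
    (h : ∀ x ∈ uIcc a b, ∀ y ∈ uIcc a b, dist (f x) (f y) ≤ K * dist (g x) (g y)) :
    AbsolutelyContinuousOnInterval f a b := by
  rw [absolutelyContinuousOnInterval_iff] at hg ⊢
  intro ε hε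
  -- `|K| + 1` is positive whatever the sign of `K`, so the division is legitimate.
  obtain ⟨δ, hδ, H⟩ := hg (ε / (|K| + 1)) (by positivity)
  refine ⟨δ, hδ, fun e he hsum => ?_⟩
  have h1 := H e he hsum
  calc ∑ i ∈ Finset.range e.1, dist (f (e.2 i).1) (f (e.2 i).2)
      ≤ ∑ i ∈ Finset.range e.1, (|K| + 1) * dist (g (e.2 i).1) (g (e.2 i).2) := by
        refine Finset.sum_le_sum fun i hi => ?_
        have hm := he.1 i hi
        refine (h _ hm.1 _ hm.2).trans ?_
        gcongr
        linarith [le_abs_self K]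
    _ = (|K| + 1) * ∑ i ∈ Finset.range e.1, dist (g (e.2 i).1) (g (e.2 i).2) := by
        rw [Finset.mul_sum]
    _ < (|K| + 1) * (ε / (|K| + 1)) := by gcongr
    _ = ε := by field_simp

/-- The chain rule for a symmetric quadratic form of a Bochner primitive. -/
theorem inner_primitive_sub (S : E →L[ℝ] E) (hS : ∀ x y, ⟪S x, y⟫ = ⟪x, S y⟫)
    {f : ℝ → E} {a b : ℝ} (hf : IntervalIntegrable f volume a b) (c : E) :
    ⟪S (c + ∫ r in a..b, f r), c + ∫ r in a..b, f r⟫ - ⟪S c, c⟫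
      = 2 * ∫ s in a..b, ⟪S (c + ∫ r in a..s, f r), f s⟫ := by
  set F : ℝ → E := fun s => c + ∫ r in a..s, f r with hF
  have hsub : ∀ x ∈ uIcc a b, IntervalIntegrable f volume a x := fun x hx =>
    hf.mono_set (uIcc_subset_uIcc_left hx)
  have hdist : ∀ x ∈ uIcc a b, ∀ y ∈ uIcc a b, ‖F x - F y‖
      ≤ |(∫ r in a..x, ‖f r‖) - ∫ r in a..y, ‖f r‖| := by
    intro x hx y hy
    have e1 : F x - F y = ∫ r in y..x, f r := by
      simp only [hF]
      rw [add_sub_add_left_eq_sub, intervalIntegral.integral_interval_sub_left (hsub x hx)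
        (hsub y hy)]
    rw [e1, intervalIntegral.integral_interval_sub_left (hsub x hx).norm (hsub y hy).norm]
    exact intervalIntegral.norm_integral_le_abs_integral_norm
  have hN : AbsolutelyContinuousOnInterval (fun x => ∫ r in a..x, ‖f r‖) a b :=
    hf.norm.absolutelyContinuousOnInterval_intervalIntegral (by simp)
  have hFac : AbsolutelyContinuousOnInterval F a b :=
    absolutelyContinuousOnInterval_of_dist_le (K := 1) hN fun x hx y hy => by
      rw [dist_eq_norm, one_mul, Real.dist_eq]
      exact hdist x hx y hy
  obtain ⟨C, hC⟩ := hFac.exists_bound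
  have hC0 : 0 ≤ C := (norm_nonneg _).trans (hC a (by simp))
  have hq : AbsolutelyContinuousOnInterval (fun s => ⟪S (F s), F s⟫) a b := by
    refine absolutelyContinuousOnInterval_of_dist_le (K := 2 * ‖S‖ * C) hFac ?_
    intro x hx y hy
    rw [Real.dist_eq, dist_eq_norm]
    have e : ⟪S (F x), F x⟫ - ⟪S (F y), F y⟫
        = ⟪S (F x), F x - F y⟫ + ⟪S (F x - F y), F y⟫ := by
      simp only [map_sub, inner_sub_left, inner_sub_right]; ring
    rw [e]
    have h1 : |⟪S (F x), F x - F y⟫| ≤ ‖S‖ * C * ‖F x - F y‖ := by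
      refine (abs_real_inner_le_norm _ _).trans ?_
      gcongr
      exact (S.le_opNorm _).trans (by gcongr; exact hC x hx)
    have h2 : |⟪S (F x - F y), F y⟫| ≤ ‖S‖ * ‖F x - F y‖ * C := by
      refine (abs_real_inner_le_norm _ _).trans ?_
      gcongr
      · exact S.le_opNorm _
      · exact hC y hy
    calc _ ≤ _ := abs_add_le _ _
      _ ≤ _ := add_le_add h1 h2
      _ = _ := by ring
  -- The quadratic form is a real absolutely continuous function, hence the integral of its
  -- derivative; by symmetry of `S` the two terms of the product rule coincide at almost every time.
  have hfin := hq.integral_deriv_eq_sub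
  have hFa : F a = c := by simp [hF]
  rw [hFa] at hfin
  rw [← hfin, ← intervalIntegral.integral_const_mul]
  apply intervalIntegral.integral_congr_ae
  filter_upwards [hf.ae_hasDerivAt_integral] with x hx hxm
  have hd : HasDerivAt F (f x) x :=
    (hx (uIoc_subset_uIcc hxm) a (by simp)).const_add c
  have hd2 : HasDerivAt (fun s => S (F s)) (S (f x)) x := S.hasFDerivAt.comp_hasDerivAt x hd
  rw [(hd2.inner ℝ hd).deriv, hS (f x), real_inner_comm (f x) (S (F x))]
  ring

end Primitive

/-! ### Weak convergence and solvability by duality in Hilbert spaces. -/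

section Hilbert

variable {E : Type*} [NormedAddCommGroup E] [InnerProductSpace ℝ E]
variable {X : Type*} [NormedAddCommGroup X] [InnerProductSpace ℝ X] [CompleteSpace X]
variable {Y : Type*} [NormedAddCommGroup Y] [InnerProductSpace ℝ Y] [CompleteSpace Y]

/-- A bounded family that converges weakly to zero against a dense set converges weakly to zero. -/
theorem tendsto_inner_zero_of_denseRange {ι α : Type*} {l : Filter ι} {k : α → E}
    (hk : DenseRange k) {x : ι → E} {C : ℝ} (hx : ∀ᶠ i in l, ‖x i‖ ≤ C)
    (h : ∀ a, Tendsto (fun i => ⟪k a, x i⟫) l (𝓝 0)) (g : E) :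
    Tendsto (fun i => ⟪g, x i⟫) l (𝓝 0) := by
  rw [Metric.tendsto_nhds]
  intro ε hε
  obtain ⟨a, ha⟩ := hk.exists_dist_lt g (show 0 < ε / (2 * (|C| + 1)) by positivity)
  have h1 := (Metric.tendsto_nhds.mp (h a)) (ε / 2) (by positivity)
  filter_upwards [h1, hx] with i hi hxi
  rw [Real.dist_eq, sub_zero] at hi ⊢
  have e : ⟪g, x i⟫ = ⟪g - k a, x i⟫ + ⟪k a, x i⟫ := by rw [inner_sub_left]; ring
  have h2 : |⟪g - k a, x i⟫| ≤ ε / (2 * (|C| + 1)) * (|C| + 1) := by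
    refine (abs_real_inner_le_norm _ _).trans ?_
    rw [dist_eq_norm] at ha
    gcongr
    linarith [le_abs_self C]
  have h3 : ε / (2 * (|C| + 1)) * (|C| + 1) = ε / 2 := by field_simp
  rw [e]
  linarith [abs_add_le ⟪g - k a, x i⟫ ⟪k a, x i⟫]

theorem integrable_inner_of_memLp {α : Type*} [MeasurableSpace α] {μ : Measure α} {f g : α → E}
    (hf : MemLp f 2 μ) (hg : MemLp g 2 μ) : Integrable (fun a => ⟪f a, g a⟫) μ := by
  refine (hf.norm.integrable_mul hg.norm).mono (hf.1.inner hg.1) (Eventually.of_forall fun a => ?_)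
  refine (norm_inner_le_norm _ _).trans ?_
  simp

/-- A functional dominated by `‖S ·‖` is in the range of the adjoint of `S`. -/
theorem exists_adjoint_eq_of_le (S : X →L[ℝ] Y) (F : X) (C : ℝ)
    (h : ∀ x, |⟪F, x⟫| ≤ C * ‖S x‖) : ∃ y, ContinuousLinearMap.adjoint S y = F := by
  let φ : X →ₗ[ℝ] ℝ := (innerSL ℝ F).toLinearMap
  -- The bound makes `φ` vanish on the kernel of `S`, so it factors as `ψ ∘ S` algebraically. On the
  -- range of `S` the functional `ψ` is bounded by `C`; Hahn–Banach extends it and Riesz represents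
  -- it. The range need not be closed.
  have hφ : φ ∈ (LinearMap.ker S.toLinearMap).dualAnnihilator := by
    rw [Submodule.mem_dualAnnihilator]
    intro x hx
    have hx' : S x = 0 := hx
    have := h x
    rw [hx', norm_zero, mul_zero] at this
    exact abs_nonpos_iff.mp this
  rw [← LinearMap.range_dualMap_eq_dualAnnihilator_ker] at hφ
  obtain ⟨ψ, hψ⟩ := hφ
  have hψ' : ∀ x, ψ (S x) = ⟪F, x⟫ := fun x => LinearMap.congr_fun hψ x
  let p : Submodule ℝ Y := LinearMap.range S.toLinearMap
  let χ : StrongDual ℝ p := (ψ.comp p.subtype).mkContinuous C (by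
    rintro ⟨_, x, rfl⟩
    change ‖ψ (S x)‖ ≤ C * ‖S x‖
    rw [hψ', Real.norm_eq_abs]
    exact h x)
  obtain ⟨g, hg, -⟩ := exists_extension_norm_eq p χ
  refine ⟨(InnerProductSpace.toDual ℝ Y).symm g, ext_inner_right ℝ fun x => ?_⟩
  rw [ContinuousLinearMap.adjoint_inner_left, InnerProductSpace.toDual_symm_apply, ← hψ']
  exact hg ⟨S x, x, rfl⟩

end Hilbert

/-! ### Energy identity and continuity in `H`, by resolvents of `j†j`. -/

section LionsMagenes

variable {V : Type*} [NormedAddCommGroup V] [InnerProductSpace ℝ V] [CompleteSpace V]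
variable {H : Type*} [NormedAddCommGroup H] [InnerProductSpace ℝ H] [CompleteSpace H]
variable (j : V →L[ℝ] H)

/-- The resolvent `(j†j + ε)⁻¹`. -/
theorem exists_resolvent {ε : ℝ} (hε : 0 < ε) :
    ∃ R : V →L[ℝ] V, (∀ F, (j†) (j (R F)) + ε • R F = F) ∧ ∀ v, R ((j†) (j v) + ε • v) = v := by
  let S : V →L[ℝ] V := (j†).comp j + ε • ContinuousLinearMap.id ℝ V
  let B : V →L[ℝ] V →L[ℝ] ℝ := (innerSL ℝ).comp S
  have hB : ∀ v w, B v w = ⟪S v, w⟫ := fun v w => rfl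
  have hS : ∀ v, S v = (j†) (j v) + ε • v := fun v => rfl
  have hc : IsCoercive B := by
    refine ⟨ε, hε, fun u => ?_⟩
    rw [hB, hS, inner_add_left, ContinuousLinearMap.adjoint_inner_left, inner_smul_left,
      real_inner_self_eq_norm_sq, real_inner_self_eq_norm_sq]
    simp only [conj_trivial]
    nlinarith [sq_nonneg ‖j u‖]
  let e := hc.continuousLinearEquivOfBilin
  have he : ∀ v, e v = S v := fun v => ext_inner_right ℝ fun w => by
    rw [hc.continuousLinearEquivOfBilin_apply, hB]
  refine ⟨e.symm, fun F => ?_, fun v => ?_⟩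
  · rw [← hS]
    change S (e.symm F) = F
    rw [← he, e.apply_symm_apply]
  · rw [← hS, ← he]
    exact e.symm_apply_apply v

variable {j}

theorem resolvent_symm {ε : ℝ} {R : V →L[ℝ] V} (hR : ∀ F, (j†) (j (R F)) + ε • R F = F) (F G : V) :
    ⟪R F, G⟫ = ⟪F, R G⟫ := by
  conv_lhs => rw [← hR G]
  conv_rhs => rw [← hR F]
  rw [inner_add_right, inner_add_left, ContinuousLinearMap.adjoint_inner_left,
    ContinuousLinearMap.adjoint_inner_right, inner_smul_left, inner_smul_right]
  simp

theorem resolvent_inner {ε : ℝ} {R : V →L[ℝ] V} (hR : ∀ F, (j†) (j (R F)) + ε • R F = F) (F v : V) :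
    ⟪F, v⟫ = ⟪j (R F), j v⟫ + ε * ⟪R F, v⟫ := by
  conv_lhs => rw [← hR F]
  rw [inner_add_left, ContinuousLinearMap.adjoint_inner_left, inner_smul_left]
  simp

/-- With `z = R j†j v`, testing the resolvent equation against `z - v` gives `‖j(z - v)‖² + ε⟪z, z -
v⟫ = 0`. Both bounds are read off from this identity. -/
theorem norm_resolvent_le {ε : ℝ} (hε : 0 < ε) {R : V →L[ℝ] V}
    (hR : ∀ F, (j†) (j (R F)) + ε • R F = F) (v : V) :
    ‖R ((j†) (j v))‖ ≤ ‖v‖ ∧ ‖j (R ((j†) (j v)) - v)‖ ^ 2 ≤ ε * (2 * ‖v‖ ^ 2) := by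
  set z := R ((j†) (j v)) with hz
  have h1 := resolvent_inner hR ((j†) (j v)) (z - v)
  rw [ContinuousLinearMap.adjoint_inner_left, ← hz] at h1
  have h2 : ⟪j z, j (z - v)⟫ - ⟪j v, j (z - v)⟫ = ‖j (z - v)‖ ^ 2 := by
    rw [← inner_sub_left, ← map_sub, real_inner_self_eq_norm_sq]
  have h3 : ⟪z, z - v⟫ = ‖z‖ ^ 2 - ⟪z, v⟫ := by
    rw [inner_sub_right, real_inner_self_eq_norm_sq]
  have h4 := real_inner_le_norm z v
  have h5 : ‖z‖ ≤ ‖v‖ := by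
    by_contra! hlt
    have : 0 < ‖z‖ ^ 2 - ⟪z, v⟫ := by nlinarith [norm_nonneg v]
    nlinarith [sq_nonneg ‖j (z - v)‖, mul_pos hε this]
  refine ⟨h5, ?_⟩
  have h6 : ‖j (z - v)‖ ^ 2 = ε * (⟪z, v⟫ - ‖z‖ ^ 2) := by rw [h3] at h1; linarith
  rw [h6]
  gcongr
  nlinarith [norm_nonneg v, norm_nonneg z, sq_nonneg ‖z‖]

theorem denseRange_adjoint (hj : Function.Injective j) : DenseRange (j†) := by
  have h : ((LinearMap.range (j†).toLinearMap)ᗮ : Submodule ℝ V) = ⊥ := by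
    rw [Submodule.eq_bot_iff]
    intro v hv
    apply hj
    rw [map_zero]
    refine ext_inner_left ℝ fun h => ?_
    have := (Submodule.mem_orthogonal _ _).mp hv ((j†) h) ⟨h, rfl⟩
    rw [ContinuousLinearMap.adjoint_inner_left] at this
    rw [this, inner_zero_right]
  have h2 := (Submodule.topologicalClosure_eq_top_iff (K := LinearMap.range (j†).toLinearMap)).mpr h
  have h3 := (Submodule.dense_iff_topologicalClosure_eq_top).mpr h2
  exact h3

/-- Allows identities between elements of `H` to be checked in the dual of `V`. -/
theorem adjoint_injective (hd : DenseRange j) : Function.Injective (j†) := by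
  intro h h' e
  refine hd.eq_of_inner_left ℝ fun v => ?_
  rw [← ContinuousLinearMap.adjoint_inner_left, ← ContinuousLinearMap.adjoint_inner_left, e]

/-- The regularizations are bounded in `V` and converge after applying `j`, so they converge against
the range of `j†`, which is dense because `j` is injective. Weak convergence in `V` is all that the
energy argument uses. -/
theorem tendsto_inner_resolvent (hj : Function.Injective j) {ε : ℕ → ℝ} (hε : ∀ n, 0 < ε n)
    (hε0 : Tendsto ε atTop (𝓝 0)) {R : ℕ → V →L[ℝ] V}
    (hR : ∀ n F, (j†) (j (R n F)) + ε n • R n F = F) (g v : V) :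
    Tendsto (fun n => ⟪g, R n ((j†) (j v))⟫) atTop (𝓝 ⟪g, v⟫) := by
  have h0 : Tendsto (fun n => ‖j (R n ((j†) (j v)) - v)‖) atTop (𝓝 0) := by
    have h1 : Tendsto (fun n => ‖j (R n ((j†) (j v)) - v)‖ ^ 2) atTop (𝓝 0) :=
      squeeze_zero (fun n => sq_nonneg _) (fun n => (norm_resolvent_le (hε n) (hR n) v).2)
        (by simpa using hε0.mul_const (2 * ‖v‖ ^ 2))
    simpa using h1.sqrt
  have h := tendsto_inner_zero_of_denseRange (l := atTop) (denseRange_adjoint hj)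
    (x := fun n => R n ((j†) (j v)) - v) (C := ‖v‖ + ‖v‖)
    (Eventually.of_forall fun n => (norm_sub_le _ _).trans
      (add_le_add_left (norm_resolvent_le (hε n) (hR n) v).1 _))
    (fun h => by
      simp only [ContinuousLinearMap.adjoint_inner_left]
      refine squeeze_zero_norm (fun n => norm_inner_le_norm _ _) ?_
      simpa using h0.const_mul ‖h‖) g
  simp only [inner_sub_right] at h
  simpa using h.add_const ⟪g, v⟫

theorem norm_resolvent_adjoint_le {ε : ℝ} (hε : 0 < ε) {R : V →L[ℝ] V}
    (hR : ∀ F, (j†) (j (R F)) + ε • R F = F) (h : H) : ‖j (R ((j†) h))‖ ≤ ‖h‖ := by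
  have h1 := resolvent_inner hR ((j†) h) (R ((j†) h))
  rw [ContinuousLinearMap.adjoint_inner_left, real_inner_self_eq_norm_sq,
    real_inner_self_eq_norm_sq] at h1
  have h2 := real_inner_le_norm h (j (R ((j†) h)))
  by_contra! hlt
  nlinarith [norm_nonneg h, mul_nonneg hε.le (sq_nonneg ‖R ((j†) h)‖)]

/-- The quadratic form of the resolvent recovers the norm of `H`: it equals `⟪j R j† h, h⟫`, and `j
R j† h` is bounded by `‖h‖` and converges weakly to `h`. -/
theorem tendsto_inner_resolvent_adjoint (hj : Function.Injective j) (hd : DenseRange j)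
    {ε : ℕ → ℝ} (hε : ∀ n, 0 < ε n) (hε0 : Tendsto ε atTop (𝓝 0)) {R : ℕ → V →L[ℝ] V}
    (hR : ∀ n F, (j†) (j (R n F)) + ε n • R n F = F) (h : H) :
    Tendsto (fun n => ⟪R n ((j†) h), (j†) h⟫) atTop (𝓝 (‖h‖ ^ 2)) := by
  have h1 := tendsto_inner_zero_of_denseRange (l := atTop) hd
    (x := fun n => j (R n ((j†) h)) - h) (C := ‖h‖ + ‖h‖)
    (Eventually.of_forall fun n => (norm_sub_le _ _).trans
      (add_le_add_left (norm_resolvent_adjoint_le (hε n) (hR n) h) _))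
    (fun v => by
      have h2 := (tendsto_inner_resolvent hj hε hε0 hR ((j†) h) v).sub_const ⟪h, j v⟫
      rw [ContinuousLinearMap.adjoint_inner_left, sub_self] at h2
      refine h2.congr fun n => ?_
      rw [inner_sub_right, real_inner_comm h (j v), ← resolvent_symm (hR n),
        ContinuousLinearMap.adjoint_inner_right, real_inner_comm (j v)]) h
  simp only [inner_sub_right, real_inner_self_eq_norm_sq] at h1
  have h3 := h1.add_const (‖h‖ ^ 2)
  simp only [sub_add_cancel, zero_add] at h3
  refine h3.congr fun n => ?_
  rw [ContinuousLinearMap.adjoint_inner_right, real_inner_comm]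

/-- A criterion for a functional on `V` to extend to `H`. The form `⟪j·, j·⟫ + ε⟪·,·⟫` takes the
value `⟪R F, F⟫` at `R F`, so its Cauchy–Schwarz inequality bounds `⟪F, v⟫`. In the limit `|⟪F, v⟫|
≤ √e ‖j v‖`. -/
theorem exists_adjoint_eq_of_resolvent_bounded {ε : ℕ → ℝ} (hε : ∀ n, 0 < ε n)
    (hε0 : Tendsto ε atTop (𝓝 0)) {R : ℕ → V →L[ℝ] V}
    (hR : ∀ n F, (j†) (j (R n F)) + ε n • R n F = F) {F : V} {e : ℝ}
    (hF : Tendsto (fun n => ⟪R n F, F⟫) atTop (𝓝 e)) : ∃ h, (j†) h = F := by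
  refine exists_adjoint_eq_of_le j F (√e) fun v => ?_
  have h1 : ∀ n, |⟪F, v⟫| ≤ √⟪R n F, F⟫ * √(‖j v‖ ^ 2 + ε n * ‖v‖ ^ 2) := by
    intro n
    have hq : ⟪R n F, F⟫ = ‖j (R n F)‖ ^ 2 + ε n * ‖R n F‖ ^ 2 := by
      rw [real_inner_comm, resolvent_inner (hR n), real_inner_self_eq_norm_sq,
        real_inner_self_eq_norm_sq]
    have hp : 0 ≤ ε n := (hε n).le
    rw [resolvent_inner (hR n) F v, hq, ← Real.sqrt_mul (by positivity)]
    apply Real.le_sqrt_of_sq_le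
    rw [sq_abs]
    have a1 := abs_real_inner_le_norm (j (R n F)) (j v)
    have a2 := abs_real_inner_le_norm (R n F) v
    have a3 : |⟪j (R n F), j v⟫ + ε n * ⟪R n F, v⟫|
        ≤ ‖j (R n F)‖ * ‖j v‖ + ε n * (‖R n F‖ * ‖v‖) := by
      refine (abs_add_le _ _).trans (add_le_add a1 ?_)
      rw [abs_mul, abs_of_nonneg hp]
      gcongr
    rw [← sq_abs]
    refine (pow_le_pow_left₀ (abs_nonneg _) a3 2).trans ?_
    nlinarith [mul_nonneg hp (sq_nonneg (‖j (R n F)‖ * ‖v‖ - ‖R n F‖ * ‖j v‖))]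
  have h2 : Tendsto (fun n => √⟪R n F, F⟫ * √(‖j v‖ ^ 2 + ε n * ‖v‖ ^ 2)) atTop
      (𝓝 (√e * √(‖j v‖ ^ 2 + 0 * ‖v‖ ^ 2))) :=
    hF.sqrt.mul ((hε0.mul_const _).const_add _).sqrt
  have h3 := ge_of_tendsto' h2 h1
  rwa [zero_mul, add_zero, Real.sqrt_sq (norm_nonneg _)] at h3

/-- If `u ∈ L²(0,T;V)` has a time derivative `g ∈ L²(0,T;V')`, here with `V'` identified with `V`
by the Riesz map, then `u` has a representative in `C([0,T];H)`, and the energy identity holds. -/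
theorem exists_continuous_energy (hj : Function.Injective j) (hd : DenseRange j) {T : ℝ}
    (hT : 0 ≤ T) {u g : ℝ → V} (hu : MemLp u 2 (volume.restrict (Ioc 0 T)))
    (hg : MemLp g 2 (volume.restrict (Ioc 0 T))) (u₀ : H)
    (heq : ∀ᵐ t ∂(volume.restrict (Ioc 0 T)), (j†) (j (u t)) = (j†) u₀ + ∫ s in (0 : ℝ)..t, g s) :
    ∃ w : ℝ → H, ContinuousOn w (Icc 0 T) ∧ w 0 = u₀ ∧
      (∀ᵐ t ∂(volume.restrict (Ioc 0 T)), j (u t) = w t) ∧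
      (∀ t ∈ Icc 0 T, (j†) (w t) = (j†) u₀ + ∫ s in (0 : ℝ)..t, g s) ∧
      ∀ t ∈ Icc 0 T, ‖w t‖ ^ 2 = ‖u₀‖ ^ 2 + 2 * ∫ s in (0 : ℝ)..t, ⟪u s, g s⟫ := by
  have hgi : IntervalIntegrable g volume 0 T :=
    (intervalIntegrable_iff_integrableOn_Ioc_of_le hT).mpr (hg.integrable (by norm_num))
  have hug : IntervalIntegrable (fun s => ⟪u s, g s⟫) volume 0 T :=
    (intervalIntegrable_iff_integrableOn_Ioc_of_le hT).mpr (integrable_inner_of_memLp hu hg)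
  have hbd : IntervalIntegrable (fun s => ‖u s‖ * ‖g s‖) volume 0 T :=
    (intervalIntegrable_iff_integrableOn_Ioc_of_le hT).mpr (hu.norm.integrable_mul hg.norm)
  have hsub : ∀ {t}, t ∈ Icc 0 T → uIcc 0 t ⊆ uIcc 0 T := fun {t} ht => by
    rw [uIcc_of_le ht.1, uIcc_of_le hT]; exact Icc_subset_Icc_right ht.2
  set W : ℝ → V := fun t => (j†) u₀ + ∫ s in (0 : ℝ)..t, g s with hW
  set e : ℝ → ℝ := fun t => ‖u₀‖ ^ 2 + 2 * ∫ s in (0 : ℝ)..t, ⟪u s, g s⟫ with he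
  let ε : ℕ → ℝ := fun n => 1 / ((n : ℝ) + 1)
  have hε : ∀ n, 0 < ε n := fun n => by positivity
  have hε0 : Tendsto ε atTop (𝓝 0) := tendsto_one_div_add_atTop_nhds_zero_nat
  choose R hR _ using fun n => exists_resolvent j (hε n)
  have hWc : ContinuousOn W (Icc 0 T) := by
    rw [← uIcc_of_le hT]
    exact continuousOn_const.add
      (intervalIntegral.continuousOn_primitive_interval' hgi (by simp))
  have hec : ContinuousOn e (Icc 0 T) := by
    rw [← uIcc_of_le hT]
    exact continuousOn_const.add (continuousOn_const.mul
      (intervalIntegral.continuousOn_primitive_interval' hug (by simp)))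
  have heq' : ∀ᵐ s : ℝ, s ∈ Ioc 0 T → (j†) (j (u s)) = W s :=
    (ae_restrict_iff' measurableSet_Ioc).mp heq
  -- The chain rule holds for each bounded form `⟪R n W, W⟫`. Since `W = j†j u` almost everywhere,
  -- the integrand is dominated by `‖u‖‖g‖` and tends to `⟪u, g⟫`. The limit exists at every `t`,
  -- not only almost every `t`.
  have hlim : ∀ t ∈ Icc 0 T, Tendsto (fun n => ⟪R n (W t), W t⟫) atTop (𝓝 (e t)) := by
    intro t ht
    have h1 : ∀ n, ⟪R n (W t), W t⟫
        = ⟪R n ((j†) u₀), (j†) u₀⟫ + 2 * ∫ s in (0 : ℝ)..t, ⟪R n (W s), g s⟫ := by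
      intro n
      have := inner_primitive_sub (R n) (resolvent_symm (hR n)) (hgi.mono_set (hsub ht)) ((j†) u₀)
      linarith
    simp only [h1]
    refine (tendsto_inner_resolvent_adjoint hj hd hε hε0 hR u₀).add (Tendsto.const_mul 2 ?_)
    refine intervalIntegral.tendsto_integral_filter_of_dominated_convergence
      (fun s => ‖u s‖ * ‖g s‖) (Eventually.of_forall fun n => ?_)
      (Eventually.of_forall fun n => ?_) (hbd.mono_set (hsub ht)) ?_
    · rw [uIoc_of_le ht.1]
      have h2 : AEStronglyMeasurable W (volume.restrict (Ioc 0 t)) :=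
        (hWc.mono (Ioc_subset_Icc_self.trans (Icc_subset_Icc_right ht.2))).aestronglyMeasurable
          measurableSet_Ioc
      exact ((R n).continuous.comp_aestronglyMeasurable h2).inner
        (hg.1.mono_measure (Measure.restrict_mono (Ioc_subset_Ioc_right ht.2) le_rfl))
    · filter_upwards [heq'] with s hs hsm
      rw [uIoc_of_le ht.1] at hsm
      rw [← hs (Ioc_subset_Ioc_right ht.2 hsm)]
      refine (norm_inner_le_norm _ _).trans ?_
      gcongr
      exact (norm_resolvent_le (hε n) (hR n) _).1
    · filter_upwards [heq'] with s hs hsm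
      rw [uIoc_of_le ht.1] at hsm
      rw [← hs (Ioc_subset_Ioc_right ht.2 hsm)]
      simp only [real_inner_comm (g s)]
      exact tendsto_inner_resolvent hj hε hε0 hR _ _
  -- A finite limit places `W t` in the range of `j†` for every `t`; its preimage is the
  -- representative sought.
  have hex : ∀ t, ∃ h : H, t ∈ Icc 0 T → (j†) h = W t := by
    intro t
    by_cases ht : t ∈ Icc 0 T
    · obtain ⟨h, hh⟩ := exists_adjoint_eq_of_resolvent_bounded hε hε0 hR (hlim t ht)
      exact ⟨h, fun _ => hh⟩
    · exact ⟨0, fun h => absurd h ht⟩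
  choose w hw using hex
  have hnorm : ∀ t ∈ Icc 0 T, ‖w t‖ ^ 2 = e t := by
    intro t ht
    have h1 := tendsto_inner_resolvent_adjoint hj hd hε hε0 hR (w t)
    rw [hw t ht] at h1
    exact tendsto_nhds_unique h1 (hlim t ht)
  refine ⟨w, ?_, ?_, ?_, hw, hnorm⟩
  · intro t ht
    -- Strong continuity at `t` follows from weak continuity, inherited from `W`, together with
    -- continuity of the norm, inherited from `e`. The local bound extends weak convergence from the
    -- range of `j` to all of `H`.
    have hb : ∀ᶠ s in 𝓝[Icc 0 T] t, ‖w s - w t‖ ≤ √(e t + 1) + ‖w t‖ := by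
      have h1 : ∀ᶠ s in 𝓝[Icc 0 T] t, e s < e t + 1 :=
        (hec t ht).eventually (gt_mem_nhds (by linarith))
      filter_upwards [h1, self_mem_nhdsWithin] with s hs hsm
      refine (norm_sub_le _ _).trans (add_le_add_left ?_ _)
      apply Real.le_sqrt_of_sq_le
      rw [hnorm s hsm]
      exact hs.le
    have hweak := tendsto_inner_zero_of_denseRange hd hb (fun v => by
      have h1 : Tendsto (fun s => ⟪v, W s⟫ - ⟪v, W t⟫) (𝓝[Icc 0 T] t) (𝓝 0) := by
        have := Tendsto.inner (𝕜 := ℝ) (tendsto_const_nhds (x := v)) (hWc t ht)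
        simpa using this.sub_const ⟪v, W t⟫
      refine h1.congr' ?_
      filter_upwards [self_mem_nhdsWithin] with s hs
      rw [← hw s hs, ← hw t ht, inner_sub_right, ContinuousLinearMap.adjoint_inner_right,
        ContinuousLinearMap.adjoint_inner_right]) (w t)
    have hsq : Tendsto (fun s => ‖w s - w t‖ ^ 2) (𝓝[Icc 0 T] t) (𝓝 0) := by
      have h1 : Tendsto (fun s => (e s - e t) - 2 * ⟪w t, w s - w t⟫) (𝓝[Icc 0 T] t)
          (𝓝 ((e t - e t) - 2 * 0)) :=
        ((hec t ht).tendsto.sub_const _).sub (hweak.const_mul 2)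
      rw [sub_self, mul_zero, sub_zero] at h1
      refine h1.congr' ?_
      filter_upwards [self_mem_nhdsWithin] with s hs
      rw [← hnorm s hs, ← hnorm t ht, norm_sub_sq_real, inner_sub_right,
        real_inner_self_eq_norm_sq, real_inner_comm]
      ring
    rw [ContinuousWithinAt, tendsto_iff_norm_sub_tendsto_zero]
    simpa using hsq.sqrt
  · apply adjoint_injective hd
    rw [hw 0 ⟨le_rfl, hT⟩]
    simp [hW]
  · rw [ae_restrict_iff' measurableSet_Ioc]
    filter_upwards [heq'] with s hs hsm
    apply adjoint_injective hd
    rw [hs hsm, hw s (Ioc_subset_Icc_self hsm)]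

end LionsMagenes

/-- The quadratic polynomial `c ↦ ∫ (f - c)²` is nonnegative, so its discriminant is nonpositive. -/
theorem sq_integral_le {α : Type*} [MeasurableSpace α] {μ : Measure α} [IsFiniteMeasure μ]
    {f : α → ℝ} (hf : MemLp f 2 μ) :
    (∫ a, f a ∂μ) ^ 2 ≤ μ.real univ * ∫ a, f a ^ 2 ∂μ := by
  have h1 : Integrable f μ := hf.integrable (by norm_num)
  have h2 : Integrable (fun a => f a ^ 2) μ := hf.integrable_sq
  have h : ∀ c : ℝ, 0 ≤ μ.real univ * (c * c) + (-2 * ∫ a, f a ∂μ) * c + ∫ a, f a ^ 2 ∂μ := by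
    intro c
    have h3 : 0 ≤ ∫ a, (f a - c) ^ 2 ∂μ := integral_nonneg fun a => sq_nonneg _
    have h4 : ∫ a, (f a - c) ^ 2 ∂μ
        = ∫ a, (f a ^ 2 - 2 * c * f a) + c * c ∂μ := by
      congr 1; funext a; ring
    have h5 : Integrable (fun a => 2 * c * f a) μ := h1.const_mul _
    have h6 : Integrable (fun a => f a ^ 2 - 2 * c * f a) μ := h2.sub h5
    rw [h4, integral_add h6 (integrable_const _), integral_sub h2 h5, integral_const_mul, integral_const] at h3
    simp only [smul_eq_mul] at h3
    linarith
  have := discrim_le_zero h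
  rw [discrim] at this
  linarith

theorem norm_sq_eq_integral {α : Type*} [MeasurableSpace α] {μ : Measure α} {E : Type*}
    [NormedAddCommGroup E] [InnerProductSpace ℝ E] (f : Lp E 2 μ) :
    ‖f‖ ^ 2 = ∫ a, ‖f a‖ ^ 2 ∂μ := by
  rw [← real_inner_self_eq_norm_sq, L2.inner_def]
  simp only [real_inner_self_eq_norm_sq]

/-! ### Linear and Lipschitz monotone evolution equations. -/

section Evolution

/-- `L²(0, T; V)`. -/
abbrev L2time (V : Type*) [NormedAddCommGroup V] (T : ℝ) : Type _ :=
  Lp V 2 (volume.restrict (Ioc (0 : ℝ) T))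

theorem L2time.intervalIntegrable {V : Type*} [NormedAddCommGroup V] {T : ℝ} (f : L2time V T) {t : ℝ} (ht : t ∈ Icc 0 T) :
    IntervalIntegrable (fun s => f s) volume 0 t := by
  rw [intervalIntegrable_iff_integrableOn_Ioc_of_le ht.1]
  have h : IntegrableOn (fun s => f s) (Ioc 0 T) := (Lp.memLp f).integrable (by norm_num)
  exact h.mono_set (Ioc_subset_Ioc_right ht.2)

theorem L2time.integral_norm_le {V : Type*} [NormedAddCommGroup V] [InnerProductSpace ℝ V] {T : ℝ}
    (hT : 0 ≤ T) (f : L2time V T) : ∫ s in Ioc 0 T, ‖f s‖ ≤ √T * ‖f‖ := by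
  have h3 := sq_integral_le (Lp.memLp f).norm
  rw [← norm_sq_eq_integral] at h3
  have h4 : (volume.restrict (Ioc 0 T)).real univ = T := by
    simp [Measure.real, hT]
  rw [h4] at h3
  refine (abs_le_of_sq_le_sq' (?_ : _ ^ 2 ≤ _) (by positivity)).2
  rw [mul_pow, Real.sq_sqrt hT]
  exact h3

theorem norm_primitive_le_integral {V : Type*} [NormedAddCommGroup V] [NormedSpace ℝ V] {T : ℝ}
    {f : ℝ → V} (hf : IntegrableOn f (Ioc 0 T)) {t : ℝ} (ht : t ∈ Icc 0 T) :
    ‖∫ s in (0 : ℝ)..t, f s‖ ≤ ∫ s in Ioc 0 T, ‖f s‖ := by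
  refine (intervalIntegral.norm_integral_le_integral_norm ht.1).trans ?_
  rw [intervalIntegral.integral_of_le ht.1]
  exact setIntegral_mono_set hf.norm (Eventually.of_forall fun _ => norm_nonneg _)
    (Ioc_subset_Ioc_right ht.2).eventuallyLE

theorem L2time.norm_primitive_le {V : Type*} [NormedAddCommGroup V] [InnerProductSpace ℝ V] {T : ℝ}
    (f : L2time V T) {t : ℝ} (ht : t ∈ Icc 0 T) :
    ‖∫ s in (0 : ℝ)..t, f s‖ ≤ √T * ‖f‖ :=
  (norm_primitive_le_integral ((Lp.memLp f).integrable (by norm_num)) ht).trans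
    (f.integral_norm_le (ht.1.trans ht.2))

theorem L2time.continuousOn_primitive {V : Type*} [NormedAddCommGroup V] [InnerProductSpace ℝ V]
    {T : ℝ} (hT : 0 ≤ T) (f : L2time V T) :
    ContinuousOn (fun t => ∫ s in (0 : ℝ)..t, f s) (Icc 0 T) := by
  have := intervalIntegral.continuousOn_primitive_interval'
    (f.intervalIntegrable (t := T) ⟨hT, le_rfl⟩) (a := 0) (by simp)
  rwa [uIcc_of_le hT] at this

theorem L2time.memLp_primitive {V : Type*} [NormedAddCommGroup V] [InnerProductSpace ℝ V]
    {T : ℝ} (f : L2time V T) :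
    MemLp (fun t => ∫ s in (0 : ℝ)..t, f s) 2 (volume.restrict (Ioc 0 T)) := by
  rcases le_or_gt 0 T with hT | hT
  · refine MemLp.of_bound (((f.continuousOn_primitive hT).mono
      Ioc_subset_Icc_self).aestronglyMeasurable measurableSet_Ioc) (√T * ‖f‖) ?_
    filter_upwards [ae_restrict_mem measurableSet_Ioc] with t ht
    exact f.norm_primitive_le (Ioc_subset_Icc_self ht)
  · simp [Ioc_eq_empty_of_le hT.le]

variable {V : Type*} [NormedAddCommGroup V] [InnerProductSpace ℝ V] [CompleteSpace V]
variable {H : Type*} [NormedAddCommGroup H] [InnerProductSpace ℝ H] [CompleteSpace H]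

/-- The Volterra operator `f ↦ ∫₀ᵗ f` on `L²(0, T; V)`. -/
def volterra (V : Type*) [NormedAddCommGroup V] [InnerProductSpace ℝ V] [CompleteSpace V] (T : ℝ) :
    L2time V T →L[ℝ] L2time V T :=
  LinearMap.mkContinuous
    { toFun := fun f => f.memLp_primitive.toLp _
      map_add' := fun f g => by
        rw [← MemLp.toLp_add, MemLp.toLp_eq_toLp_iff]
        filter_upwards [ae_restrict_mem measurableSet_Ioc] with t ht
        have ht' := Ioc_subset_Icc_self ht
        rw [Pi.add_apply, ← intervalIntegral.integral_add (f.intervalIntegrable ht')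
          (g.intervalIntegrable ht')]
        apply intervalIntegral.integral_congr_ae
        filter_upwards [(ae_restrict_iff' measurableSet_Ioc).mp (Lp.coeFn_add f g)] with s hs hsm
        rw [uIoc_of_le ht'.1] at hsm
        exact hs (Ioc_subset_Ioc_right ht'.2 hsm)
      map_smul' := fun c f => by
        rw [RingHom.id_apply, ← MemLp.toLp_const_smul, MemLp.toLp_eq_toLp_iff]
        filter_upwards [ae_restrict_mem measurableSet_Ioc] with t ht
        have ht' := Ioc_subset_Icc_self ht
        rw [Pi.smul_apply, ← intervalIntegral.integral_smul]
        apply intervalIntegral.integral_congr_ae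
        filter_upwards [(ae_restrict_iff' measurableSet_Ioc).mp (Lp.coeFn_smul c f)] with s hs hsm
        rw [uIoc_of_le ht'.1] at hsm
        exact hs (Ioc_subset_Ioc_right ht'.2 hsm) }
    ((volume.restrict (Ioc (0 : ℝ) T)).real univ ^ ((2 : ENNReal).toReal)⁻¹ * √T) (fun f => by
      rw [mul_assoc]
      refine Lp.norm_le_of_ae_bound (by positivity) ?_
      filter_upwards [f.memLp_primitive.coeFn_toLp, ae_restrict_mem measurableSet_Ioc] with t ht htm
      change ‖(f.memLp_primitive.toLp _ : L2time V T) t‖ ≤ _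
      rw [ht]
      exact f.norm_primitive_le (Ioc_subset_Icc_self htm))

theorem volterra_ae {T : ℝ} (f : L2time V T) :
    ∀ᵐ t ∂(volume.restrict (Ioc 0 T)), volterra V T f t = ∫ s in (0 : ℝ)..t, f s :=
  f.memLp_primitive.coeFn_toLp

/-- Existence for the linear equation `j†j u' + κ u = f`, `j u(0) = u₀`. -/
theorem exists_linear_evolution (j : V →L[ℝ] H) {T : ℝ} (hT : 0 ≤ T) {κ : ℝ} (hκ : 0 < κ)
    (f : L2time V T) (u₀ : H) :
    ∃ u : L2time V T, ∀ᵐ t ∂(volume.restrict (Ioc 0 T)),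
      (j†) (j (u t)) = (j†) u₀ + ∫ s in (0 : ℝ)..t, (f s - κ • u s) := by
  set J : V →L[ℝ] V := (j†).comp j with hJ
  have hJs : ∀ x y, ⟪J x, y⟫ = ⟪x, J y⟫ := fun x y => by
    simp [hJ, ContinuousLinearMap.adjoint_inner_left, ContinuousLinearMap.adjoint_inner_right]
  set JL : L2time V T →L[ℝ] L2time V T := J.compLpL 2 _ with hJL
  have hJLae : ∀ ψ : L2time V T, ∀ᵐ t ∂(volume.restrict (Ioc 0 T)), JL ψ t = J (ψ t) :=
    fun ψ => J.coeFn_compLpL ψ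
  set 𝒯 := volterra V T
  -- Integrated in time, the equation reads `S u = F` in `L²(0,T;V)`. By duality it is solvable once
  -- `⟪F, ψ⟫` is bounded by a multiple of `‖S† ψ‖`.
  let S : L2time V T →L[ℝ] L2time V T := JL + κ • 𝒯
  let F : L2time V T := Lp.const 2 _ ((j†) u₀) + 𝒯 f
  have hconst : ∀ᵐ t ∂(volume.restrict (Ioc 0 T)),
      (Lp.const 2 (volume.restrict (Ioc 0 T)) ((j†) u₀) : L2time V T) t = (j†) u₀ :=
    Lp.coeFn_const 2 _ _
  have hJLs : ∀ φ ψ : L2time V T, ⟪JL φ, ψ⟫ = ⟪φ, JL ψ⟫ := by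
    intro φ ψ
    rw [L2.inner_def, L2.inner_def]
    apply integral_congr_ae
    filter_upwards [hJLae φ, hJLae ψ] with t h1 h2
    rw [h1, h2, hJs]
  have hpair : ∀ ψ : L2time V T, ⟪ψ, 𝒯 (JL ψ)⟫ = 1 / 2 * ‖j (∫ s in (0 : ℝ)..T, ψ s)‖ ^ 2 := by
    intro ψ
    have h1 := inner_primitive_sub J hJs (ψ.intervalIntegrable (t := T) ⟨hT, le_rfl⟩) 0
    simp only [zero_add, map_zero, inner_zero_left, sub_zero] at h1
    have h2 : ⟪ψ, 𝒯 (JL ψ)⟫ = ∫ s in (0 : ℝ)..T, ⟪J (∫ r in (0 : ℝ)..s, ψ r), ψ s⟫ := by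
      rw [L2.inner_def, intervalIntegral.integral_of_le hT]
      apply integral_congr_ae
      filter_upwards [volterra_ae (JL ψ), ae_restrict_mem measurableSet_Ioc] with t h3 htm
      have ht := Ioc_subset_Icc_self htm
      rw [h3, real_inner_comm, ← J.intervalIntegral_comp_comm (ψ.intervalIntegrable ht)]
      congr 1
      apply intervalIntegral.integral_congr_ae
      filter_upwards [(ae_restrict_iff' measurableSet_Ioc).mp (hJLae ψ)] with s hs hsm
      rw [uIoc_of_le ht.1] at hsm
      exact hs (Ioc_subset_Ioc_right ht.2 hsm)
    rw [h2]
    have h4 : ⟪J (∫ s in (0 : ℝ)..T, ψ s), ∫ s in (0 : ℝ)..T, ψ s⟫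
        = ‖j (∫ s in (0 : ℝ)..T, ψ s)‖ ^ 2 := by
      rw [hJ, ContinuousLinearMap.comp_apply, ContinuousLinearMap.adjoint_inner_left,
        real_inner_self_eq_norm_sq]
    rw [h4] at h1
    linarith
  have hF : ∀ ψ : L2time V T,
      |⟪F, ψ⟫| ≤ (‖u₀‖ * √(2 / κ) + ‖f‖ / κ) * ‖(S†) ψ‖ := by
    intro ψ
    -- Pairing `S† ψ` with `𝒯† ψ` produces `½‖j ∫ψ‖² + κ‖φ‖²`. These squares control the two
    -- quantities through which `F` sees `ψ`: the initial value pairs with `j ∫ψ` and the source `f`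
    -- with `φ`.
    set φ := (𝒯†) ψ with hφ
    set a := ‖j (∫ s in (0 : ℝ)..T, ψ s)‖
    have h1 : ⟪φ, (S†) ψ⟫ = 1 / 2 * a ^ 2 + κ * ‖φ‖ ^ 2 := by
      rw [ContinuousLinearMap.adjoint_inner_right]
      change ⟪JL φ + κ • 𝒯 φ, ψ⟫ = _
      rw [inner_add_left, inner_smul_left, hJLs, hφ, ContinuousLinearMap.adjoint_inner_left, hpair,
        ← ContinuousLinearMap.adjoint_inner_right, ← hφ, real_inner_self_eq_norm_sq]
      simp [a]
    have h2 := real_inner_le_norm φ ((S†) ψ)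
    rw [h1] at h2
    have hb : ‖φ‖ ≤ ‖(S†) ψ‖ / κ := by
      rw [le_div_iff₀ hκ]
      by_contra! hlt
      have hpos : 0 < ‖φ‖ := by
        rcases (norm_nonneg φ).eq_or_lt with h0 | h0
        · rw [← h0, zero_mul] at hlt
          exact absurd hlt (norm_nonneg _).not_gt
        · exact h0
      nlinarith [sq_nonneg a]
    have ha : a ≤ √(2 / κ) * ‖(S†) ψ‖ := by
      refine (abs_le_of_sq_le_sq' (?_ : _ ^ 2 ≤ _) (by positivity)).2
      rw [mul_pow, Real.sq_sqrt (by positivity)]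
      have h3 : ‖φ‖ * ‖(S†) ψ‖ ≤ ‖(S†) ψ‖ / κ * ‖(S†) ψ‖ := by gcongr
      have h4 : 2 / κ * ‖(S†) ψ‖ ^ 2 = 2 * (‖(S†) ψ‖ / κ * ‖(S†) ψ‖) := by ring
      rw [h4]
      nlinarith [mul_nonneg hκ.le (sq_nonneg ‖φ‖)]
    have h5 : ⟪F, ψ⟫ = ⟪u₀, j (∫ s in (0 : ℝ)..T, ψ s)⟫ + ⟪f, φ⟫ := by
      change ⟪Lp.const 2 _ ((j†) u₀) + 𝒯 f, ψ⟫ = _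
      rw [inner_add_left, hφ, ContinuousLinearMap.adjoint_inner_right, L2.inner_def,
        ← ContinuousLinearMap.adjoint_inner_left, intervalIntegral.integral_of_le hT,
        ← integral_inner ((Lp.memLp ψ).integrable (by norm_num))]
      congr 1
      apply integral_congr_ae
      filter_upwards [hconst] with t ht
      rw [ht]
    rw [h5]
    refine (abs_add_le _ _).trans ?_
    have h6 := abs_real_inner_le_norm u₀ (j (∫ s in (0 : ℝ)..T, ψ s))
    have h7 := abs_real_inner_le_norm f φ
    have h8 : ‖u₀‖ * a ≤ ‖u₀‖ * (√(2 / κ) * ‖(S†) ψ‖) := by gcongr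
    have h9 : ‖f‖ * ‖φ‖ ≤ ‖f‖ * (‖(S†) ψ‖ / κ) := by gcongr
    calc _ ≤ ‖u₀‖ * (√(2 / κ) * ‖(S†) ψ‖) + ‖f‖ * (‖(S†) ψ‖ / κ) :=
          add_le_add (h6.trans h8) (h7.trans h9)
      _ = _ := by ring
  obtain ⟨u, hu⟩ := exists_adjoint_eq_of_le (S†) F _ hF
  rw [ContinuousLinearMap.adjoint_adjoint] at hu
  refine ⟨u, ?_⟩
  have hu' : JL u + κ • 𝒯 u = Lp.const 2 _ ((j†) u₀) + 𝒯 f := hu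
  have e1 := Lp.coeFn_add (JL u) (κ • 𝒯 u)
  have e2 := Lp.coeFn_smul κ (𝒯 u)
  have e3 := Lp.coeFn_add (Lp.const 2 (volume.restrict (Ioc 0 T)) ((j†) u₀)) (𝒯 f)
  rw [hu'] at e1
  filter_upwards [e1, e2, e3, hJLae u, volterra_ae u, volterra_ae f, hconst,
    ae_restrict_mem measurableSet_Ioc] with t e1 e2 e3 e4 e5 e6 e7 htm
  have ht := Ioc_subset_Icc_self htm
  have h1 : IntervalIntegrable (fun s => κ • u s) volume 0 t := (u.intervalIntegrable ht).smul κ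
  rw [intervalIntegral.integral_sub (f.intervalIntegrable ht) h1, intervalIntegral.integral_smul, ← e5, ← e6]
  simp only [Pi.add_apply, Pi.smul_apply] at e1 e2 e3
  rw [e3, e7, e2, e4] at e1
  change J (u t) = _
  rw [← add_sub_assoc, e1, add_sub_cancel_right]

/-- The energy inequality for a difference of two solutions with the same initial value. -/
theorem integral_inner_sub_nonneg {j : V →L[ℝ] H} (hj : Function.Injective j) (hd : DenseRange j)
    {T : ℝ} (hT : 0 ≤ T) {u u' g g' : ℝ → V} (hu : MemLp u 2 (volume.restrict (Ioc 0 T)))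
    (hu' : MemLp u' 2 (volume.restrict (Ioc 0 T))) (hg : MemLp g 2 (volume.restrict (Ioc 0 T)))
    (hg' : MemLp g' 2 (volume.restrict (Ioc 0 T))) (u₀ : H)
    (heq : ∀ᵐ t ∂(volume.restrict (Ioc 0 T)), (j†) (j (u t)) = (j†) u₀ + ∫ s in (0 : ℝ)..t, g s)
    (heq' : ∀ᵐ t ∂(volume.restrict (Ioc 0 T)),
      (j†) (j (u' t)) = (j†) u₀ + ∫ s in (0 : ℝ)..t, g' s) :
    0 ≤ ∫ s in Ioc 0 T, ⟪u s - u' s, g s - g' s⟫ := by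
  have h_int : ∀ {f : ℝ → V}, MemLp f 2 (volume.restrict (Ioc 0 T)) → ∀ {t}, t ∈ Ioc 0 T →
      IntervalIntegrable f volume 0 t := by
    intro f hf t ht
    rw [intervalIntegrable_iff_integrableOn_Ioc_of_le ht.1.le]
    have h : IntegrableOn f (Ioc 0 T) := hf.integrable (by norm_num)
    exact h.mono_set (Ioc_subset_Ioc_right ht.2)
  obtain ⟨w, -, -, -, -, hw⟩ := exists_continuous_energy hj hd hT (u := fun s => u s - u' s)
    (g := fun s => g s - g' s) (hu.sub hu') (hg.sub hg') 0 (by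
      filter_upwards [heq, heq', ae_restrict_mem measurableSet_Ioc] with t h1 h2 ht
      rw [intervalIntegral.integral_sub (h_int hg ht) (h_int hg' ht), map_sub, map_sub, h1, h2]
      simp)
  have h := hw T ⟨hT, le_rfl⟩
  rw [norm_zero, intervalIntegral.integral_of_le hT] at h
  nlinarith [sq_nonneg ‖w T‖]

/-- Existence for `j†j u' + A u = 0` with `A` Lipschitz and strongly monotone. -/
theorem exists_monotone_evolution {j : V →L[ℝ] H} (hj : Function.Injective j) (hd : DenseRange j)
    {T : ℝ} (hT : 0 ≤ T) {A : V → V} {C c : ℝ} (hc : 0 < c)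
    (hlip : ∀ x y, ‖A x - A y‖ ≤ C * ‖x - y‖)
    (hmono : ∀ x y, c * ‖x - y‖ ^ 2 ≤ ⟪A x - A y, x - y⟫) (hA : A 0 = 0) (u₀ : H) :
    ∃ u : L2time V T, ∀ᵐ t ∂(volume.restrict (Ioc 0 T)),
      (j†) (j (u t)) = (j†) u₀ + ∫ s in (0 : ℝ)..t, -A (u s) := by
  -- With `κc = C² + 1`, expanding `‖κ(x - y) - (A x - A y)‖²` gives the factor `κ² - 2κc + C² = κ²
  -- - C² - 2 = m`, which is below `κ²`. So `w ↦ u`, where `j†j u' + κu = κw - A w`, contracts with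
  -- ratio `√m / κ`, and its fixed point solves the equation.
  set κ : ℝ := (C ^ 2 + 1) / c with hκ
  have hκ0 : 0 < κ := by positivity
  set m : ℝ := κ ^ 2 - C ^ 2 - 2 with hm
  let G : V → V := fun x => κ • x - A x
  have hκc : κ * c = C ^ 2 + 1 := by rw [hκ]; field_simp
  have hGlip : ∀ x y, ‖G x - G y‖ ≤ √m * ‖x - y‖ := by
    intro x y
    have e : G x - G y = κ • (x - y) - (A x - A y) := by
      simp only [G, smul_sub]; abel
    have h1 : ‖G x - G y‖ ^ 2 ≤ m * ‖x - y‖ ^ 2 := by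
      rw [e, norm_sub_sq_real, inner_smul_left, norm_smul, mul_pow, Real.norm_eq_abs, sq_abs,
        conj_trivial, real_inner_comm]
      have h2 := mul_le_mul_of_nonneg_left (hmono x y) hκ0.le
      have h3 : ‖A x - A y‖ ^ 2 ≤ C ^ 2 * ‖x - y‖ ^ 2 := by
        rw [← mul_pow]; exact pow_le_pow_left₀ (norm_nonneg _) (hlip x y) 2
      rw [← mul_assoc, hκc] at h2
      rw [hm]
      linarith
    have h2 := Real.le_sqrt_of_sq_le h1
    rwa [Real.sqrt_mul' _ (sq_nonneg _), Real.sqrt_sq (norm_nonneg _)] at h2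
  have hG : LipschitzWith (√m).toNNReal G := by
    refine LipschitzWith.of_dist_le_mul fun x y => ?_
    rw [dist_eq_norm, dist_eq_norm, Real.coe_toNNReal _ (Real.sqrt_nonneg m)]
    exact hGlip x y
  have hG0 : G 0 = 0 := by simp [G, hA]
  have hmκ : √m < κ := by
    rw [Real.sqrt_lt' hκ0, hm]
    nlinarith [sq_nonneg C]
  choose Γ hΓ using fun w : L2time V T =>
    exists_linear_evolution j hT hκ0 (hG.compLp hG0 w) u₀
  -- The energy inequality gives `0 ≤ ⟪d, q - κ d⟫`, hence `κ‖d‖² ≤ ‖d‖‖q‖`.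
  have hest : ∀ w w', κ * ‖Γ w - Γ w'‖ ≤ √m * ‖w - w'‖ := by
    intro w w'
    set d := Γ w - Γ w'
    have h1 := integral_inner_sub_nonneg hj hd hT (Lp.memLp (Γ w)) (Lp.memLp (Γ w'))
      (g := fun s => hG.compLp hG0 w s - κ • Γ w s) (g' := fun s => hG.compLp hG0 w' s - κ • Γ w' s)
      ((Lp.memLp _).sub ((Lp.memLp _).const_smul κ))
      ((Lp.memLp _).sub ((Lp.memLp _).const_smul κ)) u₀ (hΓ w) (hΓ w')
    set q := hG.compLp hG0 w - hG.compLp hG0 w'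
    have h2 : ∫ s in Ioc 0 T, ⟪Γ w s - Γ w' s, (hG.compLp hG0 w s - κ • Γ w s)
        - (hG.compLp hG0 w' s - κ • Γ w' s)⟫ = ⟪d, q - κ • d⟫ := by
      rw [L2.inner_def]
      apply integral_congr_ae
      filter_upwards [Lp.coeFn_sub (Γ w) (Γ w'), Lp.coeFn_sub q (κ • d), Lp.coeFn_smul κ d,
        Lp.coeFn_sub (hG.compLp hG0 w) (hG.compLp hG0 w')] with s e1 e2 e3 e4
      rw [e2, Pi.sub_apply, e3, Pi.smul_apply, e1, e4, Pi.sub_apply, Pi.sub_apply, smul_sub]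
      congr 1
      abel
    rw [h2, inner_sub_right, inner_smul_right, real_inner_self_eq_norm_sq] at h1
    have h3 : ‖q‖ ≤ √m * ‖w - w'‖ := by
      have := hG.norm_compLp_sub_le hG0 w w'
      rwa [Real.coe_toNNReal _ (Real.sqrt_nonneg m)] at this
    have h4 := real_inner_le_norm d q
    by_contra! hlt
    have hdpos : 0 < ‖d‖ := by
      rcases (norm_nonneg d).eq_or_lt with h0 | h0
      · rw [← h0, mul_zero] at hlt
        exact absurd hlt (mul_nonneg (Real.sqrt_nonneg _) (norm_nonneg _)).not_gt
      · exact h0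
    nlinarith
  have hcontr : ContractingWith (√m / κ).toNNReal Γ := by
    refine ⟨?_, LipschitzWith.of_dist_le_mul fun w w' => ?_⟩
    · rw [Real.toNNReal_lt_one]
      exact (div_lt_one hκ0).mpr hmκ
    · rw [dist_eq_norm, dist_eq_norm, Real.coe_toNNReal _ (by positivity)]
      rw [div_mul_eq_mul_div, le_div_iff₀ hκ0, mul_comm]
      exact hest w w'
  refine ⟨hcontr.fixedPoint Γ, ?_⟩
  set u := hcontr.fixedPoint Γ
  have hfix : Γ u = u := hcontr.fixedPoint_isFixedPt
  have h1 := hΓ u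
  rw [hfix] at h1
  filter_upwards [h1, ae_restrict_mem measurableSet_Ioc] with t ht htm
  rw [ht]
  congr 1
  apply intervalIntegral.integral_congr_ae
  filter_upwards [(ae_restrict_iff' measurableSet_Ioc).mp (hG.coeFn_compLp hG0 u)] with s hs hsm
  rw [uIoc_of_le htm.1.le] at hsm
  rw [hs (Ioc_subset_Ioc_right htm.2 hsm)]
  simp [G]

end Evolution

/-! ### The space `H¹_per`: completeness, density, fundamental theorem of calculus. -/

section Periodic

variable {L : ℝ} [Fact (0 < L)]

/-- Smooth periodic functions separate the points of `L²_per`. -/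
theorem eq_zero_of_integral_smooth_eq_zero (f : L2per L)
    (h : ∀ φ : ℝ → ℝ, ContDiff ℝ ∞ φ → Function.Periodic φ L →
      ∫ x in (0 : ℝ)..L, f (x : AddCircle L) * φ x = 0) : f = 0 := by
  have hF : MemLp (fun y : AddCircle L => ((f y : ℝ) : ℂ)) 2 AddCircle.haarAddCircle :=
    memLp_haarAddCircle_iff.mpr (Lp.memLp f).ofReal
  -- Real and imaginary parts of a Fourier mode are admissible test functions, so every Fourier
  -- coefficient vanishes and Parseval concludes.
  have hcoef : ∀ n : ℤ, fourierCoeff (fun y : AddCircle L => ((f y : ℝ) : ℂ)) n = 0 := by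
    intro n
    rw [fourierCoeff_eq_intervalIntegral _ n 0, zero_add]
    have hE : ContDiff ℝ ∞ fun x : ℝ => fourier (-n) (x : AddCircle L) := by
      simp only [fourier_coe_apply]
      have h : ContDiff ℝ ∞ fun x : ℝ => (x : ℂ) := Complex.ofRealCLM.contDiff
      fun_prop
    have hre : ContDiff ℝ ∞ fun x : ℝ => (fourier (-n) (x : AddCircle L)).re :=
      Complex.reCLM.contDiff.comp hE
    have him : ContDiff ℝ ∞ fun x : ℝ => (fourier (-n) (x : AddCircle L)).im :=
      Complex.imCLM.contDiff.comp hE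
    have h1 := h _ hre (fun x => by simp)
    have h2 := h _ him (fun x => by simp)
    have h3 : ∀ x : ℝ, fourier (-n) (x : AddCircle L) • ((f (x : AddCircle L) : ℝ) : ℂ)
        = ((f (x : AddCircle L) * (fourier (-n) (x : AddCircle L)).re : ℝ) : ℂ)
          + ((f (x : AddCircle L) * (fourier (-n) (x : AddCircle L)).im : ℝ) : ℂ)
            * Complex.I := by
      intro x
      apply Complex.ext <;> simp [mul_comm]
    simp only [h3]
    have i1 := intervalIntegrable_coe_mul f hre.continuous 0 L
    have i2 := intervalIntegrable_coe_mul f him.continuous 0 L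
    rw [intervalIntegral.integral_add, intervalIntegral.integral_mul_const,
      intervalIntegral.integral_ofReal, intervalIntegral.integral_ofReal, h1, h2]
    · simp
    · exact ⟨i1.1.ofReal, i1.2.ofReal⟩
    · exact IntervalIntegrable.mul_const ⟨i2.1.ofReal, i2.2.ofReal⟩ _
  have hsum := hasSum_sq_fourierCoeff (hF.toLp _)
  have hz : ∀ i : ℤ, ‖fourierCoeff (hF.toLp _ : AddCircle L → ℂ) i‖ ^ 2 = 0 := by
    intro i
    rw [fourierCoeff_congr_ae hF.coeFn_toLp, hcoef]
    simp
  simp only [hz] at hsum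
  have h_int := hsum.unique hasSum_zero
  rw [integral_eq_zero_iff_of_nonneg (fun _ => by positivity)
    (Lp.memLp (hF.toLp _)).integrable_norm_pow'] at h_int
  rw [Lp.eq_zero_iff_ae_eq_zero]
  suffices h8 : ∀ᵐ y ∂(AddCircle.haarAddCircle : Measure (AddCircle L)), f y = 0 by
    have h9 := Measure.ae_smul_measure h8 (ENNReal.ofReal L)
    rwa [← AddCircle.volume_eq_smul_haarAddCircle] at h9
  filter_upwards [h_int, hF.coeFn_toLp] with y hy1 hy2
  rw [hy2] at hy1
  have h7 : ‖((f y : ℝ) : ℂ)‖ ^ 2 = 0 := hy1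
  rwa [pow_eq_zero_iff two_ne_zero, norm_eq_zero, Complex.ofReal_eq_zero] at h7

theorem inner_eq_intervalIntegral (f g : L2per L) :
    ⟪f, g⟫ = ∫ x in (0 : ℝ)..L, f (x : AddCircle L) * g (x : AddCircle L) := by
  have h := AddCircle.intervalIntegral_preimage L 0 (fun y : AddCircle L => f y * g y)
  rw [zero_add] at h
  rw [L2.inner_def, h]
  simp [mul_comm]

theorem norm_sq_eq_intervalIntegral (f : L2per L) :
    ‖f‖ ^ 2 = ∫ x in (0 : ℝ)..L, f (x : AddCircle L) ^ 2 := by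
  rw [← real_inner_self_eq_norm_sq, inner_eq_intervalIntegral]
  simp only [sq]

/-- The element of `L²_per` given by a continuous periodic function. -/
def periodicLp {φ : ℝ → ℝ} (hφ : Continuous φ) (hp : Function.Periodic φ L) : L2per L :=
  ContinuousMap.toLp 2 volume ℝ (⟨hp.lift, continuous_quot_lift _ hφ⟩ : C(AddCircle L, ℝ))

theorem periodicLp_ae {φ : ℝ → ℝ} (hφ : Continuous φ) (hp : Function.Periodic φ L) :
    ∀ᵐ x : ℝ, x ∈ uIoc 0 L → periodicLp hφ hp (x : AddCircle L) = φ x :=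
  ae_comp_mk (P := fun y => periodicLp hφ hp y = hp.lift y)
    (ContinuousMap.coeFn_toLp (p := 2) (𝕜 := ℝ) volume
      (⟨hp.lift, continuous_quot_lift _ hφ⟩ : C(AddCircle L, ℝ)))

theorem inner_periodicLp (f : L2per L) {φ : ℝ → ℝ} (hφ : Continuous φ)
    (hp : Function.Periodic φ L) :
    ⟪f, periodicLp hφ hp⟫ = ∫ x in (0 : ℝ)..L, f (x : AddCircle L) * φ x := by
  rw [inner_eq_intervalIntegral]
  apply intervalIntegral.integral_congr_ae
  filter_upwards [periodicLp_ae hφ hp] with x hx hxm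
  rw [hx hxm]

theorem periodic_deriv {L : ℝ} {φ : ℝ → ℝ} (hp : Function.Periodic φ L) :
    Function.Periodic (deriv φ) L := by
  intro x
  rw [← deriv_comp_add_const]
  congr 1
  funext y
  exact hp y

/-- For each test function the weak-derivative condition equates two continuous functions of the
pair. Closedness gives the completeness on which adjoints and the Riesz map depend. -/
theorem isClosed_H1per : IsClosed (H1per L : Set (WithLp 2 (L2per L × L2per L))) := by
  have h : (H1per L : Set (WithLp 2 (L2per L × L2per L)))
      = ⋂ (φ : ℝ → ℝ) (hφ : ContDiff ℝ ∞ φ) (hp : Function.Periodic φ L),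
        {p | ⟪p.fst, periodicLp (hφ.continuous_deriv (by simp)) (periodic_deriv hp)⟫
          = -⟪p.snd, periodicLp hφ.continuous hp⟫} := by
    ext p
    simp only [mem_iInter, mem_ofPred_eq, inner_periodicLp]
    rfl
  rw [h]
  refine isClosed_iInter fun φ => isClosed_iInter fun hφ => isClosed_iInter fun hp => ?_
  refine isClosed_eq ?_ ?_
  · exact (((WithLp.fstL 2 ℝ (L2per L) (L2per L)).continuous).inner continuous_const)
  · exact (((WithLp.sndL 2 ℝ (L2per L) (L2per L)).continuous).inner continuous_const).neg

instance completeSpace_H1per : CompleteSpace (H1per L) :=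
  isClosed_H1per.completeSpace_coe

theorem norm_sq_H1per (w : H1per L) :
    ‖w‖ ^ 2 = ‖H1per.toL2 L w‖ ^ 2 + ‖H1per.dx L w‖ ^ 2 :=
  WithLp.prod_norm_sq_eq_of_L2 (w : WithLp 2 (L2per L × L2per L))

theorem norm_toL2_le (w : H1per L) : ‖H1per.toL2 L w‖ ≤ ‖w‖ := by
  refine (abs_le_of_sq_le_sq' ?_ (norm_nonneg _)).2
  rw [norm_sq_H1per]
  exact le_add_of_nonneg_right (sq_nonneg _)

theorem norm_dx_le (w : H1per L) : ‖H1per.dx L w‖ ≤ ‖w‖ := by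
  refine (abs_le_of_sq_le_sq' ?_ (norm_nonneg _)).2
  rw [norm_sq_H1per]
  exact le_add_of_nonneg_left (sq_nonneg _)

/-- A smooth periodic function as an element of `H¹_per`. -/
theorem exists_H1per_of_smooth {φ : ℝ → ℝ} (hφ : ContDiff ℝ ∞ φ) (hp : Function.Periodic φ L) :
    ∃ v : H1per L, H1per.toL2 L v = periodicLp hφ.continuous hp := by
  have hφd : Continuous (deriv φ) := hφ.continuous_deriv (by simp)
  refine ⟨⟨WithLp.toLp 2 (periodicLp hφ.continuous hp, periodicLp hφd (periodic_deriv hp)), ?_⟩, rfl⟩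
  intro ψ hψ hψp
  have hψd : Continuous (deriv ψ) := hψ.continuous_deriv (by simp)
  have e1 : ∫ x in (0 : ℝ)..L, periodicLp hφ.continuous hp (x : AddCircle L) * deriv ψ x
      = ∫ x in (0 : ℝ)..L, φ x * deriv ψ x := by
    apply intervalIntegral.integral_congr_ae
    filter_upwards [periodicLp_ae hφ.continuous hp] with x hx hxm
    rw [hx hxm]
  have e2 : ∫ x in (0 : ℝ)..L, periodicLp hφd (periodic_deriv hp) (x : AddCircle L) * ψ x
      = ∫ x in (0 : ℝ)..L, deriv φ x * ψ x := by
    apply intervalIntegral.integral_congr_ae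
    filter_upwards [periodicLp_ae hφd (periodic_deriv hp)] with x hx hxm
    rw [hx hxm]
  change ∫ x in (0 : ℝ)..L, periodicLp hφ.continuous hp (x : AddCircle L) * deriv ψ x
    = -∫ x in (0 : ℝ)..L, periodicLp hφd (periodic_deriv hp) (x : AddCircle L) * ψ x
  rw [e1, e2, intervalIntegral.integral_mul_deriv_eq_deriv_mul
    (fun x _ => (hφ.differentiable (by simp) x).hasDerivAt)
    (fun x _ => (hψ.differentiable (by simp) x).hasDerivAt)
    (hφd.intervalIntegrable _ _) (hψd.intervalIntegrable _ _)]
  have h1 := hp 0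
  have h2 := hψp 0
  rw [zero_add] at h1 h2
  rw [h1, h2]
  ring

theorem denseRange_toL2 : DenseRange (H1per.toL2 L) := by
  have h : ((LinearMap.range (H1per.toL2 L).toLinearMap)ᗮ : Submodule ℝ (L2per L)) = ⊥ := by
    rw [Submodule.eq_bot_iff]
    intro f hf
    refine eq_zero_of_integral_smooth_eq_zero f fun φ hφ hp => ?_
    obtain ⟨v, hv⟩ := exists_H1per_of_smooth hφ hp
    rw [← inner_periodicLp f hφ.continuous hp, ← hv]
    exact (Submodule.mem_orthogonal' _ _).mp hf _ ⟨v, rfl⟩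
  exact (Submodule.dense_iff_topologicalClosure_eq_top).mpr
    ((Submodule.topologicalClosure_eq_top_iff
      (K := LinearMap.range (H1per.toL2 L).toLinearMap)).mpr h)

theorem injective_toL2 : Function.Injective (H1per.toL2 L) := by
  rw [injective_iff_map_eq_zero]
  intro v hv
  have hdx : H1per.dx L v = 0 := by
    refine eq_zero_of_integral_smooth_eq_zero _ fun φ hφ hp => ?_
    have h1 : ∫ x in (0 : ℝ)..L, H1per.toL2 L v (x : AddCircle L) * deriv φ x
      = -∫ x in (0 : ℝ)..L, H1per.dx L v (x : AddCircle L) * φ x := v.2 φ hφ hp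
    rw [hv, ← inner_periodicLp _ (hφ.continuous_deriv (by simp)) (periodic_deriv hp),
      inner_zero_left] at h1
    linarith
  have h := norm_sq_H1per v
  rw [hv, hdx, norm_zero] at h
  rw [← norm_eq_zero]
  nlinarith [norm_nonneg v]

/-- The fundamental theorem of calculus in `H¹_per`. -/
theorem rep_sub_rep (v : H1per L) (a b : ℝ) :
    H1per.rep v (b : AddCircle L) - H1per.rep v (a : AddCircle L)
      = ∫ x in a..b, H1per.dx L v (x : AddCircle L) := by
  have hL : 0 < L := Fact.out
  have hweak : ∀ φ : ℝ → ℝ, ContDiff ℝ ∞ φ → Function.Periodic φ L →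
      ∫ x in (0 : ℝ)..L, H1per.toL2 L v (x : AddCircle L) * deriv φ x
        = -∫ x in (0 : ℝ)..L, H1per.dx L v (x : AddCircle L) * φ x := v.2
  set g : ℝ → ℝ := fun x => H1per.dx L v (x : AddCircle L) with hg
  set f : L2per L := H1per.toL2 L v with hf
  have hgi : ∀ a b, IntervalIntegrable g volume a b := intervalIntegrable_coe _
  have hg0 : ∫ x in (0 : ℝ)..L, g x = 0 := by
    have := hweak (fun _ => 1) contDiff_const (fun _ => rfl)
    simpa using this
  set G : ℝ → ℝ := fun x => ∫ y in (0 : ℝ)..x, g y with hG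
  have hGc : Continuous G := intervalIntegral.continuous_primitive hgi 0
  have hGp : Function.Periodic G L := by
    intro x
    have hp : Function.Periodic g L := fun y => by simp [hg]
    simp only [hG]
    rw [hp.intervalIntegral_add_eq_add 0 x hgi, zero_add, hg0, add_zero]
  have hparts : ∀ φ : ℝ → ℝ, ContDiff ℝ ∞ φ →
      ∫ x in (0 : ℝ)..L, G x * deriv φ x = -∫ x in (0 : ℝ)..L, g x * φ x := by
    intro φ hφ
    have hac : AbsolutelyContinuousOnInterval G 0 L :=
      (hgi 0 L).absolutelyContinuousOnInterval_intervalIntegral (by simp)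
    have hac2 : AbsolutelyContinuousOnInterval φ 0 L :=
      (hφ.of_le (by simp)).contDiffOn.absolutelyContinuousOnInterval
    have hGL : G L = 0 := hg0
    have hG0 : G 0 = 0 := by simp [hG]
    rw [hac.integral_mul_deriv_eq_deriv_mul hac2, hGL, hG0]
    simp only [zero_mul, sub_zero, zero_sub, neg_inj]
    apply intervalIntegral.integral_congr_ae
    filter_upwards [(hgi 0 L).ae_hasDerivAt_integral] with x hx hxm
    rw [(hx (uIoc_subset_uIcc hxm) 0 (by simp)).deriv]
  -- The constant of integration, chosen so that `f - G - m` has mean zero.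
  set m : ℝ := (1 / L) * ∫ x in (0 : ℝ)..L, (f (x : AddCircle L) - G x) with hm
  have hcc : Continuous fun x => G x + m := hGc.add continuous_const
  have hcp : Function.Periodic (fun x => G x + m) L := fun x => by simp only [hGp x]
  have hfi := intervalIntegrable_coe f 0 L
  have hK : ∀ ψ : ℝ → ℝ, Continuous ψ →
      ∫ x in (0 : ℝ)..L, (f - periodicLp hcc hcp : L2per L) (x : AddCircle L) * ψ x
        = (∫ x in (0 : ℝ)..L, f (x : AddCircle L) * ψ x) - (∫ x in (0 : ℝ)..L, G x * ψ x)
          - m * ∫ x in (0 : ℝ)..L, ψ x := by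
    intro ψ hψ
    have i1 := intervalIntegrable_coe_mul f hψ 0 L
    have i2 : IntervalIntegrable (fun x => G x * ψ x) volume 0 L :=
      (hGc.mul hψ).intervalIntegrable _ _
    have i3 : IntervalIntegrable (fun x => m * ψ x) volume 0 L :=
      (continuous_const.mul hψ).intervalIntegrable _ _
    rw [← intervalIntegral.integral_const_mul, ← intervalIntegral.integral_sub i1 i2,
      ← intervalIntegral.integral_sub (i1.sub i2) i3]
    apply intervalIntegral.integral_congr_ae
    filter_upwards [ae_comp_mk (Lp.coeFn_sub f (periodicLp hcc hcp)), periodicLp_ae hcc hcp]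
      with x h1 h2 hxm
    rw [h1 hxm, Pi.sub_apply, h2 hxm]
    ring
  -- A smooth periodic `ψ` is its mean plus the derivative of a smooth periodic `φ`. Against `deriv
  -- φ` the difference integrates to zero because `f` and `G` have the same weak derivative; against
  -- constants, by the choice of `m`.
  have hzero : f - periodicLp hcc hcp = 0 := by
    refine eq_zero_of_integral_smooth_eq_zero _ fun ψ hψ hψp => ?_
    set ψm : ℝ := (1 / L) * ∫ x in (0 : ℝ)..L, ψ x with hψm
    set φ : ℝ → ℝ := fun x => ∫ y in (0 : ℝ)..x, (ψ y - ψm) with hφ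
    have hψ' : Continuous fun y => ψ y - ψm := hψ.continuous.sub continuous_const
    have hφd : ∀ x, HasDerivAt φ (ψ x - ψm) x := fun x =>
      (hψ'.integral_hasStrictDerivAt 0 x).hasDerivAt
    have hder : deriv φ = fun x => ψ x - ψm := funext fun x => (hφd x).deriv
    have hφs : ContDiff ℝ ∞ φ := by
      rw [contDiff_infty_iff_deriv, hder]
      exact ⟨fun x => (hφd x).differentiableAt, hψ.sub contDiff_const⟩
    have hφp : Function.Periodic φ L := by
      intro x
      have hp : Function.Periodic (fun y => ψ y - ψm) L := fun y => by simp only [hψp y]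
      have h0 : ∫ y in (0 : ℝ)..L, (ψ y - ψm) = 0 := by
        rw [intervalIntegral.integral_sub (hψ.continuous.intervalIntegrable _ _) (by simp),
          intervalIntegral.integral_const, hψm, smul_eq_mul]
        field_simp
        ring
      simp only [hφ]
      rw [hp.intervalIntegral_add_eq_add 0 x (fun _ _ => hψ'.intervalIntegrable _ _), zero_add,
        h0, add_zero]
    have e1 := hK (deriv φ) (hφs.continuous_deriv (by simp))
    have e2 := hK (fun _ => 1) continuous_const
    have e3 : ∫ x in (0 : ℝ)..L, deriv φ x = 0 := by
      rw [intervalIntegral.integral_deriv_eq_sub (fun y _ => (hφd y).differentiableAt)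
        ((hφs.continuous_deriv (by simp)).intervalIntegrable _ _)]
      have := hφp 0
      rw [zero_add] at this
      rw [this, sub_self]
    rw [hweak φ hφs hφp, hparts φ hφs, e3, sub_self, mul_zero, sub_zero] at e1
    have e4 : ∫ x in (0 : ℝ)..L, (f - periodicLp hcc hcp : L2per L) (x : AddCircle L) * 1 = 0 := by
      rw [e2]
      simp only [mul_one, intervalIntegral.integral_const, smul_eq_mul, sub_zero]
      rw [← intervalIntegral.integral_sub hfi (hGc.intervalIntegrable _ _), hm]
      field_simp
      ring
    have e5 : ∀ x, ψ x = deriv φ x + ψm * 1 := fun x => by rw [hder]; ring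
    simp only [e5, mul_add]
    have i1 := intervalIntegrable_coe_mul (f - periodicLp hcc hcp)
      (hφs.continuous_deriv (by simp)) 0 L
    have i2 := intervalIntegrable_coe_mul (f - periodicLp hcc hcp)
      (continuous_const (y := ψm * 1)) 0 L
    rw [intervalIntegral.integral_add i1 i2, e1, zero_add]
    simp only [mul_one] at e4 ⊢
    rw [intervalIntegral.integral_mul_const, e4, zero_mul]
  have hrep : H1per.rep v = ⟨hcp.lift, continuous_quot_lift _ hcc⟩ := by
    have h1 : (H1per.rep v : AddCircle L → ℝ) =ᵐ[volume]
        (⟨hcp.lift, continuous_quot_lift _ hcc⟩ : C(AddCircle L, ℝ)) := by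
      refine (H1per.rep_ae_eq v).trans ?_
      rw [← hf, sub_eq_zero.mp hzero]
      exact ContinuousMap.coeFn_toLp (p := 2) (𝕜 := ℝ) volume _
    exact DFunLike.coe_injective
      ((H1per.rep v).continuous.ae_eq_iff_eq volume (ContinuousMap.continuous _) |>.mp h1)
  have hr : ∀ x : ℝ, H1per.rep v (x : AddCircle L) = G x + m := fun x => by rw [hrep]; rfl
  rw [hr, hr, add_sub_add_right_eq_sub]
  exact intervalIntegral.integral_interval_sub_left (hgi _ _) (hgi _ _)

end Periodic

theorem integral_norm_mul_norm_le {α : Type*} [MeasurableSpace α] {μ : Measure α} {E F : Type*}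
    [NormedAddCommGroup E] [InnerProductSpace ℝ E] [NormedAddCommGroup F] [InnerProductSpace ℝ F]
    (f : Lp E 2 μ) (g : Lp F 2 μ) : ∫ a, ‖f a‖ * ‖g a‖ ∂μ ≤ ‖f‖ * ‖g‖ := by
  set f' : Lp ℝ 2 μ := (Lp.memLp f).norm.toLp _
  set g' : Lp ℝ 2 μ := (Lp.memLp g).norm.toLp _
  have hf : f' =ᵐ[μ] fun a => ‖f a‖ := (Lp.memLp f).norm.coeFn_toLp
  have hg : g' =ᵐ[μ] fun a => ‖g a‖ := (Lp.memLp g).norm.coeFn_toLp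
  have h1 : ‖f'‖ ≤ ‖f‖ := Lp.norm_le_norm_of_ae_le (by
    filter_upwards [hf] with a ha
    rw [ha, norm_norm])
  have h2 : ‖g'‖ ≤ ‖g‖ := Lp.norm_le_norm_of_ae_le (by
    filter_upwards [hg] with a ha
    rw [ha, norm_norm])
  calc ∫ a, ‖f a‖ * ‖g a‖ ∂μ = ⟪f', g'⟫ := by
        rw [L2.inner_def]
        apply integral_congr_ae
        filter_upwards [hf, hg] with a h3 h4
        rw [h3, h4]
        simp [mul_comm]
    _ ≤ ‖f'‖ * ‖g'‖ := real_inner_le_norm _ _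
    _ ≤ ‖f‖ * ‖g‖ := by gcongr

theorem integrable_norm_mul_norm {α : Type*} [MeasurableSpace α] {μ : Measure α} {E F : Type*}
    [NormedAddCommGroup E] [NormedAddCommGroup F]
    (f : Lp E 2 μ) (g : Lp F 2 μ) : Integrable (fun a => ‖f a‖ * ‖g a‖) μ :=
  (Lp.memLp f).norm.integrable_mul (Lp.memLp g).norm

/-! ### From Lipschitz monotone operators to their limit. -/

section Approximation

variable {V : Type*} [NormedAddCommGroup V] [InnerProductSpace ℝ V] [CompleteSpace V]
variable {H : Type*} [NormedAddCommGroup H] [InnerProductSpace ℝ H] [CompleteSpace H]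

/-- The a priori estimate for a coercive evolution equation. -/
theorem apriori_estimate {j : V →L[ℝ] H} (hj : Function.Injective j) (hd : DenseRange j)
    {T : ℝ} (hT : 0 ≤ T) {A : V → V} {c : ℝ} (hc : 0 < c)
    (hcoer : ∀ x, c * ‖x‖ ^ 2 ≤ ⟪A x, x⟫) {u₀ : H} (u : L2time V T)
    (hA : MemLp (fun s => A (u s)) 2 (volume.restrict (Ioc 0 T)))
    (heq : ∀ᵐ t ∂(volume.restrict (Ioc 0 T)),
      (j†) (j (u t)) = (j†) u₀ + ∫ s in (0 : ℝ)..t, -A (u s)) :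
    (∀ᵐ t ∂(volume.restrict (Ioc 0 T)), ‖j (u t)‖ ≤ ‖u₀‖) ∧ ‖u‖ ≤ √(‖u₀‖ ^ 2 / (2 * c)) := by
  obtain ⟨w, -, -, hw, -, hen⟩ := exists_continuous_energy hj hd hT (Lp.memLp u) hA.neg u₀ heq
  have hnn : ∀ s, ⟪u s, (-fun s => A (u s)) s⟫ ≤ 0 := by
    intro s
    rw [Pi.neg_apply, inner_neg_right, real_inner_comm]
    have := hcoer (u s)
    have : 0 ≤ c * ‖u s‖ ^ 2 := by positivity
    linarith
  constructor
  · filter_upwards [hw, ae_restrict_mem measurableSet_Ioc] with t ht htm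
    rw [ht]
    have h1 := hen t (Ioc_subset_Icc_self htm)
    have h2 := intervalIntegral.integral_nonneg htm.1.le
      (μ := volume) (f := fun s => -⟪u s, (-fun s => A (u s)) s⟫) (fun s _ => by linarith [hnn s])
    rw [intervalIntegral.integral_neg] at h2
    refine (abs_le_of_sq_le_sq' ?_ (norm_nonneg _)).2
    linarith
  · have h1 := hen T ⟨hT, le_rfl⟩
    rw [intervalIntegral.integral_of_le hT] at h1
    have h2 : c * ‖u‖ ^ 2 ≤ ∫ s in Ioc 0 T, -⟪u s, (-fun s => A (u s)) s⟫ := by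
      rw [norm_sq_eq_integral, ← integral_const_mul]
      refine integral_mono ((Lp.memLp u).norm.integrable_sq.const_mul c)
        (integrable_inner_of_memLp (Lp.memLp u) hA.neg).neg fun s => ?_
      have := hcoer (u s)
      simpa [real_inner_comm] using this
    rw [integral_neg] at h2
    apply Real.le_sqrt_of_sq_le
    rw [le_div_iff₀ (by positivity)]
    nlinarith [sq_nonneg ‖w T‖]

/-- Existence for `j†j u' + 𝒜 u = 0`, where the strongly monotone operator `𝒜` is the limit,
uniformly on sets bounded in `H`, of Lipschitz strongly monotone operators. -/
theorem exists_evolution_of_approx {j : V →L[ℝ] H} (hj : Function.Injective j)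
    (hd : DenseRange j) {T : ℝ} (hT : 0 ≤ T) {𝒜 : V → V} {A : ℕ → V → V} {c : ℝ} (hc : 0 < c)
    (hmono : ∀ x y, c * ‖x - y‖ ^ 2 ≤ ⟪𝒜 x - 𝒜 y, x - y⟫)
    (hAmono : ∀ n x y, c * ‖x - y‖ ^ 2 ≤ ⟪A n x - A n y, x - y⟫)
    (hA0 : ∀ n, A n 0 = 0) (hlip : ∀ n, ∃ C, ∀ x y, ‖A n x - A n y‖ ≤ C * ‖x - y‖)
    {u₀ : H} {K : ℝ}
    (hloc : ∀ x y, ‖j x‖ ≤ ‖u₀‖ → ‖j y‖ ≤ ‖u₀‖ →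
      ‖𝒜 x - 𝒜 y‖ ≤ K * (1 + ‖x‖ + ‖y‖) * ‖x - y‖)
    (happ : ∀ n x, ‖j x‖ ≤ ‖u₀‖ → ‖A n x - 𝒜 x‖ ≤ K / (n + 1) * ‖x‖)
    (hmeas : Continuous 𝒜) (hgrowth : ∀ x, ‖j x‖ ≤ ‖u₀‖ → ‖𝒜 x‖ ≤ K * ‖x‖) (hK : 0 ≤ K) :
    ∃ u : L2time V T, (∀ᵐ t ∂(volume.restrict (Ioc 0 T)), ‖j (u t)‖ ≤ ‖u₀‖) ∧
      ∀ᵐ t ∂(volume.restrict (Ioc 0 T)),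
        (j†) (j (u t)) = (j†) u₀ + ∫ s in (0 : ℝ)..t, -𝒜 (u s) := by
  choose C hC using hlip
  choose U hU using fun n =>
    exists_monotone_evolution hj hd hT hc (hC n) (hAmono n) (hA0 n) u₀
  have hAm : ∀ n (f : L2time V T),
      MemLp (fun s => A n (f s)) 2 (volume.restrict (Ioc 0 T)) := by
    intro n f
    have h1 : LipschitzWith (C n).toNNReal (A n) := LipschitzWith.of_dist_le_mul fun x y => by
      rw [dist_eq_norm, dist_eq_norm]
      exact (hC n x y).trans (by gcongr; exact Real.le_coe_toNNReal _)
    exact h1.comp_memLp (hA0 n) (Lp.memLp f)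
  have hcoer : ∀ n x, c * ‖x‖ ^ 2 ≤ ⟪A n x, x⟫ := fun n x => by
    simpa [hA0] using hAmono n x 0
  set B := √(‖u₀‖ ^ 2 / (2 * c)) with hB
  have hB0 : 0 ≤ B := Real.sqrt_nonneg _
  have hbd : ∀ n, ∀ᵐ t ∂(volume.restrict (Ioc 0 T)), ‖j (U n t)‖ ≤ ‖u₀‖ := fun n =>
    (apriori_estimate hj hd hT hc (hcoer n) (U n) (hAm n (U n)) (hU n)).1
  have hUB : ∀ n, ‖U n‖ ≤ B := fun n =>
    (apriori_estimate hj hd hT hc (hcoer n) (U n) (hAm n (U n)) (hU n)).2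
  -- The a priori estimate keeps every `U n` in the ball of `H` where `happ` applies. Inserting `𝒜
  -- (U n)` and `𝒜 (U m)` in the energy inequality, monotonicity of `𝒜` absorbs the main term and
  -- only the approximation errors remain.
  have hest : ∀ n m, c * ‖U n - U m‖ ≤ K / (n + 1) * B + K / (m + 1) * B := by
    intro n m
    set d := U n - U m with hdd
    have hdae : ∀ᵐ s ∂(volume.restrict (Ioc 0 T)), d s = U n s - U m s :=
      Lp.coeFn_sub (U n) (U m)
    have h1 := integral_inner_sub_nonneg hj hd hT (Lp.memLp (U n)) (Lp.memLp (U m))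
      (hAm n (U n)).neg (hAm m (U m)).neg u₀ (hU n) (hU m)
    have hκn : 0 ≤ K / ((n : ℝ) + 1) := by positivity
    have hκm : 0 ≤ K / ((m : ℝ) + 1) := by positivity
    have i0 : Integrable (fun s => c * ‖d s‖ ^ 2) (volume.restrict (Ioc 0 T)) :=
      (Lp.memLp d).norm.integrable_sq.const_mul c
    have i1 : Integrable (fun s => K / ((n : ℝ) + 1) * (‖d s‖ * ‖U n s‖))
      (volume.restrict (Ioc 0 T)) := (integrable_norm_mul_norm d (U n)).const_mul _
    have i2 : Integrable (fun s => K / ((m : ℝ) + 1) * (‖d s‖ * ‖U m s‖))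
      (volume.restrict (Ioc 0 T)) := (integrable_norm_mul_norm d (U m)).const_mul _
    have i12 : Integrable (fun s => K / ((n : ℝ) + 1) * (‖d s‖ * ‖U n s‖)
      + K / ((m : ℝ) + 1) * (‖d s‖ * ‖U m s‖)) (volume.restrict (Ioc 0 T)) := i1.add i2
    have h2 : ∫ s in Ioc 0 T, ⟪U n s - U m s,
          (-fun s => A n (U n s)) s - (-fun s => A m (U m s)) s⟫
        ≤ ∫ s in Ioc 0 T, ((K / ((n : ℝ) + 1) * (‖d s‖ * ‖U n s‖)
          + K / ((m : ℝ) + 1) * (‖d s‖ * ‖U m s‖)) - c * ‖d s‖ ^ 2) := by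
      refine integral_mono_ae (integrable_inner_of_memLp ((Lp.memLp (U n)).sub (Lp.memLp (U m)))
        ((hAm n (U n)).neg.sub (hAm m (U m)).neg)) (i12.sub i0) ?_
      filter_upwards [hdae, hbd n, hbd m] with s hs hsn hsm
      have e : ⟪U n s - U m s, (-fun s => A n (U n s)) s - (-fun s => A m (U m s)) s⟫
          = -⟪𝒜 (U n s) - 𝒜 (U m s), U n s - U m s⟫
            - ⟪U n s - U m s, A n (U n s) - 𝒜 (U n s)⟫
            + ⟪U n s - U m s, A m (U m s) - 𝒜 (U m s)⟫ := by
        rw [real_inner_comm (U n s - U m s) (𝒜 (U n s) - 𝒜 (U m s))]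
        simp only [Pi.neg_apply, inner_sub_right, inner_neg_right]
        ring
      have a1 := hmono (U n s) (U m s)
      have a2 := (neg_le_abs _).trans (abs_real_inner_le_norm (U n s - U m s)
        (A n (U n s) - 𝒜 (U n s)))
      have a3 := real_inner_le_norm (U n s - U m s) (A m (U m s) - 𝒜 (U m s))
      have a4 := mul_le_mul_of_nonneg_left (happ n _ hsn) (norm_nonneg (U n s - U m s))
      have a5 := mul_le_mul_of_nonneg_left (happ m _ hsm) (norm_nonneg (U n s - U m s))
      simp only [hs]
      rw [e]
      nlinarith
    rw [integral_sub i12 i0, integral_add i1 i2, integral_const_mul, integral_const_mul,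
      integral_const_mul, ← norm_sq_eq_integral] at h2
    have b1 := (integral_norm_mul_norm_le d (U n)).trans
      (mul_le_mul_of_nonneg_left (hUB n) (norm_nonneg d))
    have b2 := (integral_norm_mul_norm_le d (U m)).trans
      (mul_le_mul_of_nonneg_left (hUB m) (norm_nonneg d))
    have b3 := mul_le_mul_of_nonneg_left b1 hκn
    have b4 := mul_le_mul_of_nonneg_left b2 hκm
    by_contra! hlt
    have hdpos : 0 < ‖d‖ := by
      rcases (norm_nonneg d).eq_or_lt with h0 | h0
      · rw [← h0, mul_zero] at hlt
        exact absurd hlt (by positivity : 0 ≤ K / ((n : ℝ) + 1) * B + K / (m + 1) * B).not_gt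
      · exact h0
    nlinarith
  have htend0 : Tendsto (fun n : ℕ => 1 / ((n : ℝ) + 1)) atTop (𝓝 0) :=
    tendsto_one_div_add_atTop_nhds_zero_nat
  have hcau : CauchySeq U := by
    refine cauchySeq_of_le_tendsto_0 (fun n : ℕ => 2 * K * B / c * (1 / ((n : ℝ) + 1))) ?_
      (by simpa using htend0.const_mul (2 * K * B / c))
    intro n m N hn hm
    rw [dist_eq_norm]
    have h1 := hest n m
    have h2 : ∀ k, N ≤ k → K / ((k : ℝ) + 1) * B ≤ K / ((N : ℝ) + 1) * B := by
      intro k hk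
      have : (N : ℝ) ≤ k := by exact_mod_cast hk
      gcongr
    have e : 2 * K * B / c * (1 / ((N : ℝ) + 1)) = (2 * (K / ((N : ℝ) + 1) * B)) / c := by
      field_simp
    rw [e, le_div_iff₀ hc]
    linarith [h2 n hn, h2 m hm]
  obtain ⟨u, hu⟩ := cauchySeq_tendsto_of_complete hcau
  -- The integrated equation is pointwise in time, so a subsequence converging at almost every time
  -- is used for its left side.
  obtain ⟨ns, hns, hae⟩ := (tendstoInMeasure_of_tendsto_Lp hu).exists_seq_tendsto_ae
  have hub : ∀ᵐ t ∂(volume.restrict (Ioc 0 T)), ‖j (u t)‖ ≤ ‖u₀‖ := by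
    filter_upwards [hae, ae_all_iff.mpr hbd] with t ht hb
    exact le_of_tendsto' ((j.continuous.tendsto _).comp ht).norm fun i => hb (ns i)
  refine ⟨u, hub, ?_⟩
  have h𝒜m : ∀ f : L2time V T, (∀ᵐ t ∂(volume.restrict (Ioc 0 T)), ‖j (f t)‖ ≤ ‖u₀‖) →
      MemLp (fun s => 𝒜 (f s)) 2 (volume.restrict (Ioc 0 T)) := by
    intro f hf
    refine MemLp.of_le_mul (Lp.memLp f) (hmeas.comp_aestronglyMeasurable (Lp.memLp f).1) (c := K) ?_
    filter_upwards [hf] with s hs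
    exact hgrowth _ hs
  -- The bound in `hloc` is a product of two `L²` functions of time, so the nonlinear terms converge
  -- in `L¹` only; that is enough for their primitives.
  have hdiff : Tendsto (fun n => ∫ s in Ioc 0 T, ‖A n (U n s) - 𝒜 (u s)‖) atTop (𝓝 0) := by
    have hd0 : Tendsto (fun n => ‖U n - u‖) atTop (𝓝 0) :=
      tendsto_iff_norm_sub_tendsto_zero.mp hu
    refine squeeze_zero (g := fun n : ℕ => K * (1 / ((n : ℝ) + 1)) * (√T * B)
      + K * (√T + B + ‖u‖) * ‖U n - u‖) (fun n => integral_nonneg fun s => norm_nonneg _)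
      (fun n => ?_) ?_
    · set d := U n - u with hdd
      have hdae : ∀ᵐ s ∂(volume.restrict (Ioc 0 T)), d s = U n s - u s := Lp.coeFn_sub (U n) u
      have i0 : Integrable (fun s => K / ((n : ℝ) + 1) * ‖U n s‖) (volume.restrict (Ioc 0 T)) :=
        (((Lp.memLp (U n)).integrable (by norm_num)).norm).const_mul _
      have i1 : Integrable (fun s => ‖d s‖) (volume.restrict (Ioc 0 T)) :=
        ((Lp.memLp d).integrable (by norm_num)).norm
      have i2 := integrable_norm_mul_norm (U n) d
      have i3 := integrable_norm_mul_norm u d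
      have i12 : Integrable (fun s => ‖d s‖ + ‖U n s‖ * ‖d s‖) (volume.restrict (Ioc 0 T)) :=
        i1.add i2
      have i4 : Integrable (fun s => K * (‖d s‖ + ‖U n s‖ * ‖d s‖ + ‖u s‖ * ‖d s‖))
        (volume.restrict (Ioc 0 T)) := (i12.add i3).const_mul K
      have h1 : ∫ s in Ioc 0 T, ‖A n (U n s) - 𝒜 (u s)‖ ≤ ∫ s in Ioc 0 T,
          (K / ((n : ℝ) + 1) * ‖U n s‖ + K * (‖d s‖ + ‖U n s‖ * ‖d s‖ + ‖u s‖ * ‖d s‖)) := by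
        refine integral_mono_ae
          ((((hAm n (U n)).sub (h𝒜m u hub)).integrable (by norm_num)).norm) (i0.add i4) ?_
        filter_upwards [hdae, hbd n, hub] with s hs hsn hsu
        have e : A n (U n s) - 𝒜 (u s)
          = (A n (U n s) - 𝒜 (U n s)) + (𝒜 (U n s) - 𝒜 (u s)) := by abel
        have b1 := happ n _ hsn
        have b2 := hloc _ _ hsn hsu
        change ‖A n (U n s) - 𝒜 (u s)‖ ≤ _
        simp only [hs]
        rw [e]
        refine (norm_add_le _ _).trans ((add_le_add b1 b2).trans (le_of_eq ?_))
        ring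
      rw [integral_add i0 i4, integral_const_mul, integral_const_mul, integral_add i12 i3,
        integral_add i1 i2] at h1
      refine h1.trans ?_
      have c1 := ((U n).integral_norm_le hT).trans
        (mul_le_mul_of_nonneg_left (hUB n) (Real.sqrt_nonneg T))
      have c2 := L2time.integral_norm_le hT d
      have c3 := (integral_norm_mul_norm_le (U n) d).trans
        (mul_le_mul_of_nonneg_right (hUB n) (norm_nonneg d))
      have c4 := integral_norm_mul_norm_le u d
      have e1 : K * (1 / ((n : ℝ) + 1)) = K / ((n : ℝ) + 1) := by ring
      have e2 : K * (√T + B + ‖u‖) * ‖d‖ = K * (√T * ‖d‖ + B * ‖d‖ + ‖u‖ * ‖d‖) := by ring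
      rw [e1, e2]
      gcongr
    · simpa using ((htend0.const_mul K).mul_const (√T * B)).add
        (hd0.const_mul (K * (√T + B + ‖u‖)))
  filter_upwards [hae, ae_all_iff.mpr hU, ae_restrict_mem measurableSet_Ioc] with t ht hUt htm
  have hl : Tendsto (fun i => (j†) (j (U (ns i) t))) atTop (𝓝 ((j†) (j (u t)))) :=
    (((j†).continuous.comp j.continuous).tendsto _).comp ht
  have h_int : Tendsto (fun n => ∫ s in (0 : ℝ)..t, -A n (U n s)) atTop
      (𝓝 (∫ s in (0 : ℝ)..t, -𝒜 (u s))) := by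
    rw [tendsto_iff_norm_sub_tendsto_zero]
    refine squeeze_zero (fun n => norm_nonneg _) (fun n => ?_) hdiff
    have g1 : IntegrableOn (fun s => A n (U n s)) (Ioc 0 T) := (hAm n (U n)).integrable (by norm_num)
    have g2 : IntegrableOn (fun s => 𝒜 (u s)) (Ioc 0 T) := (h𝒜m u hub).integrable (by norm_num)
    have g1' : IntervalIntegrable (fun s => A n (U n s)) volume 0 t :=
      (intervalIntegrable_iff_integrableOn_Ioc_of_le htm.1.le).mpr
        (g1.mono_set (Ioc_subset_Ioc_right htm.2))
    have g2' : IntervalIntegrable (fun s => 𝒜 (u s)) volume 0 t :=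
      (intervalIntegrable_iff_integrableOn_Ioc_of_le htm.1.le).mpr
        (g2.mono_set (Ioc_subset_Ioc_right htm.2))
    rw [intervalIntegral.integral_neg, intervalIntegral.integral_neg, neg_sub_neg, norm_sub_rev,
      ← intervalIntegral.integral_sub g1' g2']
    exact norm_primitive_le_integral (g1.sub g2) (Ioc_subset_Icc_self htm)
  have hr : Tendsto (fun i => (j†) u₀ + ∫ s in (0 : ℝ)..t, -A (ns i) (U (ns i) s)) atTop
      (𝓝 ((j†) u₀ + ∫ s in (0 : ℝ)..t, -𝒜 (u s))) :=
    (h_int.comp hns.tendsto_atTop).const_add _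
  refine tendsto_nhds_unique hl (hr.congr fun i => ?_)
  exact (hUt (ns i)).symm

end Approximation

/-! ### Agmon's inequality and the nodal inequality. -/

section Embedding

variable {L : ℝ} [Fact (0 < L)]

theorem integrable_of_continuous {c : AddCircle L → ℝ} (hc : Continuous c) : Integrable c :=
  hc.integrable_of_hasCompactSupport (HasCompactSupport.of_compactSpace _)

theorem intervalIntegrable_coe_sq (f : L2per L) (a b : ℝ) :
    IntervalIntegrable (fun x : ℝ => f (x : AddCircle L) ^ 2) volume a b := by
  have hi : Integrable (fun y => f y ^ 2) := (Lp.memLp f).integrable_sq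
  have h1 : IntervalIntegrable (fun x : ℝ => f (x : AddCircle L) ^ 2) volume 0 (0 + L) := by
    rw [intervalIntegrable_iff_integrableOn_Ioc_of_le (by simpa using (Fact.out : 0 < L).le)]
    exact (AddCircle.measurePreserving_mk L 0).integrable_comp_of_integrable hi
  exact Function.Periodic.intervalIntegrable (T := L) (fun x => by simp) (Fact.out : 0 < L).ne'
    h1 a b

theorem rep_eq_of_ae {v : H1per L} {c : C(AddCircle L, ℝ)}
    (h : (c : AddCircle L → ℝ) =ᵐ[volume] H1per.toL2 L v) : H1per.rep v = c :=
  DFunLike.coe_injective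
    (((H1per.rep v).continuous.ae_eq_iff_eq volume c.continuous).mp ((H1per.rep_ae_eq v).trans h.symm))

theorem rep_ae_coe (v : H1per L) :
    ∀ᵐ x : ℝ, x ∈ uIoc 0 L → H1per.rep v (x : AddCircle L) = H1per.toL2 L v (x : AddCircle L) :=
  ae_comp_mk (H1per.rep_ae_eq v)

theorem rep_add (v w : H1per L) : H1per.rep (v + w) = H1per.rep v + H1per.rep w := by
  apply rep_eq_of_ae
  rw [map_add]
  filter_upwards [H1per.rep_ae_eq v, H1per.rep_ae_eq w,
    Lp.coeFn_add (H1per.toL2 L v) (H1per.toL2 L w)] with y h1 h2 h3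
  rw [h3, Pi.add_apply, ← h1, ← h2]
  rfl

theorem rep_smul (c : ℝ) (v : H1per L) : H1per.rep (c • v) = c • H1per.rep v := by
  apply rep_eq_of_ae
  rw [map_smul]
  filter_upwards [H1per.rep_ae_eq v, Lp.coeFn_smul c (H1per.toL2 L v)] with y h1 h3
  rw [h3, Pi.smul_apply, ← h1]
  rfl

theorem integral_rep_mul_abs_le (v w : H1per L) :
    ∫ y, |H1per.rep v y| * |H1per.rep w y| ≤ ‖H1per.toL2 L v‖ * ‖H1per.toL2 L w‖ := by
  refine le_trans (le_of_eq ?_) (integral_norm_mul_norm_le (H1per.toL2 L v) (H1per.toL2 L w))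
  apply integral_congr_ae
  filter_upwards [H1per.rep_ae_eq v, H1per.rep_ae_eq w] with y h1 h2
  rw [h1, h2, Real.norm_eq_abs, Real.norm_eq_abs]

theorem integral_rep_sq (v : H1per L) :
    ∫ y, H1per.rep v y ^ 2 = ‖H1per.toL2 L v‖ ^ 2 := by
  rw [norm_sq_eq_integral]
  apply integral_congr_ae
  filter_upwards [H1per.rep_ae_eq v] with y h1
  rw [h1, Real.norm_eq_abs, sq_abs]

/-- The derivative of `w²` is `2 w w_x`; integrating from `y` to `x` stays within one period, where
Cauchy–Schwarz applies. -/
theorem rep_sq_sub_le (w : H1per L) {x y : ℝ} (hx : x ∈ Icc 0 L) (hy : y ∈ Icc 0 L) :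
    H1per.rep w (x : AddCircle L) ^ 2 - H1per.rep w (y : AddCircle L) ^ 2
      ≤ 2 * (‖H1per.toL2 L w‖ * ‖H1per.dx L w‖) := by
  have hL : 0 < L := Fact.out
  set r : ℝ → ℝ := fun s => H1per.rep w (s : AddCircle L) with hr
  set g : ℝ → ℝ := fun s => H1per.dx L w (s : AddCircle L) with hg
  have hgi : ∀ a b, IntervalIntegrable g volume a b := intervalIntegrable_coe _
  have hrc : Continuous r := (H1per.rep w).continuous.comp (AddCircle.continuous_mk' L)
  have hri : ∀ a b, IntervalIntegrable (fun s => r s * g s) volume a b := fun a b =>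
    (hgi a b).continuousOn_mul hrc.continuousOn
  have hprim : ∀ s, r y + ∫ q in y..s, g q = r s := fun s => by
    rw [← rep_sub_rep w y s]; simp [hr]
  have h1 := inner_primitive_sub (ContinuousLinearMap.id ℝ ℝ) (fun _ _ => rfl) (hgi y x) (r y)
  simp only [hprim, ContinuousLinearMap.id_apply, real_inner_self_eq_norm_sq, Real.norm_eq_abs,
    sq_abs] at h1
  have h2 : ∫ s in y..x, ⟪r s, g s⟫ = ∫ s in y..x, r s * g s := by
    congr 1; funext s; simp [mul_comm]
  rw [h2] at h1
  change r x ^ 2 - r y ^ 2 ≤ _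
  rw [h1]
  have h3 : ∫ s in y..x, r s * g s ≤ ∫ s in Ioc 0 L, ‖r s * g s‖ := by
    refine (le_abs_self _).trans ?_
    rw [← Real.norm_eq_abs]
    refine (intervalIntegral.norm_integral_le_integral_norm_uIoc).trans ?_
    have h4 : IntegrableOn (fun s => r s * g s) (Ioc 0 L) :=
      (intervalIntegrable_iff_integrableOn_Ioc_of_le hL.le).mp (hri 0 L)
    exact setIntegral_mono_set h4.norm (Eventually.of_forall fun _ => norm_nonneg _)
      (Ioc_subset_Ioc (le_min hy.1 hx.1) (max_le hy.2 hx.2)).eventuallyLE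
  have h5 : ∫ s in Ioc 0 L, ‖r s * g s‖ = ∫ y, ‖H1per.toL2 L w y‖ * ‖H1per.dx L w y‖ := by
    rw [← AddCircle.intervalIntegral_preimage L 0, zero_add,
      ← intervalIntegral.integral_of_le hL.le]
    apply intervalIntegral.integral_congr_ae
    filter_upwards [rep_ae_coe w] with s hs hsm
    rw [norm_mul, ← hs hsm]
  have h6 := integral_norm_mul_norm_le (H1per.toL2 L w) (H1per.dx L w)
  linarith

/-- The constant of the embedding `H¹_per ⊂ C`. -/
def embConst (L : ℝ) : ℝ := 1 / L + 2

theorem embConst_pos : 0 < embConst L := by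
  have hL : 0 < L := Fact.out
  unfold embConst
  positivity

/-- Agmon's inequality. -/
theorem norm_rep_sq_le (w : H1per L) :
    ‖H1per.rep w‖ ^ 2 ≤ embConst L * (‖H1per.toL2 L w‖ * ‖w‖) := by
  have hL : 0 < L := Fact.out
  have hκ := (embConst_pos (L := L)).le
  -- Averaging `rep_sq_sub_le` over `y` bounds `w(x)²` by `‖w‖²/L + 2‖w‖‖w_x‖` in `L²` norms. This
  -- is the origin of the two terms of `embConst`.
  have key : ∀ x ∈ Icc 0 L, H1per.rep w (x : AddCircle L) ^ 2
      ≤ embConst L * (‖H1per.toL2 L w‖ * ‖w‖) := by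
    intro x hx
    have hrc : Continuous fun y : ℝ => H1per.rep w (y : AddCircle L) ^ 2 :=
      ((H1per.rep w).continuous.comp (AddCircle.continuous_mk' L)).pow 2
    have h1 := intervalIntegral.integral_mono_on (μ := volume) hL.le
      (f := fun _ => H1per.rep w (x : AddCircle L) ^ 2
        - 2 * (‖H1per.toL2 L w‖ * ‖H1per.dx L w‖))
      (by simp) (hrc.intervalIntegrable 0 L) (fun y hy => by linarith [rep_sq_sub_le w hx hy])
    have h2 := AddCircle.intervalIntegral_preimage L 0 (fun y : AddCircle L => H1per.rep w y ^ 2)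
    rw [zero_add, integral_rep_sq] at h2
    rw [h2, intervalIntegral.integral_const, smul_eq_mul, sub_zero] at h1
    have h3 := norm_toL2_le w
    have h4 := norm_dx_le w
    have h5 : H1per.rep w (x : AddCircle L) ^ 2
        ≤ 1 / L * ‖H1per.toL2 L w‖ ^ 2 + 2 * (‖H1per.toL2 L w‖ * ‖H1per.dx L w‖) := by
      have : H1per.rep w (x : AddCircle L) ^ 2 - 2 * (‖H1per.toL2 L w‖ * ‖H1per.dx L w‖)
          ≤ ‖H1per.toL2 L w‖ ^ 2 / L := by
        rw [le_div_iff₀ hL]; linarith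
      have e : 1 / L * ‖H1per.toL2 L w‖ ^ 2 = ‖H1per.toL2 L w‖ ^ 2 / L := by ring
      linarith
    refine h5.trans ?_
    have h6 : ‖H1per.toL2 L w‖ ^ 2 ≤ ‖H1per.toL2 L w‖ * ‖w‖ := by
      rw [sq]; gcongr
    have h7 : ‖H1per.toL2 L w‖ * ‖H1per.dx L w‖ ≤ ‖H1per.toL2 L w‖ * ‖w‖ := by gcongr
    have h8 : 1 / L * ‖H1per.toL2 L w‖ ^ 2 ≤ 1 / L * (‖H1per.toL2 L w‖ * ‖w‖) := by gcongr
    unfold embConst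
    linarith
  have h9 : ‖H1per.rep w‖ ≤ √(embConst L * (‖H1per.toL2 L w‖ * ‖w‖)) := by
    rw [ContinuousMap.norm_le _ (Real.sqrt_nonneg _)]
    intro y
    obtain ⟨x, hx, rfl⟩ : y ∈ ((↑) : ℝ → AddCircle L) '' Ico 0 (0 + L) := by
      rw [AddCircle.coe_image_Ico_eq]; trivial
    rw [zero_add] at hx
    exact Real.abs_le_sqrt (key x (Ico_subset_Icc_self hx))
  have h10 := pow_le_pow_left₀ (norm_nonneg _) h9 2
  rwa [Real.sq_sqrt (by positivity)] at h10

theorem norm_rep_le (w : H1per L) : ‖H1per.rep w‖ ≤ √(embConst L) * ‖w‖ := by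
  refine (abs_le_of_sq_le_sq' (?_ : _ ^ 2 ≤ _) (by positivity)).2
  have hκ := (embConst_pos (L := L)).le
  rw [mul_pow, Real.sq_sqrt hκ]
  refine (norm_rep_sq_le w).trans ?_
  rw [sq]
  gcongr
  exact norm_toL2_le w

/-- The embedding `H¹_per → C`. -/
def repL (L : ℝ) [Fact (0 < L)] : H1per L →L[ℝ] C(AddCircle L, ℝ) :=
  LinearMap.mkContinuous
    { toFun := H1per.rep, map_add' := rep_add, map_smul' := rep_smul } (√(embConst L)) norm_rep_le

theorem repL_apply (w : H1per L) : repL L w = H1per.rep w := rfl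

theorem rep_sub (v w : H1per L) : H1per.rep (v - w) = H1per.rep v - H1per.rep w :=
  map_sub (repL L) v w

theorem sq_rep_sub_le (w : H1per L) {a b p q : ℝ} (hab : a ≤ b) (hp : p ∈ Icc a b)
    (hq : q ∈ Icc a b) :
    (H1per.rep w (p : AddCircle L) - H1per.rep w (q : AddCircle L)) ^ 2
      ≤ (b - a) * ∫ s in a..b, H1per.dx L w (s : AddCircle L) ^ 2 := by
  wlog hqp : q ≤ p generalizing p q
  · rw [← neg_sub, neg_sq]
    exact this hq hp (not_le.mp hqp).le
  set g : ℝ → ℝ := fun s => H1per.dx L w (s : AddCircle L) with hg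
  have hg2 : ∀ c d, IntervalIntegrable (fun s => g s ^ 2) volume c d := intervalIntegrable_coe_sq _
  rw [rep_sub_rep w q p]
  have hmem : MemLp g 2 (volume.restrict (Ioc q p)) := by
    rw [memLp_two_iff_integrable_sq (intervalIntegrable_coe (H1per.dx L w) q p).1.1]
    exact (intervalIntegrable_iff_integrableOn_Ioc_of_le hqp).mp (hg2 q p)
  have h1 := sq_integral_le hmem
  rw [← intervalIntegral.integral_of_le hqp, ← intervalIntegral.integral_of_le hqp] at h1
  have h2 : (volume.restrict (Ioc q p)).real univ = p - q := by
    simp [Measure.real, hqp]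
  rw [h2] at h1
  refine h1.trans ?_
  have h3 : ∫ s in q..p, g s ^ 2 ≤ ∫ s in a..b, g s ^ 2 :=
    intervalIntegral.integral_mono_interval hq.1 hqp hp.2
      (Eventually.of_forall fun s => sq_nonneg _) (hg2 a b)
  have h4 : 0 ≤ ∫ s in q..p, g s ^ 2 :=
    intervalIntegral.integral_nonneg hqp fun s _ => sq_nonneg _
  have h5 : p - q ≤ b - a := by linarith [hp.2, hq.1]
  have h6 : 0 ≤ p - q := by linarith
  gcongr

/-- Let `h = b - a` and `D = ∫ w_x²` over the cell. From `(w(s) - w(p))² ≤ hD` follows `w(s)² ≤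
2w(p)² + 2hD`, whence `h w(p)²/2 ≥ ¼∫w² - h²D/2`. The same oscillation bound gives `w(p)w(q) ≥
w(p)²/2 - hD/2`. Adding the two yields the constants `1/4` and `h²`. -/
theorem cell_inequality (w : H1per L) {a b p q : ℝ} (hab : a ≤ b) (hp : p ∈ Icc a b)
    (hq : q ∈ Icc a b) :
    1 / 4 * (∫ s in a..b, H1per.rep w (s : AddCircle L) ^ 2)
        - (b - a) ^ 2 * ∫ s in a..b, H1per.dx L w (s : AddCircle L) ^ 2
      ≤ (b - a) * H1per.rep w (p : AddCircle L) * H1per.rep w (q : AddCircle L) := by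
  set D := ∫ s in a..b, H1per.dx L w (s : AddCircle L) ^ 2
  set r : ℝ → ℝ := fun s => H1per.rep w (s : AddCircle L) with hr
  have hrc : Continuous fun s => r s ^ 2 :=
    ((H1per.rep w).continuous.comp (AddCircle.continuous_mk' L)).pow 2
  have h1 := intervalIntegral.integral_mono_on (μ := volume) hab
    (g := fun _ => 2 * r p ^ 2 + 2 * ((b - a) * D)) (hrc.intervalIntegrable a b) (by simp)
    (fun s hs => by
      have := sq_rep_sub_le w hab hs hp
      change (r s - r p) ^ 2 ≤ _ at this
      nlinarith [sq_nonneg (r s - 2 * r p)])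
  rw [intervalIntegral.integral_const, smul_eq_mul] at h1
  have h2 := sq_rep_sub_le w hab hq hp
  change (r q - r p) ^ 2 ≤ (b - a) * D at h2
  change 1 / 4 * (∫ s in a..b, r s ^ 2) - (b - a) ^ 2 * D ≤ (b - a) * r p * r q
  have h3 : r p ^ 2 / 2 - (b - a) * D / 2 ≤ r p * r q := by nlinarith [sq_nonneg (r q)]
  have h4 := mul_le_mul_of_nonneg_left h3 (sub_nonneg.mpr hab)
  nlinarith

/-- The cell inequality summed over the partition. As `k` starts at `0`, cell `k` is the interval
`J_{k+1}` of the usual numbering. -/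
theorem nodal_inequality (w : H1per L) {N : ℕ} (hN : 0 < N) {xbar x : Fin N → ℝ}
    (hxbar : ∀ k : Fin N, xbar k ∈ Icc ((k : ℝ) * (L / N)) (((k : ℝ) + 1) * (L / N)))
    (hx : ∀ k : Fin N, x k ∈ Icc ((k : ℝ) * (L / N)) (((k : ℝ) + 1) * (L / N))) :
    1 / 4 * ‖H1per.toL2 L w‖ ^ 2 - (L / N) ^ 2 * ‖H1per.dx L w‖ ^ 2
      ≤ ∑ k : Fin N, (L / N) * H1per.rep w (xbar k : AddCircle L)
        * H1per.rep w (x k : AddCircle L) := by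
  have hL : 0 < L := Fact.out
  have hN' : (0 : ℝ) < N := by exact_mod_cast hN
  set h : ℝ := L / N with hh
  have hpos : 0 < h := by positivity
  let a : ℕ → ℝ := fun k => (k : ℝ) * h
  have ha : ∀ k : ℕ, a (k + 1) - a k = h := fun k => by simp only [a]; push_cast; ring
  have ha1 : ∀ k : ℕ, a (k + 1) = ((k : ℝ) + 1) * h := fun k => by simp only [a]; push_cast; ring
  have ha0 : a 0 = 0 := by simp [a]
  have haN : a N = L := by simp only [a, hh]; field_simp
  have hrc : Continuous fun s : ℝ => H1per.rep w (s : AddCircle L) ^ 2 :=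
    ((H1per.rep w).continuous.comp (AddCircle.continuous_mk' L)).pow 2
  have hgi : ∀ c d, IntervalIntegrable (fun s : ℝ => H1per.dx L w (s : AddCircle L) ^ 2)
      volume c d := intervalIntegrable_coe_sq _
  have s1 := intervalIntegral.sum_integral_adjacent_intervals (μ := volume) (a := a) (n := N)
    (f := fun s : ℝ => H1per.rep w (s : AddCircle L) ^ 2)
    (fun k _ => hrc.intervalIntegrable _ _)
  have s2 := intervalIntegral.sum_integral_adjacent_intervals (μ := volume) (a := a) (n := N)
    (f := fun s : ℝ => H1per.dx L w (s : AddCircle L) ^ 2) (fun k _ => hgi _ _)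
  rw [ha0, haN] at s1 s2
  have e1 := AddCircle.intervalIntegral_preimage L 0 (fun y : AddCircle L => H1per.rep w y ^ 2)
  rw [zero_add, integral_rep_sq] at e1
  rw [← norm_sq_eq_intervalIntegral] at s2
  rw [e1] at s1
  rw [← s1, ← s2, Finset.mul_sum, Finset.mul_sum, ← Finset.sum_sub_distrib,
    Finset.sum_range]
  refine Finset.sum_le_sum fun k _ => ?_
  have hk := cell_inequality w (a := a k) (b := a (k + 1)) (p := xbar k) (q := x k)
    (by linarith [ha k]) (by rw [ha1]; exact hxbar k) (by rw [ha1]; exact hx k)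
  rwa [ha] at hk

end Embedding

/-! ### Truncation of the cubic. -/

section Truncation

/-- Truncation at height `M`. -/
def clamp (M s : ℝ) : ℝ := max (-M) (min M s)

/-- The cubic nonlinearity, truncated at height `M`. -/
def clampCube (M s : ℝ) : ℝ := clamp M s ^ 3

theorem clamp_mono (M : ℝ) : Monotone (clamp M) := fun _ _ h =>
  max_le_max le_rfl (min_le_min le_rfl h)

theorem abs_clamp_sub_le (M s t : ℝ) : |clamp M s - clamp M t| ≤ |s - t| := by
  unfold clamp
  rw [max_comm (-M), max_comm (-M), min_comm M, min_comm M]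
  refine (abs_max_sub_max_le_abs _ _ _).trans ((abs_min_sub_min_le_max s M t M).trans ?_)
  simp

theorem abs_clamp_le {M : ℝ} (hM : 0 ≤ M) (s : ℝ) : |clamp M s| ≤ M := by
  unfold clamp
  rw [abs_le]
  exact ⟨le_max_left _ _, max_le (by linarith) (min_le_left _ _)⟩

theorem abs_clamp_le_abs {M : ℝ} (hM : 0 ≤ M) (s : ℝ) : |clamp M s| ≤ |s| := by
  have h := abs_clamp_sub_le M s 0
  have h0 : clamp M 0 = 0 := by simp [clamp, hM]
  rwa [h0, sub_zero, sub_zero] at h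

theorem clamp_eq_self {M s : ℝ} (h : |s| ≤ M) : clamp M s = s := by
  unfold clamp
  rw [abs_le] at h
  rw [min_eq_right h.2, max_eq_right h.1]

theorem abs_cube_sub_cube_le (a b : ℝ) :
    |a ^ 3 - b ^ 3| ≤ 2 * (a ^ 2 + b ^ 2) * |a - b| := by
  have e : a ^ 3 - b ^ 3 = (a ^ 2 + a * b + b ^ 2) * (a - b) := by ring
  rw [e, abs_mul]
  gcongr
  rw [abs_le]
  constructor <;> nlinarith [sq_nonneg (a + b), sq_nonneg (a - b)]

theorem clampCube_zero {M : ℝ} (hM : 0 ≤ M) : clampCube M 0 = 0 := by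
  simp [clampCube, clamp, hM]

theorem lipschitzWith_clampCube {M : ℝ} (hM : 0 ≤ M) :
    LipschitzWith (4 * M ^ 2).toNNReal (clampCube M) := by
  refine LipschitzWith.of_dist_le_mul fun s t => ?_
  rw [Real.dist_eq, Real.dist_eq, Real.coe_toNNReal _ (by positivity)]
  refine (abs_cube_sub_cube_le _ _).trans ?_
  have h1 : ∀ r, clamp M r ^ 2 ≤ M ^ 2 := fun r => by
    rw [← sq_abs]; exact pow_le_pow_left₀ (abs_nonneg _) (abs_clamp_le hM r) 2
  have h2 := abs_clamp_sub_le M s t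
  have h3 : 2 * (clamp M s ^ 2 + clamp M t ^ 2) ≤ 4 * M ^ 2 := by linarith [h1 s, h1 t]
  gcongr

theorem cube_mono : Monotone fun s : ℝ => s ^ 3 := (Odd.strictMono_pow (by decide)).monotone

theorem sub_mul_sub_nonneg_of_monotone {f : ℝ → ℝ} (hf : Monotone f) (s t : ℝ) :
    0 ≤ (f s - f t) * (s - t) := by
  rcases le_total s t with h | h
  · exact mul_nonneg_of_nonpos_of_nonpos (sub_nonpos.mpr (hf h)) (sub_nonpos.mpr h)
  · exact mul_nonneg (sub_nonneg.mpr (hf h)) (sub_nonneg.mpr h)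

/-- The error is zero where `|s| ≤ M`; elsewhere it is at most `2|s|³`, and `1 ≤ |s|/M` trades one
more power of `s` for the decay in `M`. -/
theorem abs_clampCube_sub_le {M : ℝ} (hM : 0 < M) (s : ℝ) :
    |clampCube M s - s ^ 3| ≤ 2 / M * s ^ 4 := by
  rcases le_or_gt |s| M with h | h
  · rw [clampCube, clamp_eq_self h, sub_self, abs_zero]
    positivity
  · have h1 : |clampCube M s| ≤ |s| ^ 3 := by
      rw [clampCube, abs_pow]
      exact pow_le_pow_left₀ (abs_nonneg _) (abs_clamp_le_abs hM.le s) 3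
    have h2 : |clampCube M s - s ^ 3| ≤ 2 * |s| ^ 3 := by
      refine (abs_sub _ _).trans ?_
      rw [abs_pow]
      linarith
    refine h2.trans ?_
    have e : 2 / M * s ^ 4 = 2 * |s| ^ 3 * (|s| / M) := by
      have : s ^ 4 = |s| ^ 3 * |s| := by rw [← pow_succ]; exact (Even.pow_abs (by decide) s).symm
      rw [this]; ring
    rw [e]
    have h3 : 1 ≤ |s| / M := by rw [le_div_iff₀ hM]; linarith
    nlinarith [pow_nonneg (abs_nonneg s) 3]

end Truncation

/-! ### The operator of the weak form and its monotonicity. -/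

section Operator

variable {L : ℝ} [Fact (0 < L)]

/-- The point evaluation `v ↦ v(a)`. -/
def evalL (a : AddCircle L) : H1per L →L[ℝ] ℝ := (ContinuousMap.evalCLM ℝ a).comp (repL L)

theorem evalL_apply (a : AddCircle L) (v : H1per L) : evalL a v = H1per.rep v a := rfl

/-- The linear part of the weak form, as an operator by the Riesz map of `H¹_per`. -/
def linOp (ν α μ : ℝ) {N : ℕ} (xbar x : Fin N → ℝ) : H1per L →L[ℝ] H1per L :=
  ν • ((H1per.dx L)†).comp (H1per.dx L) - α • ((H1per.toL2 L)†).comp (H1per.toL2 L)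
    + μ • ∑ k : Fin N, (L / N) • (evalL (xbar k : AddCircle L)).smulRight
      ((InnerProductSpace.toDual ℝ (H1per L)).symm (evalL (x k : AddCircle L)))

theorem inner_smul_H1per (c : ℝ) (f g : H1per L) : ⟪c • f, g⟫ = c * ⟪f, g⟫ :=
  real_inner_smul_left f g c

theorem inner_linOp (ν α μ : ℝ) {N : ℕ} (xbar x : Fin N → ℝ) (w v : H1per L) :
    ⟪linOp ν α μ xbar x w, v⟫
      = ν * ⟪H1per.dx L w, H1per.dx L v⟫ - α * ⟪H1per.toL2 L w, H1per.toL2 L v⟫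
        + μ * ∑ k : Fin N, (L / N) * H1per.rep w (xbar k : AddCircle L)
          * H1per.rep v (x k : AddCircle L) := by
  have h1 : linOp ν α μ xbar x w = ν • ((H1per.dx L)†) (H1per.dx L w)
      - α • ((H1per.toL2 L)†) (H1per.toL2 L w)
      + μ • ∑ k : Fin N, (L / N) • H1per.rep w (xbar k : AddCircle L) •
        (InnerProductSpace.toDual ℝ (H1per L)).symm (evalL (x k : AddCircle L)) := by
    simp [linOp, evalL_apply]
  rw [h1, inner_add_left, inner_sub_left, inner_smul_H1per, inner_smul_H1per,
    inner_smul_H1per, ContinuousLinearMap.adjoint_inner_left,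
    ContinuousLinearMap.adjoint_inner_left, sum_inner]
  congr 2
  refine Finset.sum_congr rfl fun k _ => ?_
  rw [inner_smul_H1per, inner_smul_H1per, InnerProductSpace.toDual_symm_apply, evalL_apply,
    mul_assoc]

/-- The cube of `w ∈ H¹_per`, in `L²_per`. -/
def cubeLp (w : H1per L) : L2per L := ContinuousMap.toLp 2 volume ℝ (H1per.rep w ^ 3)

theorem cubeLp_ae (w : H1per L) : ∀ᵐ y, cubeLp w y = H1per.rep w y ^ 3 :=
  ContinuousMap.coeFn_toLp (p := 2) (𝕜 := ℝ) volume (H1per.rep w ^ 3)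

theorem continuous_cubeLp : Continuous (cubeLp (L := L)) :=
  (ContinuousMap.toLp 2 volume ℝ).continuous.comp ((repL L).continuous.pow 3)

/-- The operator of the weak form. -/
def nodalOp (ν α μ : ℝ) {N : ℕ} (xbar x : Fin N → ℝ) (w : H1per L) : H1per L :=
  linOp ν α μ xbar x w + ((H1per.toL2 L)†) (cubeLp w)

/-- The operator of the weak form with truncated nonlinearity. -/
def truncOp (ν α μ : ℝ) {N : ℕ} (xbar x : Fin N → ℝ) (n : ℕ) (w : H1per L) : H1per L :=
  linOp ν α μ xbar x w + ((H1per.toL2 L)†)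
    ((lipschitzWith_clampCube (M := n + 1) (by positivity)).compLp
      (clampCube_zero (by positivity)) (H1per.toL2 L w))

theorem inner_toL2 (f : L2per L) (v : H1per L) :
    ⟪f, H1per.toL2 L v⟫ = ∫ y, f y * H1per.rep v y := by
  rw [L2.inner_def]
  apply integral_congr_ae
  filter_upwards [H1per.rep_ae_eq v] with y hy
  rw [hy]
  simp [mul_comm]

theorem inner_nodalOp (ν α μ : ℝ) {N : ℕ} (xbar x : Fin N → ℝ) (w v : H1per L) :
    ⟪nodalOp ν α μ xbar x w, v⟫ = weakForm ν α μ xbar x w v := by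
  rw [nodalOp, inner_add_left, inner_linOp, ContinuousLinearMap.adjoint_inner_left,
    inner_toL2 (cubeLp w), weakForm]
  have h : ∫ y, cubeLp w y * H1per.rep v y = ∫ y, H1per.rep w y ^ 3 * H1per.rep v y := by
    apply integral_congr_ae
    filter_upwards [cubeLp_ae w] with y hy
    rw [hy]
  rw [h]
  ring

theorem continuous_nodalOp (ν α μ : ℝ) {N : ℕ} (xbar x : Fin N → ℝ) :
    Continuous (nodalOp (L := L) ν α μ xbar x) :=
  (linOp ν α μ xbar x).continuous.add (((H1per.toL2 L)†).continuous.comp continuous_cubeLp)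

/-- The embedding of `L¹` in the dual of `H¹_per`, dual to that of `H¹_per` in the continuous
functions. It permits estimates of the cube in `L¹` alone. -/
theorem norm_adjoint_toL2_le (f : L2per L) :
    ‖((H1per.toL2 L)†) f‖ ≤ √(embConst L) * ∫ y, |f y| := by
  set z := ((H1per.toL2 L)†) f with hz
  have hfi : Integrable (fun y => f y) := (Lp.memLp f).integrable (by norm_num)
  have h1 : ‖z‖ * ‖z‖ ≤ (√(embConst L) * ∫ y, |f y|) * ‖z‖ := by
    rw [← sq, ← real_inner_self_eq_norm_sq]
    nth_rw 1 [hz]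
    rw [ContinuousLinearMap.adjoint_inner_left, inner_toL2]
    have h2 : ∫ y, f y * H1per.rep z y ≤ ∫ y, ‖H1per.rep z‖ * |f y| := by
      refine integral_mono (hfi.mul_bdd (c := ‖H1per.rep z‖)
        (H1per.rep z).continuous.aestronglyMeasurable
        (Eventually.of_forall fun y => (H1per.rep z).norm_coe_le_norm y))
        (hfi.abs.const_mul _) fun y => ?_
      refine (le_abs_self _).trans ?_
      rw [abs_mul, mul_comm]
      gcongr
      exact (H1per.rep z).norm_coe_le_norm y
    rw [integral_const_mul] at h2
    refine h2.trans ?_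
    have h3 := norm_rep_le z
    have h4 : 0 ≤ ∫ y, |f y| := integral_nonneg fun y => abs_nonneg _
    calc _ ≤ (√(embConst L) * ‖z‖) * ∫ y, |f y| := by gcongr
      _ = _ := by ring
  rcases (norm_nonneg z).eq_or_lt with h0 | h0
  · rw [← h0]
    exact mul_nonneg (Real.sqrt_nonneg _) (integral_nonneg fun y => abs_nonneg _)
  · exact le_of_mul_le_mul_right h1 h0

theorem integral_abs_cubeLp_le (w : H1per L) :
    ∫ y, |cubeLp w y| ≤ ‖H1per.rep w‖ * ‖H1per.toL2 L w‖ ^ 2 := by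
  rw [← integral_rep_sq, ← integral_const_mul]
  refine integral_mono_ae ((Lp.memLp (cubeLp w)).integrable (by norm_num)).abs
    ((integrable_of_continuous ((H1per.rep w).continuous.pow 2)).const_mul _) ?_
  filter_upwards [cubeLp_ae w] with y hy
  change |cubeLp w y| ≤ ‖H1per.rep w‖ * H1per.rep w y ^ 2
  rw [hy, abs_pow, ← sq_abs (H1per.rep w y), pow_succ']
  gcongr
  exact (H1per.rep w).norm_coe_le_norm y

theorem integral_abs_cubeLp_sub_le (w z : H1per L) :
    ∫ y, |(cubeLp w - cubeLp z : L2per L) y|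
      ≤ 2 * (‖H1per.rep w‖ * ‖H1per.toL2 L w‖ + ‖H1per.rep z‖ * ‖H1per.toL2 L z‖)
        * ‖H1per.toL2 L (w - z)‖ := by
  have hc : ∀ v : H1per L, Integrable fun y => |H1per.rep v y| * |H1per.rep (w - z) y| :=
    fun v => integrable_of_continuous ((H1per.rep v).continuous.abs.mul
      (H1per.rep (w - z)).continuous.abs)
  have i1 : Integrable fun y => ‖H1per.rep w‖ * (|H1per.rep w y| * |H1per.rep (w - z) y|) :=
    (hc w).const_mul _
  have i2 : Integrable fun y => ‖H1per.rep z‖ * (|H1per.rep z y| * |H1per.rep (w - z) y|) :=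
    (hc z).const_mul _
  have h1 : ∫ y, |(cubeLp w - cubeLp z : L2per L) y|
      ≤ ∫ y, 2 * (‖H1per.rep w‖ * (|H1per.rep w y| * |H1per.rep (w - z) y|)
        + ‖H1per.rep z‖ * (|H1per.rep z y| * |H1per.rep (w - z) y|)) := by
    refine integral_mono_ae ((Lp.memLp (cubeLp w - cubeLp z)).integrable (by norm_num)).abs
      ((i1.add i2).const_mul 2) ?_
    filter_upwards [cubeLp_ae w, cubeLp_ae z, Lp.coeFn_sub (cubeLp w) (cubeLp z)] with y h1 h2 h3
    change |(cubeLp w - cubeLp z : L2per L) y| ≤ 2 * (‖H1per.rep w‖ * (|H1per.rep w y| *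
      |H1per.rep (w - z) y|) + ‖H1per.rep z‖ * (|H1per.rep z y| * |H1per.rep (w - z) y|))
    rw [h3, Pi.sub_apply, h1, h2, rep_sub, ContinuousMap.sub_apply]
    refine (abs_cube_sub_cube_le _ _).trans ?_
    have b1 : ∀ v : H1per L, H1per.rep v y ^ 2 ≤ ‖H1per.rep v‖ * |H1per.rep v y| := fun v => by
      rw [← sq_abs, sq]
      gcongr
      exact (H1per.rep v).norm_coe_le_norm y
    have b2 := mul_le_mul_of_nonneg_right (add_le_add (b1 w) (b1 z))
      (abs_nonneg (H1per.rep w y - H1per.rep z y))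
    linarith
  rw [integral_const_mul, integral_add i1 i2, integral_const_mul, integral_const_mul] at h1
  refine h1.trans ?_
  have c1 := mul_le_mul_of_nonneg_left (integral_rep_mul_abs_le w (w - z))
    (norm_nonneg (H1per.rep w))
  have c2 := mul_le_mul_of_nonneg_left (integral_rep_mul_abs_le z (w - z))
    (norm_nonneg (H1per.rep z))
  linarith

theorem clampLp_ae (n : ℕ) (w : H1per L) :
    ∀ᵐ y, ((lipschitzWith_clampCube (M := n + 1) (by positivity)).compLp
      (clampCube_zero (by positivity)) (H1per.toL2 L w) : L2per L) y
        = clampCube (n + 1) (H1per.rep w y) := by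
  filter_upwards [(lipschitzWith_clampCube (M := n + 1) (by positivity)).coeFn_compLp
    (clampCube_zero (by positivity)) (H1per.toL2 L w), H1per.rep_ae_eq w] with y h1 h2
  rw [h1, Function.comp_apply, h2]

/-- Only the cubic terms differ. Their difference is estimated in `L¹`, with `w⁴` bounded by `w²`
times the square of the supremum. -/
theorem norm_truncOp_sub_nodalOp_le (ν α μ : ℝ) {N : ℕ} (xbar x : Fin N → ℝ) (n : ℕ)
    (w : H1per L) :
    ‖truncOp ν α μ xbar x n w - nodalOp ν α μ xbar x w‖
      ≤ √(embConst L) * (2 / (n + 1) * (‖H1per.rep w‖ ^ 2 * ‖H1per.toL2 L w‖ ^ 2)) := by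
  set f : L2per L := (lipschitzWith_clampCube (M := (n : ℝ) + 1) (by positivity)).compLp
      (clampCube_zero (by positivity)) (H1per.toL2 L w) with hf
  have e : truncOp ν α μ xbar x n w - nodalOp ν α μ xbar x w
      = ((H1per.toL2 L)†) (f - cubeLp w) := by
    rw [truncOp, nodalOp, add_sub_add_left_eq_sub, map_sub]
  rw [e]
  refine (norm_adjoint_toL2_le _).trans ?_
  gcongr
  rw [← integral_rep_sq, ← integral_const_mul, ← integral_const_mul]
  refine integral_mono_ae ((Lp.memLp (f - cubeLp w)).integrable (by norm_num)).abs
    (((integrable_of_continuous ((H1per.rep w).continuous.pow 2)).const_mul _).const_mul _) ?_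
  filter_upwards [cubeLp_ae w, clampLp_ae n w, Lp.coeFn_sub f (cubeLp w)] with y h1 h2 h3
  change |(f - cubeLp w : L2per L) y| ≤ 2 / (n + 1) * (‖H1per.rep w‖ ^ 2 * H1per.rep w y ^ 2)
  rw [h3, Pi.sub_apply, h1, hf, h2]
  refine (abs_clampCube_sub_le (by positivity) _).trans ?_
  have h4 : H1per.rep w y ^ 4 = |H1per.rep w y| ^ 2 * H1per.rep w y ^ 2 := by
    rw [sq_abs]; ring
  rw [h4]
  gcongr
  exact (H1per.rep w).norm_coe_le_norm y

/-- The linear part is coercive: the feedback dominates the destabilizing term. -/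
theorem exists_coercive {ν α μ : ℝ} (hα : 0 < α) {N : ℕ} (hN : 0 < N) {xbar x : Fin N → ℝ}
    (hxbar : ∀ k : Fin N, xbar k ∈ Icc ((k : ℝ) * (L / N)) (((k : ℝ) + 1) * (L / N)))
    (hx : ∀ k : Fin N, x k ∈ Icc ((k : ℝ) * (L / N)) (((k : ℝ) + 1) * (L / N)))
    (hμ : 4 * α < μ) (hν : 2 * μ * (L / N) ^ 2 ≤ ν) :
    ∃ c, 0 < c ∧ ∀ w : H1per L, c * ‖w‖ ^ 2 ≤ ⟪linOp ν α μ xbar x w, w⟫ := by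
  have hL : 0 < L := Fact.out
  have hN' : (0 : ℝ) < N := by exact_mod_cast hN
  have hμ0 : 0 < μ := by linarith
  have hp : 0 < μ * (L / N) ^ 2 := by positivity
  -- The feedback costs `μh²` of the viscosity and supplies `μ/4` of damping. Since `ν ≥ 2μh²`, at
  -- least `μh² > 0` of viscosity is left, and `μ > 4α` makes the damping win over `α`.
  refine ⟨min (ν - μ * (L / N) ^ 2) (μ / 4 - α), lt_min (by linarith) (by linarith), fun w => ?_⟩
  rw [inner_linOp, real_inner_self_eq_norm_sq, real_inner_self_eq_norm_sq, norm_sq_H1per]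
  have h1 := mul_le_mul_of_nonneg_left (nodal_inequality w hN hxbar hx) hμ0.le
  have h2 := mul_le_mul_of_nonneg_right (min_le_left (ν - μ * (L / N) ^ 2) (μ / 4 - α))
    (sq_nonneg ‖H1per.dx L w‖)
  have h3 := mul_le_mul_of_nonneg_right (min_le_right (ν - μ * (L / N) ^ 2) (μ / 4 - α))
    (sq_nonneg ‖H1per.toL2 L w‖)
  linarith

theorem inner_cubeLp_sub_nonneg (w z : H1per L) :
    0 ≤ ⟪cubeLp w - cubeLp z, H1per.toL2 L (w - z)⟫ := by
  rw [inner_toL2]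
  apply integral_nonneg_of_ae
  filter_upwards [cubeLp_ae w, cubeLp_ae z, Lp.coeFn_sub (cubeLp w) (cubeLp z)] with y h1 h2 h3
  rw [h3, Pi.sub_apply, h1, h2, rep_sub, ContinuousMap.sub_apply]
  exact sub_mul_sub_nonneg_of_monotone cube_mono _ _

theorem nodalOp_mono {ν α μ c : ℝ} {N : ℕ} {xbar x : Fin N → ℝ}
    (hc : ∀ w : H1per L, c * ‖w‖ ^ 2 ≤ ⟪linOp ν α μ xbar x w, w⟫) (w z : H1per L) :
    c * ‖w - z‖ ^ 2 ≤ ⟪nodalOp ν α μ xbar x w - nodalOp ν α μ xbar x z, w - z⟫ := by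
  have e : nodalOp ν α μ xbar x w - nodalOp ν α μ xbar x z
      = linOp ν α μ xbar x (w - z) + ((H1per.toL2 L)†) (cubeLp w - cubeLp z) := by
    simp only [nodalOp, map_sub]; abel
  rw [e, inner_add_left, ContinuousLinearMap.adjoint_inner_left]
  linarith [hc (w - z), inner_cubeLp_sub_nonneg w z]

/-- Truncation keeps the constant `c`, because the truncated cube is a composition of increasing
functions. -/
theorem truncOp_mono {ν α μ c : ℝ} {N : ℕ} {xbar x : Fin N → ℝ}
    (hc : ∀ w : H1per L, c * ‖w‖ ^ 2 ≤ ⟪linOp ν α μ xbar x w, w⟫) (n : ℕ) (w z : H1per L) :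
    c * ‖w - z‖ ^ 2 ≤ ⟪truncOp ν α μ xbar x n w - truncOp ν α μ xbar x n z, w - z⟫ := by
  set F : H1per L → L2per L := fun v =>
    (lipschitzWith_clampCube (M := (n : ℝ) + 1) (by positivity)).compLp
      (clampCube_zero (by positivity)) (H1per.toL2 L v) with hF
  have e : truncOp ν α μ xbar x n w - truncOp ν α μ xbar x n z
      = linOp ν α μ xbar x (w - z) + ((H1per.toL2 L)†) (F w - F z) := by
    simp only [truncOp, map_sub, hF]; abel
  have h0 : 0 ≤ ⟪F w - F z, H1per.toL2 L (w - z)⟫ := by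
    rw [inner_toL2]
    apply integral_nonneg_of_ae
    filter_upwards [clampLp_ae n w, clampLp_ae n z, Lp.coeFn_sub (F w) (F z)] with y h1 h2 h3
    rw [h3, Pi.sub_apply, hF, h1, h2, rep_sub, ContinuousMap.sub_apply]
    exact sub_mul_sub_nonneg_of_monotone
      (f := clampCube (n + 1)) (cube_mono.comp (clamp_mono _)) _ _
  rw [e, inner_add_left, ContinuousLinearMap.adjoint_inner_left]
  linarith [hc (w - z)]

theorem exists_lipschitz_truncOp (ν α μ : ℝ) {N : ℕ} (xbar x : Fin N → ℝ) (n : ℕ) :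
    ∃ C, ∀ w z : H1per L, ‖truncOp ν α μ xbar x n w - truncOp ν α μ xbar x n z‖ ≤ C * ‖w - z‖ := by
  set K : ℝ := ((4 * ((n : ℝ) + 1) ^ 2).toNNReal : ℝ)
  refine ⟨‖(linOp ν α μ xbar x : H1per L →L[ℝ] H1per L)‖
    + ‖(H1per.toL2 L)†‖ * (K * ‖H1per.toL2 L‖), fun w z => ?_⟩
  have h := lipschitzWith_clampCube (M := (n : ℝ) + 1) (by positivity)
  set F : H1per L → L2per L := fun v => h.compLp (clampCube_zero (by positivity)) (H1per.toL2 L v)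
    with hF
  have e : truncOp ν α μ xbar x n w - truncOp ν α μ xbar x n z
      = linOp ν α μ xbar x (w - z) + ((H1per.toL2 L)†) (F w - F z) := by
    simp only [truncOp, map_sub, hF]; abel
  rw [e, add_mul]
  refine (norm_add_le _ _).trans (add_le_add (ContinuousLinearMap.le_opNorm _ _) ?_)
  refine (ContinuousLinearMap.le_opNorm _ _).trans ?_
  rw [mul_assoc, mul_assoc]
  gcongr
  refine (h.norm_compLp_sub_le _ _ _).trans ?_
  rw [← map_sub]
  gcongr
  exact ContinuousLinearMap.le_opNorm _ _

theorem truncOp_zero (ν α μ : ℝ) {N : ℕ} (xbar x : Fin N → ℝ) (n : ℕ) :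
    truncOp ν α μ xbar x n (0 : H1per L) = 0 := by
  have h := lipschitzWith_clampCube (M := (n : ℝ) + 1) (by positivity)
  have h0 : h.compLp (clampCube_zero (by positivity)) (0 : L2per L) = 0 := by
    have := h.norm_compLp_le (clampCube_zero (by positivity)) (0 : L2per L)
    rw [norm_zero, mul_zero] at this
    exact norm_le_zero_iff.mp this
  rw [truncOp, map_zero, map_zero, h0, map_zero, add_zero]

theorem norm_nodalOp_sub_le (ν α μ : ℝ) {N : ℕ} (xbar x : Fin N → ℝ) {R : ℝ} {w z : H1per L}
    (hw : ‖H1per.toL2 L w‖ ≤ R) (hz : ‖H1per.toL2 L z‖ ≤ R) :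
    ‖nodalOp ν α μ xbar x w - nodalOp ν α μ xbar x z‖
      ≤ (‖(linOp ν α μ xbar x : H1per L →L[ℝ] H1per L)‖ + 2 * embConst L * R * (‖w‖ + ‖z‖))
        * ‖w - z‖ := by
  have hR : 0 ≤ R := (norm_nonneg _).trans hw
  have e : nodalOp ν α μ xbar x w - nodalOp ν α μ xbar x z
      = linOp ν α μ xbar x (w - z) + ((H1per.toL2 L)†) (cubeLp w - cubeLp z) := by
    simp only [nodalOp, map_sub]; abel
  rw [e, add_mul]
  refine (norm_add_le _ _).trans (add_le_add (ContinuousLinearMap.le_opNorm _ _) ?_)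
  refine (norm_adjoint_toL2_le _).trans ?_
  have h1 := integral_abs_cubeLp_sub_le w z
  have h2 := norm_rep_le w
  have h3 := norm_rep_le z
  have h4 := norm_toL2_le (w - z)
  calc √(embConst L) * ∫ y, |(cubeLp w - cubeLp z : L2per L) y|
      ≤ √(embConst L) * (2 * (√(embConst L) * ‖w‖ * R + √(embConst L) * ‖z‖ * R) * ‖w - z‖) := by
        gcongr
        refine h1.trans ?_
        gcongr
    _ = 2 * (√(embConst L) * √(embConst L)) * R * (‖w‖ + ‖z‖) * ‖w - z‖ := by ring
    _ = _ := by rw [Real.mul_self_sqrt embConst_pos.le]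

/-- On a ball of `L²_per` the growth is linear in the `H¹` norm, so `nodalOp` maps `L²(0,T;H¹_per)`
functions bounded in `L²_per` to `L²(0,T;H¹_per)`. -/
theorem norm_nodalOp_le (ν α μ : ℝ) {N : ℕ} (xbar x : Fin N → ℝ) {R : ℝ} {w : H1per L}
    (hw : ‖H1per.toL2 L w‖ ≤ R) :
    ‖nodalOp ν α μ xbar x w‖
      ≤ (‖(linOp ν α μ xbar x : H1per L →L[ℝ] H1per L)‖ + embConst L * R ^ 2) * ‖w‖ := by
  rw [nodalOp, add_mul]
  refine (norm_add_le _ _).trans (add_le_add (ContinuousLinearMap.le_opNorm _ _) ?_)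
  refine (norm_adjoint_toL2_le _).trans ?_
  have h1 := integral_abs_cubeLp_le w
  have h2 := norm_rep_le w
  calc √(embConst L) * ∫ y, |cubeLp w y|
      ≤ √(embConst L) * (√(embConst L) * ‖w‖ * R ^ 2) := by
        gcongr
        refine h1.trans ?_
        gcongr
    _ = (√(embConst L) * √(embConst L)) * R ^ 2 * ‖w‖ := by ring
    _ = _ := by rw [Real.mul_self_sqrt embConst_pos.le]

/-- The nodal feedback equation in integrated form has a solution in `L²(0, T; H¹_per)`. -/
theorem exists_integrated_solution {ν α μ c : ℝ} {N : ℕ} {xbar x : Fin N → ℝ} (hc : 0 < c)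
    (hcoer : ∀ w : H1per L, c * ‖w‖ ^ 2 ≤ ⟪linOp ν α μ xbar x w, w⟫) {T : ℝ} (hT : 0 ≤ T)
    (u₀ : L2per L) :
    ∃ u : L2time (H1per L) T,
      (∀ᵐ t ∂(volume.restrict (Ioc 0 T)), ‖H1per.toL2 L (u t)‖ ≤ ‖u₀‖) ∧
      ∀ᵐ t ∂(volume.restrict (Ioc 0 T)), ((H1per.toL2 L)†) (H1per.toL2 L (u t))
        = ((H1per.toL2 L)†) u₀ + ∫ s in (0 : ℝ)..t, -nodalOp ν α μ xbar x (u s) := by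
  have hκ := (embConst_pos (L := L)).le
  set R := ‖u₀‖ with hR
  have hR0 : 0 ≤ R := norm_nonneg _
  set Λ := ‖(linOp ν α μ xbar x : H1per L →L[ℝ] H1per L)‖
  have hΛ : 0 ≤ Λ := ContinuousLinearMap.opNorm_nonneg _
  have k1 : 0 ≤ 2 * embConst L * R := by positivity
  have k2 : 0 ≤ embConst L * R ^ 2 := by positivity
  have k3 : 0 ≤ √(embConst L) * (2 * (embConst L * R ^ 3)) := by positivity
  refine exists_evolution_of_approx injective_toL2 denseRange_toL2 hT hc (nodalOp_mono hcoer)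
    (truncOp_mono hcoer) (truncOp_zero ν α μ xbar x) (exists_lipschitz_truncOp ν α μ xbar x)
    -- One constant for the three bounds below: the sum of all the terms they require.
    (K := Λ + 2 * embConst L * R + embConst L * R ^ 2
      + √(embConst L) * (2 * (embConst L * R ^ 3))) ?_ ?_
    (continuous_nodalOp ν α μ xbar x) ?_ (by positivity)
  · intro w z hw hz
    refine (norm_nodalOp_sub_le ν α μ xbar x hw hz).trans ?_
    gcongr
    have hn : 0 ≤ ‖w‖ + ‖z‖ := by positivity
    nlinarith [mul_nonneg hΛ hn, mul_nonneg k2 hn, mul_nonneg k3 hn]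
  · intro n w hw
    refine (norm_truncOp_sub_nodalOp_le ν α μ xbar x n w).trans ?_
    have h1 := norm_rep_sq_le w
    -- Agmon's inequality gives a squared supremum linear in `‖w‖` when the `L²` norm is at most
    -- `R`. The bound `norm_rep_le` would only give `‖w‖²`, too large for the approximation
    -- hypothesis.
    calc √(embConst L) * (2 / ((n : ℝ) + 1) * (‖H1per.rep w‖ ^ 2 * ‖H1per.toL2 L w‖ ^ 2))
        ≤ √(embConst L) * (2 / ((n : ℝ) + 1) * (embConst L * (R * ‖w‖) * R ^ 2)) := by
          gcongr
          refine h1.trans ?_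
          gcongr
      _ = √(embConst L) * (2 * (embConst L * R ^ 3)) / ((n : ℝ) + 1) * ‖w‖ := by ring
      _ ≤ _ := by
          gcongr
          linarith
  · intro w hw
    refine (norm_nodalOp_le ν α μ xbar x hw).trans (mul_le_mul_of_nonneg_right ?_ (norm_nonneg _))
    rw [← hR]
    linarith

end Operator

/-! ### Test functions in time and the du Bois-Reymond lemma. -/

section TimeTest

theorem IsTimeTest.eq_zero_of_notMem {T : ℝ} {φ : ℝ → ℝ} (hφ : IsTimeTest T φ) {t : ℝ}
    (ht : t ∉ Ioo 0 T) : φ t = 0 :=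
  image_eq_zero_of_notMem_tsupport fun h => ht (hφ.2.2 h)

/-- Integration by parts for absolutely continuous functions; the boundary terms vanish with `φ`. -/
theorem IsTimeTest.integral_deriv_mul_primitive {T : ℝ} {φ : ℝ → ℝ}
    (hφ : IsTimeTest T φ) {p : ℝ → ℝ} (hp : IntervalIntegrable p volume 0 T) (c : ℝ) :
    ∫ t in (0 : ℝ)..T, deriv φ t * (c + ∫ s in (0 : ℝ)..t, p s)
      = -∫ t in (0 : ℝ)..T, φ t * p t := by
  have hac : AbsolutelyContinuousOnInterval (fun t => c + ∫ s in (0 : ℝ)..t, p s) 0 T :=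
    ((LipschitzWith.const c).lipschitzOnWith.absolutelyContinuousOnInterval).fun_add
      (hp.absolutelyContinuousOnInterval_intervalIntegral (by simp))
  have hac2 : AbsolutelyContinuousOnInterval φ 0 T :=
    (hφ.1.of_le (by simp)).contDiffOn.absolutelyContinuousOnInterval
  have h := hac.integral_mul_deriv_eq_deriv_mul hac2
  rw [hφ.eq_zero_of_notMem (t := T) (by simp), hφ.eq_zero_of_notMem (t := 0) (by simp)] at h
  simp only [mul_zero, sub_zero, zero_sub] at h
  have e1 : ∫ t in (0 : ℝ)..T, deriv φ t * (c + ∫ s in (0 : ℝ)..t, p s)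
      = ∫ t in (0 : ℝ)..T, (c + ∫ s in (0 : ℝ)..t, p s) * deriv φ t := by
    congr 1; funext t; ring
  rw [e1, h, neg_inj]
  apply intervalIntegral.integral_congr_ae
  filter_upwards [hp.ae_hasDerivAt_integral] with t ht htm
  rw [((ht (uIoc_subset_uIcc htm) 0 (by simp)).const_add c).deriv, mul_comm]

/-- A primitive of a test function of integral zero is a test function. -/
theorem IsTimeTest.primitive {T : ℝ} {ψ : ℝ → ℝ} (hψ : IsTimeTest T ψ)
    (h0 : ∫ t in (0 : ℝ)..T, ψ t = 0) :
    IsTimeTest T (fun t => ∫ s in (0 : ℝ)..t, ψ s) ∧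
      deriv (fun t => ∫ s in (0 : ℝ)..t, ψ s) = ψ := by
  set φ : ℝ → ℝ := fun t => ∫ s in (0 : ℝ)..t, ψ s with hφ
  have hψc : Continuous ψ := hψ.1.continuous
  have hd : ∀ t, HasDerivAt φ (ψ t) t := fun t => (hψc.integral_hasStrictDerivAt 0 t).hasDerivAt
  have hder : deriv φ = ψ := funext fun t => (hd t).deriv
  refine ⟨?_, hder⟩
  have hsm : ContDiff ℝ ∞ φ := by
    rw [contDiff_infty_iff_deriv, hder]
    exact ⟨fun t => (hd t).differentiableAt, hψ.1⟩
  -- The support is enclosed in a closed interval inside `(0, T)`. Left of `a` the primitive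
  -- vanishes with its integrand, right of `b` because the total integral is zero. If the support is
  -- empty, any `a > 0` and `b < T` serve.
  obtain ⟨a, b, ha, hb, hab⟩ : ∃ a b, 0 < a ∧ b < T ∧ tsupport ψ ⊆ Icc a b := by
    rcases (tsupport ψ).eq_empty_or_nonempty with he | hne
    · exact ⟨1, T - 1, one_pos, by linarith, by rw [he]; exact empty_subset _⟩
    · have hK : IsCompact (tsupport ψ) := hψ.2.1
      exact ⟨sInf (tsupport ψ), sSup (tsupport ψ), (hψ.2.2 (hK.sInf_mem hne)).1,
        (hψ.2.2 (hK.sSup_mem hne)).2, fun t ht =>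
          ⟨csInf_le hK.bddBelow ht, le_csSup hK.bddAbove ht⟩⟩
  have hz : ∀ t, t ∉ Icc a b → ψ t = 0 := fun t ht =>
    image_eq_zero_of_notMem_tsupport fun h => ht (hab h)
  have hsupp : tsupport φ ⊆ Icc a b := by
    refine closure_minimal (fun t ht => ?_) isClosed_Icc
    by_contra hnt
    apply ht
    rcases lt_or_ge t a with h1 | h1
    · simp only [hφ]
      rw [intervalIntegral.integral_zero_ae]
      refine Eventually.of_forall fun s hs => hz s fun hsI => ?_
      have : s ≤ max 0 t := hs.2
      exact absurd (this.trans_lt (max_lt ha h1)) (not_lt.mpr hsI.1)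
    · have h2 : b < t := by
        by_contra! h3
        exact hnt ⟨h1, h3⟩
      have h3 : ∫ s in t..T, ψ s = 0 := by
        rw [intervalIntegral.integral_zero_ae]
        refine Eventually.of_forall fun s hs => hz s fun hsI => ?_
        have : min t T < s := hs.1
        exact absurd ((lt_min h2 hb).trans this) (not_lt.mpr hsI.2)
      have h4 := intervalIntegral.integral_add_adjacent_intervals
        (hψc.intervalIntegrable (μ := volume) 0 t) (hψc.intervalIntegrable t T)
      rw [h3, h0, add_zero] at h4
      exact h4
  exact ⟨hsm, HasCompactSupport.of_support_subset_isCompact isCompact_Icc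
    (subset_closure.trans hsupp), hsupp.trans (Icc_subset_Ioo ha hb)⟩

theorem IsTimeTest.sub {T : ℝ} {φ ψ : ℝ → ℝ} (hφ : IsTimeTest T φ) (hψ : IsTimeTest T ψ) :
    IsTimeTest T (φ - ψ) :=
  ⟨hφ.1.sub hψ.1, hφ.2.1.sub hψ.2.1,
    (tsupport_sub φ ψ).trans (union_subset hφ.2.2 hψ.2.2)⟩

theorem IsTimeTest.const_mul {T : ℝ} {φ : ℝ → ℝ} (hφ : IsTimeTest T φ) (c : ℝ) :
    IsTimeTest T (fun t => c * φ t) :=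
  ⟨contDiff_const.mul hφ.1, hφ.2.1.mul_left,
    (tsupport_mul_subset_right (f := fun _ => c) (g := φ)).trans hφ.2.2⟩

theorem exists_isTimeTest_integral_eq_one {T : ℝ} (hT : 0 < T) :
    ∃ χ, IsTimeTest T χ ∧ ∫ t in (0 : ℝ)..T, χ t = 1 := by
  let f : ContDiffBump (T / 2) := ⟨T / 8, T / 4, by positivity, by linarith⟩
  have hsupp : tsupport (f.normed volume) ⊆ Ioo 0 T := by
    rw [f.tsupport_normed_eq, Real.closedBall_eq_Icc]
    exact Icc_subset_Ioo (by change 0 < T / 2 - T / 4; linarith)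
      (by change T / 2 + T / 4 < T; linarith)
  have htest : IsTimeTest T (f.normed volume) :=
    ⟨f.contDiff_normed, f.hasCompactSupport_normed, hsupp⟩
  refine ⟨f.normed volume, htest, ?_⟩
  rw [intervalIntegral.integral_eq_integral_of_support_subset
    (subset_closure.trans (hsupp.trans Ioo_subset_Ioc_self))]
  exact f.integral_normed

/-- The lemma of du Bois-Reymond. -/
theorem eq_of_integral_deriv_mul_eq_zero {T : ℝ} (hT : 0 < T) {h : ℝ → ℝ}
    (hc : ContinuousOn h (Icc 0 T))
    (h_int : ∀ φ, IsTimeTest T φ → ∫ t in (0 : ℝ)..T, deriv φ t * h t = 0) :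
    ∀ t ∈ Icc 0 T, h t = h 0 := by
  obtain ⟨χ, hχ, hχ1⟩ := exists_isTimeTest_integral_eq_one hT
  have hhi : ∀ {ψ : ℝ → ℝ}, Continuous ψ →
      IntervalIntegrable (fun t => ψ t * h t) volume 0 T := fun {ψ} hψ => by
    apply ContinuousOn.intervalIntegrable
    rw [uIcc_of_le hT.le]
    exact hψ.continuousOn.mul hc
  -- The constant that `h` must equal. Subtracting from `ψ` its integral times `χ` leaves a test
  -- function of integral zero, hence the derivative of a test function.
  set m := ∫ t in (0 : ℝ)..T, χ t * h t with hm
  have key : ∀ ψ, IsTimeTest T ψ → ∫ t in (0 : ℝ)..T, ψ t * (h t - m) = 0 := by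
    intro ψ hψ
    set I := ∫ t in (0 : ℝ)..T, ψ t with hI
    have hψc := hψ.1.continuous
    have hχc := hχ.1.continuous
    have ht : IsTimeTest T (ψ - fun t => I * χ t) := hψ.sub (hχ.const_mul I)
    have h0 : ∫ t in (0 : ℝ)..T, (ψ - fun t => I * χ t) t = 0 := by
      simp only [Pi.sub_apply]
      rw [intervalIntegral.integral_sub (hψc.intervalIntegrable _ _)
        ((hχc.intervalIntegrable _ _).const_mul I),
        intervalIntegral.integral_const_mul, hχ1, mul_one, sub_self]
    obtain ⟨hp, hpd⟩ := ht.primitive h0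
    have h1 := h_int _ hp
    rw [hpd] at h1
    have e1 : ∀ t, (ψ - fun t => I * χ t) t * h t = ψ t * h t - I * (χ t * h t) := fun t => by
      simp only [Pi.sub_apply]; ring
    simp only [e1] at h1
    rw [intervalIntegral.integral_sub (hhi hψc) ((hhi hχc).const_mul I),
      intervalIntegral.integral_const_mul] at h1
    have e2 : ∀ t, ψ t * (h t - m) = ψ t * h t - m * ψ t := fun t => by ring
    simp only [e2]
    rw [intervalIntegral.integral_sub (hhi hψc)
      ((hψc.intervalIntegrable _ _).const_mul m), intervalIntegral.integral_const_mul]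
    linarith
  have hae : ∀ᵐ t : ℝ, t ∈ Ioo 0 T → h t - m = 0 := by
    refine isOpen_Ioo.ae_eq_zero_of_integral_contDiff_smul_eq_zero
      (((hc.mono Ioo_subset_Icc_self).sub continuousOn_const).locallyIntegrableOn
        measurableSet_Ioo) fun ψ hψ hψc hψs => ?_
    have h1 := key ψ ⟨hψ, hψc, hψs⟩
    rw [intervalIntegral.integral_eq_integral_of_support_subset] at h1
    · exact h1
    · exact (Function.support_mul_subset_left _ _).trans
        (subset_closure.trans (hψs.trans Ioo_subset_Ioc_self))
  have hres : h =ᵐ[volume.restrict (Icc 0 T)] fun _ => m := by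
    rw [← restrict_Ioo_eq_restrict_Icc, Filter.EventuallyEq, ae_restrict_iff' measurableSet_Ioo]
    filter_upwards [hae] with t ht htm
    exact sub_eq_zero.mp (ht htm)
  have heq := Measure.eqOn_Icc_of_ae_eq volume hT.ne hres hc continuousOn_const
  intro t ht
  rw [heq ht, heq ⟨le_rfl, hT.le⟩]

end TimeTest

/-! ### Weak and integrated solutions: equivalence, uniqueness, globality, decay. -/

section Solution

variable {L : ℝ} [Fact (0 < L)] {ν α μ c : ℝ} {N : ℕ} {xbar x : Fin N → ℝ}

/-- The equation integrated in time, tested through the Riesz map of `H¹_per`. -/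
def IsIntegratedSolution (ν α μ : ℝ) {N : ℕ} (xbar x : Fin N → ℝ) (T : ℝ) (u₀ : L2per L)
    (u : ℝ → L2per L) : Prop :=
  ∃ U : ℝ → H1per L, MemLp U 2 (volume.restrict (Ioc 0 T)) ∧
    MemLp (fun t => nodalOp ν α μ xbar x (U t)) 2 (volume.restrict (Ioc 0 T)) ∧
    (∀ᵐ t ∂(volume.restrict (Ioc 0 T)), H1per.toL2 L (U t) = u t) ∧
    ∀ t ∈ Icc 0 T, ((H1per.toL2 L)†) (u t)
      = ((H1per.toL2 L)†) u₀ + ∫ s in (0 : ℝ)..t, -nodalOp ν α μ xbar x (U s)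

theorem IsIntegratedSolution.mono {T T' : ℝ} (hTT : T' ≤ T) {u₀ : L2per L} {u : ℝ → L2per L}
    (h : IsIntegratedSolution ν α μ xbar x T u₀ u) :
    IsIntegratedSolution ν α μ xbar x T' u₀ u := by
  obtain ⟨U, hU, hA, hae, heq⟩ := h
  have hm : volume.restrict (Ioc 0 T') ≤ volume.restrict (Ioc 0 T) :=
    Measure.restrict_mono (Ioc_subset_Ioc_right hTT) le_rfl
  exact ⟨U, hU.mono_measure hm, hA.mono_measure hm, ae_mono hm hae,
    fun t ht => heq t ⟨ht.1, ht.2.trans hTT⟩⟩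

theorem IsIntegratedSolution.congr {T : ℝ} {u₀ : L2per L} {u v : ℝ → L2per L}
    (h : IsIntegratedSolution ν α μ xbar x T u₀ u) (huv : EqOn u v (Icc 0 T)) :
    IsIntegratedSolution ν α μ xbar x T u₀ v := by
  obtain ⟨U, hU, hA, hae, heq⟩ := h
  refine ⟨U, hU, hA, ?_, fun t ht => by rw [← huv ht]; exact heq t ht⟩
  filter_upwards [hae, ae_restrict_mem measurableSet_Ioc] with t ht htm
  rw [ht, huv (Ioc_subset_Icc_self htm)]

theorem nodalOp_zero : nodalOp ν α μ xbar x (0 : H1per L) = 0 := by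
  have h : cubeLp (0 : H1per L) = 0 := by
    rw [cubeLp, ← repL_apply, map_zero, zero_pow three_ne_zero, map_zero]
  rw [nodalOp, h, map_zero, map_zero, add_zero]

/-- Solutions of the integrated equation are continuous in time and satisfy the energy identity. -/
theorem IsIntegratedSolution.continuous_energy {T : ℝ} (hT : 0 ≤ T) {u₀ : L2per L}
    {u : ℝ → L2per L} {U : ℝ → H1per L} (hU : MemLp U 2 (volume.restrict (Ioc 0 T)))
    (hA : MemLp (fun t => nodalOp ν α μ xbar x (U t)) 2 (volume.restrict (Ioc 0 T)))
    (hae : ∀ᵐ t ∂(volume.restrict (Ioc 0 T)), H1per.toL2 L (U t) = u t)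
    (heq : ∀ t ∈ Icc 0 T, ((H1per.toL2 L)†) (u t)
      = ((H1per.toL2 L)†) u₀ + ∫ s in (0 : ℝ)..t, -nodalOp ν α μ xbar x (U s)) :
    ContinuousOn u (Icc 0 T) ∧ u 0 = u₀ ∧ ∀ t ∈ Icc 0 T,
      ‖u t‖ ^ 2 = ‖u₀‖ ^ 2 - 2 * ∫ s in (0 : ℝ)..t, ⟪nodalOp ν α μ xbar x (U s), U s⟫ := by
  obtain ⟨w, hwc, hw0, -, hweq, hen⟩ := exists_continuous_energy injective_toL2 denseRange_toL2 hT
    hU hA.neg u₀ (by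
      filter_upwards [hae, ae_restrict_mem measurableSet_Ioc] with t ht htm
      rw [ht, heq t (Ioc_subset_Icc_self htm)]
      rfl)
  have huw : EqOn u w (Icc 0 T) := fun t ht => by
    apply adjoint_injective denseRange_toL2
    rw [heq t ht, hweq t ht]
    rfl
  refine ⟨hwc.congr huw, by rw [huw ⟨le_rfl, hT⟩, hw0], fun t ht => ?_⟩
  rw [huw ht, hen t ht]
  simp only [Pi.neg_apply, inner_neg_right, intervalIntegral.integral_neg]
  have : ∀ s, ⟪U s, nodalOp ν α μ xbar x (U s)⟫ = ⟪nodalOp ν α μ xbar x (U s), U s⟫ := fun s =>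
    real_inner_comm _ _
  simp only [this]
  ring

/-- The difference starts from zero, and by monotonicity the energy identity bounds its squared norm
by zero. -/
theorem IsIntegratedSolution.unique (hc : 0 < c)
    (hcoer : ∀ w : H1per L, c * ‖w‖ ^ 2 ≤ ⟪linOp ν α μ xbar x w, w⟫) {T : ℝ} (hT : 0 ≤ T)
    {u₀ : L2per L} {u v : ℝ → L2per L} (hu : IsIntegratedSolution ν α μ xbar x T u₀ u)
    (hv : IsIntegratedSolution ν α μ xbar x T u₀ v) : EqOn u v (Icc 0 T) := by
  obtain ⟨U, hU, hA, hae, heq⟩ := hu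
  obtain ⟨U', hU', hA', hae', heq'⟩ := hv
  have h_int : ∀ {f : ℝ → H1per L}, MemLp f 2 (volume.restrict (Ioc 0 T)) → ∀ {t}, t ∈ Icc 0 T →
      IntervalIntegrable f volume 0 t := by
    intro f hf t ht
    rw [intervalIntegrable_iff_integrableOn_Ioc_of_le ht.1]
    have h : IntegrableOn f (Ioc 0 T) := hf.integrable (by norm_num)
    exact h.mono_set (Ioc_subset_Ioc_right ht.2)
  have hdiff : ∀ t ∈ Icc 0 T, ((H1per.toL2 L)†) (u t - v t) = ((H1per.toL2 L)†) 0
      + ∫ s in (0 : ℝ)..t, (-nodalOp ν α μ xbar x (U s) - -nodalOp ν α μ xbar x (U' s)) := by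
    intro t ht
    have i1 : IntervalIntegrable (fun s => -nodalOp ν α μ xbar x (U s)) volume 0 t :=
      h_int hA.neg ht
    have i2 : IntervalIntegrable (fun s => -nodalOp ν α μ xbar x (U' s)) volume 0 t :=
      h_int hA'.neg ht
    rw [intervalIntegral.integral_sub i1 i2, map_sub, heq t ht,
      heq' t ht, map_zero, zero_add, add_sub_add_left_eq_sub]
  obtain ⟨w, -, -, -, hweq, hen⟩ := exists_continuous_energy injective_toL2 denseRange_toL2 hT
    (hU.sub hU') (hA.neg.sub hA'.neg) 0 (by
      filter_upwards [hae, hae', ae_restrict_mem measurableSet_Ioc] with t h1 h2 htm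
      rw [Pi.sub_apply, map_sub, h1, h2, hdiff t (Ioc_subset_Icc_self htm)]
      rfl)
  intro t ht
  have h1 : w t = u t - v t := by
    apply adjoint_injective denseRange_toL2
    rw [hweq t ht, hdiff t ht]
    rfl
  have h2 := hen t ht
  have h3 := intervalIntegral.integral_nonneg ht.1 (μ := volume)
    (f := fun s => -⟪(U - U') s, (-(fun t => nodalOp ν α μ xbar x (U t))
      - -fun t => nodalOp ν α μ xbar x (U' t)) s⟫) (fun s _ => by
        have h4 := nodalOp_mono hcoer (U s) (U' s)
        have h5 : 0 ≤ c * ‖U s - U' s‖ ^ 2 := by positivity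
        have e : -⟪(U - U') s, (-(fun t => nodalOp ν α μ xbar x (U t))
            - -fun t => nodalOp ν α μ xbar x (U' t)) s⟫
            = ⟪nodalOp ν α μ xbar x (U s) - nodalOp ν α μ xbar x (U' s), U s - U' s⟫ := by
          rw [← inner_neg_right, real_inner_comm]
          congr 1
          simp only [Pi.sub_apply, Pi.neg_apply]
          abel
        rw [e]
        linarith)
  rw [intervalIntegral.integral_neg] at h3
  rw [norm_zero] at h2
  have h6 : ‖w t‖ ^ 2 ≤ 0 := by linarith
  have h7 : w t = 0 := by
    rw [← norm_eq_zero]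
    nlinarith [norm_nonneg (w t)]
  rw [h1, sub_eq_zero] at h7
  exact h7

theorem memLp_nodalOp_of_bounded {T : ℝ} {U : ℝ → H1per L}
    (hU : MemLp U 2 (volume.restrict (Ioc 0 T))) {R : ℝ}
    (hb : ∀ᵐ t ∂(volume.restrict (Ioc 0 T)), ‖H1per.toL2 L (U t)‖ ≤ R) :
    MemLp (fun t => nodalOp ν α μ xbar x (U t)) 2 (volume.restrict (Ioc 0 T)) := by
  refine MemLp.of_le_mul hU
    ((continuous_nodalOp ν α μ xbar x).comp_aestronglyMeasurable hU.1)
    (c := ‖(linOp ν α μ xbar x : H1per L →L[ℝ] H1per L)‖ + embConst L * R ^ 2) ?_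
  filter_upwards [hb] with s hs
  exact norm_nodalOp_le ν α μ xbar x hs

theorem exists_isIntegratedSolution (hc : 0 < c)
    (hcoer : ∀ w : H1per L, c * ‖w‖ ^ 2 ≤ ⟪linOp ν α μ xbar x w, w⟫) {T : ℝ} (hT : 0 ≤ T)
    (u₀ : L2per L) : ∃ u, IsIntegratedSolution ν α μ xbar x T u₀ u := by
  obtain ⟨U, hb, hUeq⟩ := exists_integrated_solution hc hcoer hT u₀
  have hA : MemLp (fun t => nodalOp ν α μ xbar x (U t)) 2 (volume.restrict (Ioc 0 T)) :=
    memLp_nodalOp_of_bounded (Lp.memLp U) hb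
  obtain ⟨w, -, -, hae, hweq, -⟩ := exists_continuous_energy injective_toL2 denseRange_toL2 hT
    (Lp.memLp U) hA.neg u₀ hUeq
  exact ⟨w, U, Lp.memLp U, hA, hae, hweq⟩

theorem exists_global_isIntegratedSolution (hc : 0 < c)
    (hcoer : ∀ w : H1per L, c * ‖w‖ ^ 2 ≤ ⟪linOp ν α μ xbar x w, w⟫) (u₀ : L2per L) :
    ∃ u, ∀ T, 0 ≤ T → IsIntegratedSolution ν α μ xbar x T u₀ u := by
  choose u hu using fun n : ℕ =>
    exists_isIntegratedSolution (xbar := xbar) (x := x) hc hcoer (Nat.cast_nonneg n) u₀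
  -- At time `t` the solution built on `[0, ⌈t⌉₊]` is used. Uniqueness on `[0, t]` makes it agree
  -- with the solution on any longer interval.
  refine ⟨fun t => u ⌈t⌉₊ t, fun T hT => ?_⟩
  refine ((hu ⌈T⌉₊).mono (Nat.le_ceil T)).congr fun t ht => ?_
  exact IsIntegratedSolution.unique hc hcoer ht.1
    ((hu ⌈T⌉₊).mono (ht.2.trans (Nat.le_ceil T))) ((hu ⌈t⌉₊).mono (Nat.le_ceil t)) ⟨ht.1, le_rfl⟩

/-- Continuity on a compact interval gives the `L²_per` bound under which `nodalOp` of the solution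
is square-integrable in time. -/
theorem ae_norm_le_of_continuousOn {T : ℝ} {u : ℝ → L2per L} (hu : ContinuousOn u (Icc 0 T))
    {U : ℝ → H1per L} (hae : ∀ᵐ t ∂(volume.restrict (Ioc 0 T)), H1per.toL2 L (U t) = u t) :
    ∃ R, ∀ᵐ t ∂(volume.restrict (Ioc 0 T)), ‖H1per.toL2 L (U t)‖ ≤ R := by
  obtain ⟨R, hR⟩ := isCompact_Icc.exists_bound_of_continuousOn hu
  refine ⟨R, ?_⟩
  filter_upwards [hae, ae_restrict_mem measurableSet_Ioc] with t ht htm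
  rw [ht]
  exact hR t (Ioc_subset_Icc_self htm)

/-- A weak solution solves the integrated equation. -/
theorem IsSolution.isIntegratedSolution {T : ℝ} (hT : 0 < T) {u₀ : L2per L} {u : ℝ → L2per L}
    (h : IsSolution ν α μ xbar x T u₀ u) : IsIntegratedSolution ν α μ xbar x T u₀ u := by
  obtain ⟨hcont, hinit, -, U, hU, hae, hweak⟩ := h
  rw [restrict_Ioo_eq_restrict_Ioc] at hU hae
  obtain ⟨R, hR⟩ := ae_norm_le_of_continuousOn hcont hae
  have hA : MemLp (fun t => nodalOp ν α μ xbar x (U t)) 2 (volume.restrict (Ioc 0 T)) :=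
    memLp_nodalOp_of_bounded hU hR
  have hAi : IntervalIntegrable (fun t => nodalOp ν α μ xbar x (U t)) volume 0 T :=
    (intervalIntegrable_iff_integrableOn_Ioc_of_le hT.le).mpr (hA.integrable (by norm_num))
  refine ⟨U, hU, hA, hae, fun t ht => ?_⟩
  refine ext_inner_right ℝ fun v => ?_
  set p : ℝ → ℝ := fun s => ⟪nodalOp ν α μ xbar x (U s), v⟫ with hp
  have hpi : IntervalIntegrable p volume 0 T := ⟨hAi.1.inner_const v, hAi.2.inner_const v⟩
  -- By the weak equation, `⟪u t, v⟫ + ∫₀ᵗ p` has zero distributional derivative, so it keeps its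
  -- value at time `0`. The summand `0` matches the constant in `integral_deriv_mul_primitive`.
  have hconst := eq_of_integral_deriv_mul_eq_zero hT
    (h := fun t => ⟪u t, H1per.toL2 L v⟫ + (0 + ∫ s in (0 : ℝ)..t, p s)) (by
      refine (hcont.inner continuousOn_const).add (continuousOn_const.add ?_)
      have := intervalIntegral.continuousOn_primitive_interval' hpi (a := 0) (by simp)
      rwa [uIcc_of_le hT.le] at this) (fun φ hφ => by
      have h1 := hweak v φ hφ
      have h2 := hφ.integral_deriv_mul_primitive hpi 0
      have hφd : Continuous (deriv φ) := hφ.1.continuous_deriv (by simp)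
      simp only [mul_add (deriv φ _) (inner ℝ _ _)]
      rw [intervalIntegral.integral_add, h1, h2]
      · simp only [hp, inner_nodalOp]
        ring
      · apply ContinuousOn.intervalIntegrable
        rw [uIcc_of_le hT.le]
        exact hφd.continuousOn.mul (hcont.inner continuousOn_const)
      · apply ContinuousOn.intervalIntegrable
        exact hφd.continuousOn.mul (continuousOn_const.add
          (intervalIntegral.continuousOn_primitive_interval' hpi (by simp)))) t ht
  simp only [intervalIntegral.integral_same, add_zero, zero_add, hinit] at hconst
  have hAt : IntervalIntegrable (fun t => nodalOp ν α μ xbar x (U t)) volume 0 t :=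
    hAi.mono_set (by rw [uIcc_of_le ht.1, uIcc_of_le hT.le]; exact Icc_subset_Icc_right ht.2)
  rw [inner_add_left, ContinuousLinearMap.adjoint_inner_left,
    ContinuousLinearMap.adjoint_inner_left, intervalIntegral.integral_neg, inner_neg_left,
    ← hconst]
  have e : ⟪∫ s in (0 : ℝ)..t, nodalOp ν α μ xbar x (U s), v⟫ = ∫ s in (0 : ℝ)..t, p s := by
    have := (innerSL ℝ v).intervalIntegral_comp_comm hAt
    simp only [innerSL_apply_apply] at this
    rw [real_inner_comm, ← this]
    simp only [hp, real_inner_comm]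
  rw [e]
  ring

/-- The tested equation, for solutions of the integrated equation. -/
theorem integral_deriv_mul_inner {T : ℝ} (hT : 0 ≤ T) {u₀ : L2per L} {u : ℝ → L2per L}
    {U : ℝ → H1per L}
    (hA : MemLp (fun t => nodalOp ν α μ xbar x (U t)) 2 (volume.restrict (Ioc 0 T)))
    (heq : ∀ t ∈ Icc 0 T, ((H1per.toL2 L)†) (u t)
      = ((H1per.toL2 L)†) u₀ + ∫ s in (0 : ℝ)..t, -nodalOp ν α μ xbar x (U s))
    (v : H1per L) {φ : ℝ → ℝ} (hφ : IsTimeTest T φ) :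
    ∫ t in (0 : ℝ)..T, deriv φ t * ⟪u t, H1per.toL2 L v⟫
      = ∫ t in (0 : ℝ)..T, φ t * weakForm ν α μ xbar x (U t) v := by
  have hAi : IntervalIntegrable (fun t => -nodalOp ν α μ xbar x (U t)) volume 0 T :=
    (intervalIntegrable_iff_integrableOn_Ioc_of_le hT).mpr (hA.neg.integrable (by norm_num))
  set p : ℝ → ℝ := fun s => ⟪v, -nodalOp ν α μ xbar x (U s)⟫ with hp
  have hpi : IntervalIntegrable p volume 0 T := ⟨hAi.1.const_inner v, hAi.2.const_inner v⟩
  have h1 := hφ.integral_deriv_mul_primitive hpi ⟪u₀, H1per.toL2 L v⟫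
  have h2 : ∫ t in (0 : ℝ)..T, deriv φ t * ⟪u t, H1per.toL2 L v⟫
      = ∫ t in (0 : ℝ)..T, deriv φ t * (⟪u₀, H1per.toL2 L v⟫ + ∫ s in (0 : ℝ)..t, p s) := by
    refine intervalIntegral.integral_congr fun t ht => ?_
    rw [uIcc_of_le hT] at ht
    have hAt : IntervalIntegrable (fun t => -nodalOp ν α μ xbar x (U t)) volume 0 t :=
      hAi.mono_set (by rw [uIcc_of_le ht.1, uIcc_of_le hT]; exact Icc_subset_Icc_right ht.2)
    have e := (innerSL ℝ v).intervalIntegral_comp_comm hAt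
    simp only [innerSL_apply_apply] at e
    change deriv φ t * ⟪u t, H1per.toL2 L v⟫
      = deriv φ t * (⟪u₀, H1per.toL2 L v⟫ + ∫ s in (0 : ℝ)..t, p s)
    rw [e, ← ContinuousLinearMap.adjoint_inner_left, heq t ht, inner_add_left,
      ContinuousLinearMap.adjoint_inner_left, real_inner_comm v]
  rw [h2, h1, ← intervalIntegral.integral_neg]
  congr 1
  funext t
  rw [hp, ← inner_nodalOp]
  simp only [inner_neg_right, real_inner_comm v]
  ring

/-- The embedding `H¹_per → L⁴_per`. -/
def toL4 (L : ℝ) [Fact (0 < L)] : H1per L →L[ℝ] L4per L :=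
  (ContinuousMap.toLp 4 volume ℝ).comp (repL L)

theorem toL4_ae (w : H1per L) : ∀ᵐ y, toL4 L w y = H1per.rep w y :=
  ContinuousMap.coeFn_toLp (p := 4) (𝕜 := ℝ) volume (H1per.rep w)

/-- The interpolation `∫ w⁴ ≤ (sup |w|)² ∫ w²`: boundedness in `L²` and square-integrability in `H¹`
over time yield the `L⁴` class. -/
theorem norm_toL4_pow_le (w : H1per L) :
    ‖toL4 L w‖ ^ 4 ≤ embConst L * ‖H1per.toL2 L w‖ ^ 2 * ‖w‖ ^ 2 := by
  have h1 : ‖toL4 L w‖ ^ 4 = ∫ y, H1per.rep w y ^ 4 := by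
    rw [Lp.norm_def, (Lp.memLp (toL4 L w)).eLpNorm_eq_integral_rpow_norm (by norm_num) (by norm_num),
      ENNReal.toReal_ofReal (by positivity), ← Real.rpow_natCast, ← Real.rpow_mul (by positivity)]
    have e : ((4 : ENNReal).toReal)⁻¹ * ((4 : ℕ) : ℝ) = 1 := by norm_num
    rw [e, Real.rpow_one]
    apply integral_congr_ae
    filter_upwards [toL4_ae w] with y hy
    have e4 : (4 : ENNReal).toReal = ((4 : ℕ) : ℝ) := by norm_num
    rw [hy, e4, Real.rpow_natCast, Real.norm_eq_abs]
    exact Even.pow_abs (by decide) _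
  have h2 : ∫ y, H1per.rep w y ^ 4 ≤ ‖H1per.rep w‖ ^ 2 * ‖H1per.toL2 L w‖ ^ 2 := by
    rw [← integral_rep_sq, ← integral_const_mul]
    refine integral_mono (integrable_of_continuous ((H1per.rep w).continuous.pow 4))
      ((integrable_of_continuous ((H1per.rep w).continuous.pow 2)).const_mul _) fun y => ?_
    have e : H1per.rep w y ^ 4 = |H1per.rep w y| ^ 2 * H1per.rep w y ^ 2 := by
      rw [sq_abs]; ring
    change H1per.rep w y ^ 4 ≤ ‖H1per.rep w‖ ^ 2 * H1per.rep w y ^ 2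
    rw [e]
    gcongr
    exact (H1per.rep w).norm_coe_le_norm y
  have h3 := pow_le_pow_left₀ (norm_nonneg _) (norm_rep_le w) 2
  rw [mul_pow, Real.sq_sqrt embConst_pos.le] at h3
  rw [h1]
  refine h2.trans ?_
  calc ‖H1per.rep w‖ ^ 2 * ‖H1per.toL2 L w‖ ^ 2
      ≤ (embConst L * ‖w‖ ^ 2) * ‖H1per.toL2 L w‖ ^ 2 := by gcongr
    _ = _ := by ring

theorem memLp_toL4 {T : ℝ} {U : ℝ → H1per L} (hU : MemLp U 2 (volume.restrict (Ioc 0 T))) {R : ℝ}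
    (hb : ∀ᵐ t ∂(volume.restrict (Ioc 0 T)), ‖H1per.toL2 L (U t)‖ ≤ R) :
    MemLp (fun t => toL4 L (U t)) 4 (volume.restrict (Ioc 0 T)) := by
  have hm : AEStronglyMeasurable (fun t => toL4 L (U t)) (volume.restrict (Ioc 0 T)) :=
    (toL4 L).continuous.comp_aestronglyMeasurable hU.1
  rw [← integrable_norm_rpow_iff hm (by norm_num) (by norm_num)]
  have e4 : (4 : ENNReal).toReal = ((4 : ℕ) : ℝ) := by norm_num
  simp only [e4, Real.rpow_natCast]
  refine (hU.norm.integrable_sq.const_mul (embConst L * R ^ 2)).mono' (hm.norm.pow 4) ?_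
  filter_upwards [hb] with t ht
  rw [Real.norm_eq_abs, abs_of_nonneg (by positivity)]
  refine (norm_toL4_pow_le (U t)).trans ?_
  have := (embConst_pos (L := L)).le
  gcongr

/-- A solution of the integrated equation is a weak solution. -/
theorem IsIntegratedSolution.isSolution {T : ℝ} (hT : 0 < T) {u₀ : L2per L} {u : ℝ → L2per L}
    (h : IsIntegratedSolution ν α μ xbar x T u₀ u) : IsSolution ν α μ xbar x T u₀ u := by
  obtain ⟨U, hU, hA, hae, heq⟩ := h
  obtain ⟨hcont, hinit, -⟩ := IsIntegratedSolution.continuous_energy hT.le hU hA hae heq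
  obtain ⟨R, hR⟩ := ae_norm_le_of_continuousOn hcont hae
  refine ⟨hcont, hinit, ⟨fun t => toL4 L (U t), ?_, ?_⟩, U, ?_, ?_, ?_⟩
  · rw [restrict_Ioo_eq_restrict_Ioc]
    exact memLp_toL4 hU hR
  · rw [restrict_Ioo_eq_restrict_Ioc]
    filter_upwards [hae] with t ht
    filter_upwards [toL4_ae (U t), H1per.rep_ae_eq (U t)] with y h1 h2
    rw [h1, h2, ht]
  · rw [restrict_Ioo_eq_restrict_Ioc]
    exact hU
  · rw [restrict_Ioo_eq_restrict_Ioc]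
    exact hae
  · exact fun v φ hφ => integral_deriv_mul_inner hT.le hA heq v hφ

theorem continuous_toHneg1 : Continuous (toHneg1 : L2per L → Hneg1per L) :=
  (innerSL ℝ).continuous.clm_comp continuous_const

set_option maxSynthPendingDepth 6 in
theorem IsIntegratedSolution.timeDerivMemL2Hneg1 {T : ℝ} (hT : 0 < T) {u₀ : L2per L}
    {u : ℝ → L2per L} (h : IsIntegratedSolution ν α μ xbar x T u₀ u) : TimeDerivMemL2Hneg1 T u := by
  obtain ⟨U, hU, hA, hae, heq⟩ := h
  obtain ⟨hcont, -, -⟩ := IsIntegratedSolution.continuous_energy hT.le hU hA hae heq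
  have hg : MemLp (fun t => innerSL ℝ (-nodalOp ν α μ xbar x (U t))) 2
      (volume.restrict (Ioc 0 T)) := (innerSL ℝ).comp_memLp' hA.neg
  -- The time derivative is `-𝒜 U`, turned into a functional by the Riesz map; evaluated at `v`, the
  -- identity is the tested equation.
  refine ⟨fun t => innerSL ℝ (-nodalOp ν α μ xbar x (U t)), ?_, fun φ hφ => ?_⟩
  · rw [restrict_Ioo_eq_restrict_Ioc]
    exact hg
  · have hφd : Continuous (deriv φ) := hφ.1.continuous_deriv (by simp)
    have i1 : IntervalIntegrable (fun t => deriv φ t • toHneg1 (u t)) volume 0 T := by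
      apply ContinuousOn.intervalIntegrable
      rw [uIcc_of_le hT.le]
      exact hφd.continuousOn.smul (continuous_toHneg1.comp_continuousOn hcont)
    have i2 : IntervalIntegrable (fun t => φ t • innerSL ℝ (-nodalOp ν α μ xbar x (U t)))
        volume 0 T := by
      have h1 : IntervalIntegrable (fun t => innerSL ℝ (-nodalOp ν α μ xbar x (U t))) volume 0 T :=
        (intervalIntegrable_iff_integrableOn_Ioc_of_le hT.le).mpr (hg.integrable (by norm_num))
      exact h1.continuousOn_smul hφ.1.continuous.continuousOn
    ext v
    rw [neg_apply, ContinuousLinearMap.intervalIntegral_apply i1,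
      ContinuousLinearMap.intervalIntegral_apply i2, ← intervalIntegral.integral_neg]
    refine (integral_deriv_mul_inner hT.le hA heq v hφ).trans ?_
    congr 1
    funext t
    rw [← inner_nodalOp, smul_apply, innerSL_apply_apply, inner_neg_left, smul_eq_mul, mul_neg,
      neg_neg]

/-- The norm in `L²_per` is nonincreasing, so the dissipation up to time `T` is at least `cT‖u T‖²`,
while the energy identity bounds twice the dissipation by `‖u₀‖²`. The resulting algebraic rate
suffices for the limit. -/
theorem IsIntegratedSolution.decay (hc : 0 < c)
    (hcoer : ∀ w : H1per L, c * ‖w‖ ^ 2 ≤ ⟪linOp ν α μ xbar x w, w⟫) {T : ℝ} (hT : 0 ≤ T)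
    {u₀ : L2per L} {u : ℝ → L2per L} (h : IsIntegratedSolution ν α μ xbar x T u₀ u) :
    2 * c * T * ‖u T‖ ^ 2 ≤ ‖u₀‖ ^ 2 := by
  obtain ⟨U, hU, hA, hae, heq⟩ := h
  obtain ⟨hcont, -, hen⟩ := IsIntegratedSolution.continuous_energy hT hU hA hae heq
  set D : ℝ → ℝ := fun s => ⟪nodalOp ν α μ xbar x (U s), U s⟫ with hD
  have hDi : IntervalIntegrable D volume 0 T :=
    (intervalIntegrable_iff_integrableOn_Ioc_of_le hT).mpr (integrable_inner_of_memLp hA hU)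
  have hDc : ∀ s, c * ‖U s‖ ^ 2 ≤ D s := fun s => by
    have := nodalOp_mono hcoer (U s) 0
    rwa [nodalOp_zero, sub_zero, sub_zero] at this
  have hD0 : ∀ s, 0 ≤ D s := fun s => le_trans (by positivity) (hDc s)
  have hle : ∀ s ∈ Icc 0 T, ‖u T‖ ^ 2 ≤ ‖u s‖ ^ 2 := by
    intro s hs
    have h1 := intervalIntegral.integral_mono_interval le_rfl hs.1 hs.2
      (Eventually.of_forall hD0) hDi
    linarith [hen s hs, hen T ⟨hT, le_rfl⟩]
  have h2 : ∫ _ in (0 : ℝ)..T, c * ‖u T‖ ^ 2 ≤ ∫ s in (0 : ℝ)..T, D s := by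
    refine intervalIntegral.integral_mono_ae_restrict hT (by simp) hDi ?_
    rw [← restrict_Ioc_eq_restrict_Icc]
    filter_upwards [hae, ae_restrict_mem measurableSet_Ioc] with s hs hsm
    refine le_trans ?_ (hDc s)
    have h3 := pow_le_pow_left₀ (norm_nonneg _) (norm_toL2_le (U s)) 2
    rw [hs] at h3
    have h4 := hle s (Ioc_subset_Icc_self hsm)
    exact mul_le_mul_of_nonneg_left (h4.trans h3) hc.le
  rw [intervalIntegral.integral_const, smul_eq_mul, sub_zero] at h2
  have h5 := hen T ⟨hT, le_rfl⟩
  nlinarith [sq_nonneg ‖u T‖]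

theorem tendsto_norm_of_decay {u : ℝ → L2per L} {K : ℝ} (hc : 0 < c)
    (h : ∀ T, 0 ≤ T → 2 * c * T * ‖u T‖ ^ 2 ≤ K) : Tendsto (fun t => ‖u t‖) atTop (𝓝 0) := by
  have h1 : Tendsto (fun t : ℝ => K / (2 * c) / t) atTop (𝓝 0) :=
    tendsto_const_nhds.div_atTop tendsto_id
  have h2 : Tendsto (fun t => ‖u t‖ ^ 2) atTop (𝓝 0) := by
    refine squeeze_zero' (Eventually.of_forall fun t => sq_nonneg _) ?_ h1
    filter_upwards [eventually_gt_atTop 0] with t ht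
    rw [div_div, le_div_iff₀ (by positivity)]
    linarith [h t ht.le]
  simpa using h2.sqrt

end Solution

end NodalFeedback

end

theorem mainTheorem3 (L : ℝ) [Fact (0 < L)] (ν α μ : ℝ) (hα : 0 < α)
    (N : ℕ) (hN : 0 < N) (xbar x : Fin N → ℝ)
    (hxbar : ∀ k : Fin N, xbar k ∈ Set.Icc ((k : ℝ) * (L / N)) (((k : ℝ) + 1) * (L / N)))
    (hx : ∀ k : Fin N, x k ∈ Set.Icc ((k : ℝ) * (L / N)) (((k : ℝ) + 1) * (L / N)))
    (hμ : 4 * α < μ) (hν : 2 * μ * (L / N) ^ 2 ≤ ν) (u₀ : NodalFeedback.L2per L) :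
    ∃ u : ℝ → NodalFeedback.L2per L,
      (∀ T : ℝ, 0 < T →
        NodalFeedback.IsSolution ν α μ xbar x T u₀ u ∧
        NodalFeedback.TimeDerivMemL2Hneg1 T u ∧
        ∀ v : ℝ → NodalFeedback.L2per L, NodalFeedback.IsSolution ν α μ xbar x T u₀ v →
          Set.EqOn v u (Set.Icc 0 T)) ∧
      Filter.Tendsto (fun t => ‖u t‖) Filter.atTop (nhds 0) := by
  obtain ⟨c, hc, hcoer⟩ := NodalFeedback.exists_coercive (L := L) hα hN hxbar hx hμ hν
  obtain ⟨u, hu⟩ := NodalFeedback.exists_global_isIntegratedSolution hc hcoer u₀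
  refine ⟨u, fun T hT => ⟨(hu T hT.le).isSolution hT, (hu T hT.le).timeDerivMemL2Hneg1 hT,
    fun v hv => (hv.isIntegratedSolution hT).unique hc hcoer hT.le (hu T hT.le)⟩, ?_⟩
  exact NodalFeedback.tendsto_norm_of_decay hc fun T hT => (hu T hT).decay hc hcoer hT
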